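/- Let $\gamma>1$, $\psi(z)=|z|^2+\gamma\,\mathrm{Re}\,z^2$, and $S=\{(z,w)\in\mathbb C^2: w=\psi(z)\}$. Let $\tau_1,\tau_2$ be the antiholomorphic reflections of $\mathbb C^2$ in the totally real planes $\{w=\bar z\}$ and $\{w=-\bar z-(2/\gamma)z\}$, and suppose that they generate a finite dihedral group. Let $W$ be an open neighbourhood of the origin in $\mathbb C^2$ and $\rho:W\to\mathbb R$ a $C^2$ function such that $d\rho\neq0$ on $\{\rho=0\}$, the hypersurface $\{\rho=0\}$ is strictly Levi convex (the Levi form of $\rho$ is positive on its nonzero complex tangent vectors) and $S\cap W\subset\{\rho=0\}$. (That is, the origin is a good hyperbolic point of the surface $S$ in the boundary of $\{\rho<0\}$.) A hyperbolic disc in $W$ through the origin is a continuous map $f:\Omega\to W$, where $\Omega$ is a relatively open subset of the closed unit disc $\overline{\mathbb D}$, such that $f$ is proper as a map to $W$, $f$ is holomorphic on $\Omega\cap\mathbb D$, $f(\Omega\cap\mathbb D)\subset\{\rho<0\}$, $f(\Omega\cap\partial\mathbb D)\subset S$, and $f^{-1}(0)$ is finite and non-empty. (This is the part in $W$, or a connected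 component of that part, of a disc that is continuous on $\overline{\mathbb D}$, has its boundary in the surface, and meets hyperbolic points at finitely many boundary points.) Lemma. Let $f_1,f_2$ be hyperbolic discs in $W$ through the origin, defined on $\Omega_1,\Omega_2$. Then for every sufficiently small open neighbourhood $U$ of the origin the following holds. Suppose that, for $j=1,2$, the set $f_j(\Omega_j\cap\mathbb D)\cap U$ is the graph $\{w=g_j(z): z\in D_j\}$ of a holomorphic function $g_j$ on a domain (a non-empty connected open set) $D_j\subset\mathbb C$, and that one of the following conditions is satisfied: (i) $D_1=D_2$; (ii) $D_1\subset D_2$ and $\mathrm{Re}\,g_1(z)\le\mathrm{Re}\,g_2(z)$ for all $z\in D_1$. Then the two discs coincide in $U$: $f_1(\Omega_1\cap\mathbb D)\cap U=f_2(\Omega_2\cap\mathbb D)\cap U$ (equivalently, $D_1=D_2$ and $g_1=g_2$). -/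

import Mathlib

open Set Filter Topology

namespace HyperbolicDiscs

/-- The model function `ψ(z) = z z̄ + γ Re z²`. -/
noncomputable def psi (γ : ℝ) (z : ℂ) : ℝ := Complex.normSq z + γ * (z ^ 2).re

/-- The model quadric `w = ψ(z)` in `ℂ²`, i.e. the real surface near the hyperbolic point `0`.
For `γ > 1` it is totally real at each of its points except the origin, which is hyperbolic. -/
def quadric (γ : ℝ) : Set (ℂ × ℂ) := {p | p.2 = (psi γ p.1 : ℂ)}

/-- The antiholomorphic reflection of `ℂ²` in the totally real plane `E₁ = {w = z̄}`. -/
def reflection₁ (p : ℂ × ℂ) : ℂ × ℂ := (star p.2, star p.1)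

/-- The antiholomorphic reflection of `ℂ²` in the totally real plane
`E₂ = {w = - z̄ - (2/γ) z}`. Together, `E₁` and `E₂` form the preimage of the quadric under
`(z, w) ↦ (z, z w + (γ/2) (z² + w²))`. -/
noncomputable def reflection₂ (γ : ℝ) (p : ℂ × ℂ) : ℂ × ℂ :=
  (-((2 / γ : ℝ) : ℂ) * star p.1 - star p.2,
    (((2 / γ : ℝ) : ℂ) ^ 2 - 1) * star p.1 + ((2 / γ : ℝ) : ℂ) * star p.2)

theorem reflection₁_involutive : Function.Involutive reflection₁ := by
  intro p
  simp [reflection₁]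

theorem reflection₂_involutive (γ : ℝ) : Function.Involutive (reflection₂ γ) := by
  intro p
  ext1
  · simp only [reflection₂, Complex.star_def, map_sub, map_add, map_mul, map_neg, map_pow, map_one,
      Complex.conj_ofReal, Complex.conj_conj]
    ring
  · simp only [reflection₂, Complex.star_def, map_sub, map_add, map_mul, map_neg, map_pow, map_one,
      Complex.conj_ofReal, Complex.conj_conj]
    ring

/-- The group of transformations of `ℂ²` generated by the two reflections. -/
noncomputable def reflectionGroup (γ : ℝ) : Subgroup (Equiv.Perm (ℂ × ℂ)) :=
  Subgroup.closure {reflection₁_involutive.toPerm, (reflection₂_involutive γ).toPerm}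

/-- The set `Λ` of the parameters `γ > 0` for which the two reflections generate a finite
dihedral group. -/
def goodParameters : Set ℝ :=
  {γ | 0 < γ ∧ ∃ n : ℕ, 0 < n ∧ Nonempty (reflectionGroup γ ≃* DihedralGroup n)}

/-- The Levi form (up to the factor `4`) of a real function `ρ` at `p` in the direction `v`. -/
noncomputable def leviForm (ρ : ℂ × ℂ → ℝ) (p v : ℂ × ℂ) : ℝ :=
  fderiv ℝ (fderiv ℝ ρ) p v v + fderiv ℝ (fderiv ℝ ρ) p (Complex.I • v) (Complex.I • v)

/-- In a coordinate neighbourhood `W` of the origin in `ℂ²` (with the standard complex structure)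
the manifold with boundary is `{ρ ≤ 0}`, its boundary `{ρ = 0}` is strictly Levi convex and contains
the real surface, which is the quadric `w = ψ(z)`; the origin is a good hyperbolic point. -/
structure IsGoodHyperbolicOrigin (γ : ℝ) (ρ : ℂ × ℂ → ℝ) (W : Set (ℂ × ℂ)) : Prop where
  one_lt : 1 < γ
  mem_goodParameters : γ ∈ goodParameters
  isOpen : IsOpen W
  zero_mem : (0 : ℂ × ℂ) ∈ W
  contDiffOn : ContDiffOn ℝ 2 ρ W
  fderiv_ne_zero : ∀ p ∈ W, ρ p = 0 → fderiv ℝ ρ p ≠ 0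
  strictly_levi_convex : ∀ p ∈ W, ρ p = 0 → ∀ v : ℂ × ℂ, v ≠ 0 →
    fderiv ℝ ρ p v = 0 → fderiv ℝ ρ p (Complex.I • v) = 0 → 0 < leviForm ρ p v
  quadric_subset : ∀ p ∈ W, p ∈ quadric γ → ρ p = 0

/-- A hyperbolic disc in the coordinate neighbourhood `W`, touching the hyperbolic point `0`.
If `F` is a hyperbolic disc (continuous on the closed unit disc, holomorphic inside, with the open
disc mapped into the interior of the manifold, the circle mapped into the real surface, and
finitely many points of the circle mapped to hyperbolic points), then `f` is `F` read in the
coordinates and `Ω` is the set of the points of the closed unit disc mapped by `F` into `W`, or a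
connected component of that set. The field `proper` expresses that `f` leaves `W` at the
ends of `Ω`. -/
structure IsHyperbolicDisc (γ : ℝ) (ρ : ℂ × ℂ → ℝ) (W : Set (ℂ × ℂ)) (Ω : Set ℂ)
    (f : ℂ → ℂ × ℂ) : Prop where
  relatively_open : ∃ O : Set ℂ, IsOpen O ∧ Ω = O ∩ Metric.closedBall 0 1
  mapsTo : MapsTo f Ω W
  proper : ∀ K ⊆ W, IsCompact K → IsCompact (Ω ∩ f ⁻¹' K)
  continuousOn : ContinuousOn f Ω
  holomorphic : DifferentiableOn ℂ f (Ω ∩ Metric.ball 0 1)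
  interior : ∀ ζ ∈ Ω ∩ Metric.ball 0 1, ρ (f ζ) < 0
  boundary : ∀ ζ ∈ Ω ∩ Metric.sphere 0 1, f ζ ∈ quadric γ
  finite_hyperbolic : {ζ ∈ Ω | f ζ = 0}.Finite
  touches : ∃ ζ ∈ Ω, f ζ = 0

/-- The image of the open disc. -/
def discImage (Ω : Set ℂ) (f : ℂ → ℂ × ℂ) : Set (ℂ × ℂ) := f '' (Ω ∩ Metric.ball 0 1)

/-- `Y` is the graph `w = g(z)` of a holomorphic function `g` over a domain `D` of `ℂ`. -/
structure IsHolomorphicGraph (Y : Set (ℂ × ℂ)) (D : Set ℂ) (g : ℂ → ℂ) : Prop where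
  isOpen : IsOpen D
  isConnected : IsConnected D
  holomorphic : DifferentiableOn ℂ g D
  eq_graph : Y = (fun z => (z, g z)) '' D

end HyperbolicDiscs

/-! Near a preimage of the origin a disc is read on a half-disc as `s ↦ (z, w)`, with `w = ψ(z)`
real on the flat part. If this is a piece of the first disc, the two discs are compared through
`h(s) = g₂(z(s)) - w(s)`, where `g₂` is extended by `ψ` off `D₂`; properness makes the extension
continuous (`continuousOn_extendByPsi`). Once `h = 0`, the identity theorem gives `g₁ = g₂` on `D₁`.
Moreover `D₁` is relatively closed in `D₂`, since a limit of points of the first disc lies in that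
disc or on the surface, where `ρ = 0`; hence the graphs coincide (`graph_eq_of_half_disc`).

If `D₁ = D₂`, flat points project outside the common domain, so `h` vanishes on the flat part and
Schwarz reflection gives `h = 0`.

In the ordered case `Re h ≥ 0`. At a flat point either `h = 0` or `h = g₂ - ψ`, with imaginary part
`Im g₂`. On a disc `Im w` is negligible against `ρ`, and `|ρ|` is at most a multiple of `|w -
ψ(z)|`, so the flat values of `h` become tangent to the real axis. A Phragmén–Lindelöf argument then
makes `arg h` small near `0`. If `h` is not zero, every power of it has positive real part inside a
small half-disc, and Hopf's lemma gives `|h(it)|^p ≥ c t` for every `p`, with `c` depending on `p`.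
But `|h(it)|^n ≤ C t` for some `n`, which is absurd for `p = n + 1` (`eq_zero_of_flat_im_le`).

Three facts about a single disc carry this. First, `w = O(z²)` (`exists_norm_w_le`): the sign of `w`
is constant on each side of `0`, which bounds `arg z` there, and the maximum principle applies to `w
/ z²`. Second, `Im w` is negligible (`exists_abs_im_le`): a sector argument shows that `|z|²`
dominates every multiple of `Im s`, strict plurisubharmonicity of `ρ + Cρ²` transfers this to `-ρ`,
while reflection gives `|Im w| ≤ C Im s`. Third, `|z(it)|^n ≤ C √t` (`exists_pow_le_sqrt`):
finiteness of the reflection group makes the directions of the lines `ψ = 0` roots of unity, so some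
`z^n` is nearly real where `ψ(z)` is small. -/

namespace HyperbolicDiscs

/-! ### Half-discs and the maximum principle -/

/-- The open upper half-disc of radius `R`. -/
def hd (R : ℝ) : Set ℂ := {s | ‖s‖ < R ∧ 0 < s.im}

/-- The closed upper half-disc of radius `R`. -/
def chd (R : ℝ) : Set ℂ := {s | ‖s‖ ≤ R ∧ 0 ≤ s.im}

theorem isOpen_hd (R : ℝ) : IsOpen (hd R) :=
  (isOpen_lt continuous_norm continuous_const).inter (isOpen_lt continuous_const Complex.continuous_im)

theorem isClosed_chd (R : ℝ) : IsClosed (chd R) :=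
  (isClosed_le continuous_norm continuous_const).inter
    (isClosed_le continuous_const Complex.continuous_im)

theorem isCompact_chd (R : ℝ) : IsCompact (chd R) := by
  refine (isCompact_closedBall (0 : ℂ) R).of_isClosed_subset (isClosed_chd R) fun s hs => ?_
  simpa using hs.1

theorem hd_subset_chd (R : ℝ) : hd R ⊆ chd R := fun _ hs => ⟨hs.1.le, hs.2.le⟩

theorem chd_mono {r R : ℝ} (h : r ≤ R) : chd r ⊆ chd R := fun _ hs => ⟨hs.1.trans h, hs.2⟩

theorem hd_mono {r R : ℝ} (h : r ≤ R) : hd r ⊆ hd R := fun _ hs => ⟨hs.1.trans_le h, hs.2⟩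

theorem zero_mem_chd {R : ℝ} (hR : 0 ≤ R) : (0 : ℂ) ∈ chd R := by simp [chd, hR]

theorem mem_hd_of_mem_chd {R : ℝ} {s : ℂ} (hs : s ∈ chd R) (h1 : ‖s‖ ≠ R) (h2 : s.im ≠ 0) :
    s ∈ hd R := ⟨lt_of_le_of_ne hs.1 h1, lt_of_le_of_ne hs.2 (Ne.symm h2)⟩

theorem convex_hd (R : ℝ) : Convex ℝ (hd R) := by
  have h1 : Convex ℝ {s : ℂ | ‖s‖ < R} := by
    have e : {s : ℂ | ‖s‖ < R} = Metric.ball 0 R := by ext s; simp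
    rw [e]
    exact convex_ball (0 : ℂ) R
  exact h1.inter (convex_halfSpace_im_gt 0)

theorem I_mul_mem_hd {t R : ℝ} (h0 : 0 < t) (h : t < R) : (t : ℂ) * Complex.I ∈ hd R := by
  simp [hd, abs_of_pos h0, h0, h]

/-! ### Laplacians along the coordinate lines, and Hopf's lemma -/

/-- Twice differentiability at `0` of a real function, with second derivative `A`. -/
def HasDeriv2At (φ : ℝ → ℝ) (A : ℝ) : Prop :=
  ∃ φ' : ℝ → ℝ, (∀ᶠ τ in 𝓝 0, HasDerivAt φ (φ' τ) τ) ∧ HasDerivAt φ' A 0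

theorem HasDeriv2At.add {φ χ : ℝ → ℝ} {A B : ℝ} (h : HasDeriv2At φ A) (k : HasDeriv2At χ B) :
    HasDeriv2At (fun τ => φ τ + χ τ) (A + B) := by
  obtain ⟨φ', h1, h2⟩ := h
  obtain ⟨χ', k1, k2⟩ := k
  refine ⟨fun τ => φ' τ + χ' τ, ?_, h2.add k2⟩
  filter_upwards [h1, k1] with τ a b using a.add b

theorem HasDeriv2At.const_mul {φ : ℝ → ℝ} {A : ℝ} (c : ℝ) (h : HasDeriv2At φ A) :
    HasDeriv2At (fun τ => c * φ τ) (c * A) := by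
  obtain ⟨φ', h1, h2⟩ := h
  refine ⟨fun τ => c * φ' τ, ?_, h2.const_mul c⟩
  filter_upwards [h1] with τ a using a.const_mul c

theorem HasDeriv2At.mul {φ χ φ' χ' : ℝ → ℝ} {A B : ℝ}
    (h1 : ∀ᶠ τ in 𝓝 0, HasDerivAt φ (φ' τ) τ) (h2 : HasDerivAt φ' A 0)
    (k1 : ∀ᶠ τ in 𝓝 0, HasDerivAt χ (χ' τ) τ) (k2 : HasDerivAt χ' B 0) :
    HasDeriv2At (fun τ => φ τ * χ τ) (A * χ 0 + 2 * (φ' 0 * χ' 0) + φ 0 * B) := by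
  refine ⟨fun τ => φ' τ * χ τ + φ τ * χ' τ, ?_, ?_⟩
  · filter_upwards [h1, k1] with τ a b using a.mul b
  · have := (h2.mul k1.self_of_nhds).add (h1.self_of_nhds.mul k2)
    refine this.congr_deriv ?_
    ring

/-- If `A > 0`, the second derivative test makes `0` a local minimum too, so `φ` is locally constant
and `A = 0`. -/
theorem HasDeriv2At.nonpos_of_isLocalMax {φ : ℝ → ℝ} {A : ℝ} (h : HasDeriv2At φ A)
    (hm : IsLocalMax φ 0) : A ≤ 0 := by
  obtain ⟨φ', h1, h2⟩ := h
  by_contra! hA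
  have h0 : φ' 0 = 0 := hm.hasDerivAt_eq_zero h1.self_of_nhds
  have e : ∀ᶠ τ in 𝓝 (0 : ℝ), deriv φ τ = φ' τ := h1.mono fun τ a => a.deriv
  have hd : deriv (deriv φ) 0 = A := by
    rw [Filter.EventuallyEq.deriv_eq (show deriv φ =ᶠ[𝓝 0] φ' from e)]; exact h2.deriv
  have hmin := isLocalMin_of_deriv_deriv_pos (f := φ) (x₀ := 0) (by rw [hd]; exact hA)
    (by rw [e.self_of_nhds, h0]) h1.self_of_nhds.continuousAt
  have hc : φ =ᶠ[𝓝 0] fun _ => φ 0 := by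
    filter_upwards [hm, hmin] with τ a b using le_antisymm a b
  have hc1 : deriv φ =ᶠ[𝓝 0] fun _ => 0 := by
    filter_upwards [hc.deriv] with τ hτ
    rw [hτ]; simp
  rw [hc1.deriv_eq] at hd
  simp at hd
  exact hA.ne hd

/-- `q` has second derivatives at `s` in the two coordinate directions, with sum `c`. -/
def HasLaplacianAt (q : ℂ → ℝ) (s : ℂ) (c : ℝ) : Prop :=
  ∃ A B : ℝ, A + B = c ∧ HasDeriv2At (fun τ => q (s + τ * 1)) A ∧
    HasDeriv2At (fun τ => q (s + τ * Complex.I)) B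

theorem HasLaplacianAt.add {q p : ℂ → ℝ} {s : ℂ} {c d : ℝ} (h : HasLaplacianAt q s c)
    (k : HasLaplacianAt p s d) : HasLaplacianAt (fun s => q s + p s) s (c + d) := by
  obtain ⟨A, B, rfl, h1, h2⟩ := h
  obtain ⟨A', B', rfl, k1, k2⟩ := k
  exact ⟨A + A', B + B', by ring, h1.add k1, h2.add k2⟩

theorem HasLaplacianAt.const_mul {q : ℂ → ℝ} {s : ℂ} {c : ℝ} (a : ℝ) (h : HasLaplacianAt q s c) :
    HasLaplacianAt (fun s => a * q s) s (a * c) := by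
  obtain ⟨A, B, rfl, h1, h2⟩ := h
  exact ⟨a * A, a * B, by ring, h1.const_mul a, h2.const_mul a⟩

theorem hasDerivAt_comp_line {E : Type*} [NormedAddCommGroup E] [NormedSpace ℂ E] {F F' : ℂ → E}
    {s v : ℂ} {τ : ℝ} (h : HasDerivAt F (F' (s + τ * v)) (s + τ * v)) :
    HasDerivAt (fun τ : ℝ => F (s + τ * v)) (v • F' (s + τ * v)) τ := by
  have h1 : HasDerivAt (fun τ : ℝ => s + (τ : ℂ) * v) v τ := by
    simpa using ((Complex.ofRealCLM.hasDerivAt (x := τ)).mul_const v).const_add s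
  exact h.scomp τ h1

theorem tendsto_line (s v : ℂ) : Tendsto (fun τ : ℝ => s + (τ : ℂ) * v) (𝓝 0) (𝓝 s) := by
  have : Continuous fun τ : ℝ => s + (τ : ℂ) * v := by fun_prop
  simpa using this.tendsto 0

/-- The first two derivatives of a holomorphic map along a real line. -/
theorem line_derivs {E : Type*} [NormedAddCommGroup E] [NormedSpace ℂ E] [CompleteSpace E]
    {F : ℂ → E} {U : Set ℂ} (hU : IsOpen U) (hF : DifferentiableOn ℂ F U) {s : ℂ} (hs : s ∈ U)
    (v : ℂ) :
    (∀ᶠ τ : ℝ in 𝓝 0, HasDerivAt (fun τ : ℝ => F (s + τ * v)) (v • deriv F (s + τ * v)) τ) ∧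
      HasDerivAt (fun τ : ℝ => v • deriv F (s + τ * v)) (v • v • deriv (deriv F) s) 0 := by
  constructor
  · filter_upwards [(tendsto_line s v).eventually (hU.mem_nhds hs)] with τ hτ
    exact hasDerivAt_comp_line ((hF.differentiableAt (hU.mem_nhds hτ)).hasDerivAt)
  · have h := ((hF.deriv hU).differentiableAt (hU.mem_nhds hs)).hasDerivAt
    have h2 := hasDerivAt_comp_line (F := deriv F) (F' := deriv (deriv F)) (s := s) (v := v) (τ := 0)
      (by simpa using h)
    simpa using h2.fun_const_smul v

theorem hasLaplacianAt_re {F : ℂ → ℂ} {U : Set ℂ} (hU : IsOpen U) (hF : DifferentiableOn ℂ F U)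
    {s : ℂ} (hs : s ∈ U) : HasLaplacianAt (fun s => (F s).re) s 0 := by
  have key : ∀ v : ℂ, HasDeriv2At (fun τ : ℝ => (F (s + τ * v)).re) ((v • v • deriv (deriv F) s).re) := by
    intro v
    obtain ⟨h1, h2⟩ := line_derivs hU hF hs v
    refine ⟨fun τ => (v • deriv F (s + τ * v)).re, ?_, ?_⟩
    · filter_upwards [h1] with τ a
      exact (Complex.reCLM.hasFDerivAt.comp_hasDerivAt τ a)
    · exact (Complex.reCLM.hasFDerivAt.comp_hasDerivAt (0 : ℝ) h2)
  refine ⟨_, _, ?_, key 1, key Complex.I⟩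
  simp

theorem hasLaplacianAt_normSq {F : ℂ → ℂ} {U : Set ℂ} (hU : IsOpen U) (hF : DifferentiableOn ℂ F U)
    {s : ℂ} (hs : s ∈ U) (a : ℂ) :
    HasLaplacianAt (fun s => Complex.normSq (F s - a)) s (4 * Complex.normSq (deriv F s)) := by
  have key : ∀ v : ℂ, HasDeriv2At (fun τ : ℝ => Complex.normSq (F (s + τ * v) - a))
      (2 * ((v * deriv F s).re ^ 2 + (v * deriv F s).im ^ 2 +
      (F s - a).re * (v * (v * deriv (deriv F) s)).re + (F s - a).im * (v * (v * deriv (deriv F) s)).im)) := by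
    intro v
    obtain ⟨h1, h2⟩ := line_derivs hU hF hs v
    have r1 : ∀ᶠ τ : ℝ in 𝓝 0, HasDerivAt (fun τ : ℝ => (F (s + τ * v) - a).re)
        (v • deriv F (s + τ * v)).re τ := by
      filter_upwards [h1] with τ h
      exact (Complex.reCLM.hasFDerivAt.comp_hasDerivAt τ (h.sub_const a))
    have i1 : ∀ᶠ τ : ℝ in 𝓝 0, HasDerivAt (fun τ : ℝ => (F (s + τ * v) - a).im)
        (v • deriv F (s + τ * v)).im τ := by
      filter_upwards [h1] with τ h
      exact (Complex.imCLM.hasFDerivAt.comp_hasDerivAt τ (h.sub_const a))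
    have r2 : HasDerivAt (fun τ : ℝ => (v • deriv F (s + τ * v)).re) (v • v • deriv (deriv F) s).re 0 :=
      (Complex.reCLM.hasFDerivAt.comp_hasDerivAt (0 : ℝ) h2)
    have i2 : HasDerivAt (fun τ : ℝ => (v • deriv F (s + τ * v)).im) (v • v • deriv (deriv F) s).im 0 :=
      (Complex.imCLM.hasFDerivAt.comp_hasDerivAt (0 : ℝ) h2)
    have := (HasDeriv2At.mul r1 r2 r1 r2).add (HasDeriv2At.mul i1 i2 i1 i2)
    simp only [smul_eq_mul, Complex.ofReal_zero, zero_mul, add_zero, ← Complex.normSq_apply] at this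
    refine Eq.subst (motive := fun x => HasDeriv2At _ x) ?_ this
    ring
  refine ⟨_, _, ?_, key 1, key Complex.I⟩
  simp [Complex.normSq_apply]
  ring

/-- Maximum principle on the half-disc for functions with non-negative Laplacian. -/
theorem le_zero_of_laplacian_nonneg {R : ℝ} {q : ℂ → ℝ} (hq : ContinuousOn q (chd R))
    (hl : ∀ s ∈ hd R, ∃ c, 0 ≤ c ∧ HasLaplacianAt q s c)
    (hb : ∀ s ∈ chd R, (s.im = 0 ∨ ‖s‖ = R) → q s ≤ 0) : ∀ s ∈ chd R, q s ≤ 0 := by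
  intro s hs
  by_contra! hpos
  have hR : 0 ≤ R := (norm_nonneg s).trans hs.1
  -- Adding `η |x|²` makes the Laplacian at least `4η > 0`; this `η` keeps the correction below `q
  -- s` on the half-disc.
  set η : ℝ := q s / (2 * (R ^ 2 + 1)) with hη
  have hηpos : 0 < η := by positivity
  have hη1 : η * R ^ 2 < q s := by
    have : η * (2 * (R ^ 2 + 1)) = q s := by rw [hη]; field_simp
    nlinarith [sq_nonneg R]
  set p : ℂ → ℝ := fun x => q x + η * Complex.normSq (x - 0) with hp
  have hpc : ContinuousOn p (chd R) := by
    refine hq.add (Continuous.continuousOn ?_)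
    have := Complex.continuous_normSq
    fun_prop
  obtain ⟨m, hm, hmax⟩ := (isCompact_chd R).exists_isMaxOn ⟨s, hs⟩ hpc
  have hmb : ¬ (m.im = 0 ∨ ‖m‖ = R) := by
    intro h
    have h1 := hb m hm h
    have h2 : p s ≤ p m := hmax hs
    have h3 : p m ≤ η * R ^ 2 := by
      simp only [hp, sub_zero, Complex.normSq_eq_norm_sq]
      have : ‖m‖ ^ 2 ≤ R ^ 2 := pow_le_pow_left₀ (norm_nonneg _) hm.1 2
      nlinarith
    have h4 : q s ≤ p s := by
      simp only [hp]
      have := Complex.normSq_nonneg (s - 0)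
      nlinarith
    linarith
  push Not at hmb
  have hmi : m ∈ hd R := mem_hd_of_mem_chd hm hmb.2 hmb.1
  obtain ⟨c, hc, hlap⟩ := hl m hmi
  have hN : HasLaplacianAt (fun x => Complex.normSq (x - 0)) m 4 := by
    simpa using hasLaplacianAt_normSq (F := fun x => x) isOpen_univ differentiableOn_id (mem_univ m) 0
  obtain ⟨A, B, hAB, hA, hB⟩ := hlap.add (hN.const_mul η)
  have hloc : ∀ v : ℂ, IsLocalMax (fun τ : ℝ => p (m + τ * v)) 0 := by
    intro v
    have := (tendsto_line m v).eventually ((isOpen_hd R).mem_nhds hmi)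
    filter_upwards [this] with τ hτ
    simpa using hmax (hd_subset_chd R hτ)
  have a1 := hA.nonpos_of_isLocalMax (hloc 1)
  have b1 := hB.nonpos_of_isLocalMax (hloc Complex.I)
  linarith

/-- The harmonic barrier of the half-disc of radius `R`. -/
noncomputable def barrier (R : ℝ) (s : ℂ) : ℝ :=
  (-Complex.I * ((2 / R : ℝ) * s - ((1 / R ^ 3 : ℝ) : ℂ) * s ^ 3)).re

theorem barrier_eq (R : ℝ) (s : ℂ) :
    barrier R s = s.im * (2 / R - (3 * s.re ^ 2 - s.im ^ 2) / R ^ 3) := by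
  simp [barrier, pow_succ, Complex.mul_re, Complex.mul_im]
  ring

theorem hasLaplacianAt_barrier (R : ℝ) (s : ℂ) : HasLaplacianAt (barrier R) s 0 := by
  refine hasLaplacianAt_re (F := fun s => -Complex.I * ((2 / R : ℝ) * s - ((1 / R ^ 3 : ℝ) : ℂ) * s ^ 3))
    isOpen_univ ?_ (mem_univ s)
  fun_prop

theorem continuous_barrier (R : ℝ) : Continuous (barrier R) := by
  unfold barrier
  fun_prop

/-- With `Im s / R = sin θ` this is `2 sin θ - sin 3θ`: non-positive near the corners, at most `3`
at the top. Hence Hopf's lemma needs a positive bound only where `Im s ≥ R / 2`. -/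
theorem barrier_arc {R : ℝ} (hR : 0 < R) {s : ℂ} (hs : ‖s‖ = R) :
    barrier R s = s.im / R * (4 * (s.im / R) ^ 2 - 1) := by
  have h : s.re ^ 2 + s.im ^ 2 = R ^ 2 := by
    rw [← hs, Complex.sq_norm, Complex.normSq_apply]; ring
  have h1 : s.re ^ 2 = R ^ 2 - s.im ^ 2 := by linarith
  rw [barrier_eq, h1]
  field_simp
  ring

theorem barrier_ge {R : ℝ} (hR : 0 < R) {s : ℂ} (hs : ‖s‖ ≤ R / 2) (h0 : 0 ≤ s.im) :
    5 / 4 / R * s.im ≤ barrier R s := by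
  have h : s.re ^ 2 + s.im ^ 2 ≤ (R / 2) ^ 2 := by
    calc s.re ^ 2 + s.im ^ 2 = ‖s‖ ^ 2 := by rw [Complex.sq_norm, Complex.normSq_apply]; ring
      _ ≤ _ := pow_le_pow_left₀ (norm_nonneg _) hs 2
  have h2 : (3 * s.re ^ 2 - s.im ^ 2) / R ^ 3 ≤ 3 / 4 / R := by
    rw [div_le_div_iff₀ (by positivity) hR]
    nlinarith [sq_nonneg s.im, mul_nonneg (sq_nonneg s.im) hR.le]
  rw [barrier_eq]
  have h3 : 5 / 4 / R ≤ 2 / R - (3 * s.re ^ 2 - s.im ^ 2) / R ^ 3 := by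
    have : 2 / R - 3 / 4 / R = 5 / 4 / R := by field_simp; norm_num
    linarith
  rw [mul_comm]
  exact mul_le_mul_of_nonneg_left h3 h0

/-- Quantitative Hopf lemma on the half-disc. -/
theorem hopf_lower_bound {R m : ℝ} {q : ℂ → ℝ} (hR : 0 < R) (hm : 0 ≤ m)
    (hq : ContinuousOn q (chd R))
    (hl : ∀ s ∈ hd R, ∃ c, c ≤ 0 ∧ HasLaplacianAt q s c)
    (hb : ∀ s ∈ chd R, (s.im = 0 ∨ ‖s‖ = R) → 0 ≤ q s)
    (hmid : ∀ s ∈ chd R, ‖s‖ = R → R / 2 ≤ s.im → m ≤ q s) :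
    ∀ s ∈ chd R, ‖s‖ ≤ R / 2 → 5 / 12 * m / R * s.im ≤ q s := by
  -- The barrier is at most `3` on the arc, whence `m / 3`; with the slope `5 / 4 / R` of
  -- `barrier_ge` this yields `5 / 12`.
  have key : ∀ s ∈ chd R, m / 3 * barrier R s + (-1) * q s ≤ 0 := by
    refine le_zero_of_laplacian_nonneg ?_ ?_ ?_
    · exact (continuousOn_const.mul (continuous_barrier R).continuousOn).add (continuousOn_const.mul hq)
    · intro s hs
      obtain ⟨c, hc, h⟩ := hl s hs
      exact ⟨_, by linarith, ((hasLaplacianAt_barrier R s).const_mul (m / 3)).add (h.const_mul (-1))⟩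
    · intro s hs hsb
      have h0 := hb s hs hsb
      rcases hsb with h | h
      · rw [barrier_eq, h]; simp; exact h0
      · rw [barrier_arc hR h]
        have e1 : 0 ≤ s.im / R := div_nonneg hs.2 hR.le
        have e2 : s.im / R ≤ 1 := by
          rw [div_le_one hR, ← h]; exact (le_abs_self _).trans (Complex.abs_im_le_norm s)
        by_cases hh : R / 2 ≤ s.im
        · have := hmid s hs h hh
          have e3 : s.im / R * (4 * (s.im / R) ^ 2 - 1) ≤ 3 := by
            nlinarith [mul_nonneg e1 e1, mul_nonneg (mul_nonneg e1 e1) (sub_nonneg.2 e2)]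
          nlinarith
        · have e4 : s.im / R ≤ 1 / 2 := by
            rw [div_le_div_iff₀ hR (by norm_num)]; linarith
          have e3 : s.im / R * (4 * (s.im / R) ^ 2 - 1) ≤ 0 := by
            apply mul_nonpos_of_nonneg_of_nonpos e1
            nlinarith
          nlinarith
  intro s hs hs2
  have h1 := key s hs
  have h2 := barrier_ge hR hs2 hs.2
  have h3 : m / 3 * (5 / 4 / R * s.im) ≤ m / 3 * barrier R s :=
    mul_le_mul_of_nonneg_left h2 (by positivity)
  have : 5 / 12 * m / R * s.im = m / 3 * (5 / 4 / R * s.im) := by ring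
  linarith

/-- Maximum modulus principle on the half-disc. -/
theorem norm_le_of_boundary {R C : ℝ} {F : ℂ → ℂ} (hF : ContinuousOn F (chd R))
    (hd' : DifferentiableOn ℂ F (hd R))
    (hb : ∀ s ∈ chd R, (s.im = 0 ∨ ‖s‖ = R) → ‖F s‖ ≤ C) : ∀ s ∈ chd R, ‖F s‖ ≤ C := by
  have hcl : closure (hd R) ⊆ chd R := closure_minimal (hd_subset_chd R) (isClosed_chd R)
  intro s hs
  by_cases h : s.im = 0 ∨ ‖s‖ = R
  · exact hb s hs h
  push Not at h
  have hsi := mem_hd_of_mem_chd hs h.2 h.1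
  refine Complex.norm_le_of_forall_mem_frontier_norm_le (U := hd R) ?_ ⟨hd', hF.mono hcl⟩ ?_
    (subset_closure hsi)
  · exact (isCompact_chd R).isBounded.subset (hd_subset_chd R)
  · intro x hx
    have hx1 := hcl hx.1
    refine hb x hx1 ?_
    by_contra hcon
    push Not at hcon
    apply hx.2
    rw [(isOpen_hd R).interior_eq]
    exact mem_hd_of_mem_chd hx1 hcon.2 hcon.1

end HyperbolicDiscs

namespace HyperbolicDiscs

/-! ### Schwarz reflection -/

-- Morera: a rectangle crossing the real axis is cut along it, and Cauchy's theorem on each half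
-- needs only continuity up to the boundary.
open Complex in
theorem differentiableOn_of_off_real_line {R : ℝ} {f : ℂ → ℂ}
    (hc : ContinuousOn f (Metric.ball 0 R))
    (hd' : ∀ s ∈ Metric.ball (0 : ℂ) R, s.im ≠ 0 → DifferentiableAt ℂ f s) :
    DifferentiableOn ℂ f (Metric.ball 0 R) := by
  refine (isConservativeOn_and_continuousOn_iff_isDifferentiableOn Metric.isOpen_ball).1 ⟨?_, hc⟩
  have direct : ∀ z w : ℂ, Rectangle z w ⊆ Metric.ball 0 R → (0 : ℝ) ∉ Ioo (min z.im w.im) (max z.im w.im) →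
      (∫ x : ℝ in z.re..w.re, f (x + z.im * I)) - (∫ x : ℝ in z.re..w.re, f (x + w.im * I)) +
      I • (∫ y : ℝ in z.im..w.im, f (re w + y * I)) -
      I • (∫ y : ℝ in z.im..w.im, f (re z + y * I)) = 0 := by
    intro z w hzw h0
    refine integral_boundary_rect_eq_zero_of_continuousOn_of_differentiableOn f z w (hc.mono hzw) ?_
    intro s hs
    refine (hd' s (hzw ?_) ?_).differentiableWithinAt
    · exact ⟨Ioo_subset_Icc_self hs.1, Ioo_subset_Icc_self hs.2⟩
    · intro h
      exact h0 (h ▸ hs.2)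
  intro z w hzw
  rw [← add_eq_zero_iff_eq_neg, wedgeIntegral_add_wedgeIntegral_eq]
  by_cases h0 : (0 : ℝ) ∈ Ioo (min z.im w.im) (max z.im w.im)
  swap
  · exact direct z w hzw h0
  have h0' : (0 : ℝ) ∈ uIcc z.im w.im := Ioo_subset_Icc_self h0
  have s1 : uIcc z.im 0 ⊆ uIcc z.im w.im := uIcc_subset_uIcc_left h0'
  have s2 : uIcc 0 w.im ⊆ uIcc z.im w.im := uIcc_subset_uIcc_right h0'
  have e1 := direct z (w.re : ℂ) (fun s hs => hzw ⟨by simpa using hs.1, s1 (by simpa using hs.2)⟩)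
    (by simpa using le_of_lt)
  have e2 := direct (z.re : ℂ) w (fun s hs => hzw ⟨by simpa using hs.1, s2 (by simpa using hs.2)⟩)
    (by simpa using le_of_lt)
  have hint : ∀ a ∈ uIcc z.re w.re, ∀ c d : ℝ, uIcc c d ⊆ uIcc z.im w.im →
      IntervalIntegrable (fun y : ℝ => f (a + y * I)) MeasureTheory.volume c d := by
    intro a ha c d hcd
    apply ContinuousOn.intervalIntegrable
    refine hc.comp (by fun_prop) ?_
    intro y hy
    exact hzw ⟨by simpa using ha, by simpa using hcd hy⟩
  have i1 := intervalIntegral.integral_add_adjacent_intervals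
    (hint z.re left_mem_uIcc z.im 0 s1) (hint z.re left_mem_uIcc 0 w.im s2)
  have i2 := intervalIntegral.integral_add_adjacent_intervals
    (hint w.re right_mem_uIcc z.im 0 s1) (hint w.re right_mem_uIcc 0 w.im s2)
  simp only [ofReal_re, ofReal_im] at e1 e2
  rw [← i1, ← i2, smul_add, smul_add]
  linear_combination e1 + e2

open ComplexConjugate in
/-- Schwarz reflection principle in a half-disc. -/
theorem exists_reflection {R : ℝ} {w : ℂ → ℂ} (hw : ContinuousOn w (chd R))
    (hd' : DifferentiableOn ℂ w (hd R)) (hreal : ∀ s ∈ chd R, s.im = 0 → (w s).im = 0) :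
    ∃ W : ℂ → ℂ, DifferentiableOn ℂ W (Metric.ball 0 R) ∧ ∀ s, ‖s‖ < R → 0 ≤ s.im → W s = w s := by
  classical
  set W : ℂ → ℂ := fun s => if 0 ≤ s.im then w s else conj (w (conj s)) with hW
  refine ⟨W, ?_, fun s _ h => by simp [hW, h]⟩
  apply differentiableOn_of_off_real_line
  · apply ContinuousOn.if
    · intro s hs
      have h0 : s.im = 0 := by
        have h2 := frontier_le_subset_eq continuous_const Complex.continuous_im hs.2
        exact h2.symm
      have h3 : conj s = s := Complex.conj_eq_iff_im.2 h0
      have h4 : s ∈ chd R := ⟨by simpa using (Metric.mem_ball.1 hs.1).le, h0.ge⟩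
      rw [h3, Complex.conj_eq_iff_im.2 (hreal s h4 h0)]
    · refine hw.mono ?_
      rintro s ⟨h1, h2⟩
      rw [(isClosed_le continuous_const Complex.continuous_im).closure_eq] at h2
      exact ⟨by simpa using (Metric.mem_ball.1 h1).le, h2⟩
    · refine Complex.continuous_conj.comp_continuousOn (hw.comp Complex.continuous_conj.continuousOn ?_)
      rintro s ⟨h1, h2⟩
      have h3 : s.im ≤ 0 := by
        have : {a : ℂ | ¬ 0 ≤ a.im} ⊆ {a : ℂ | a.im ≤ 0} := fun a ha => (not_le.1 ha).le
        exact closure_minimal this (isClosed_le Complex.continuous_im continuous_const) h2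
      exact ⟨by simpa using (Metric.mem_ball.1 h1).le, by simpa using h3⟩
  · intro s hs h0
    have hn : ‖s‖ < R := by simpa using hs
    rcases lt_or_gt_of_ne h0 with h | h
    · have h1 : W =ᶠ[𝓝 s] (conj ∘ w ∘ conj) := by
        filter_upwards [(isOpen_lt Complex.continuous_im continuous_const).mem_nhds h] with x hx
        have : ¬ 0 ≤ x.im := not_le.2 hx
        simp [hW, this]
      refine DifferentiableAt.congr_of_eventuallyEq ?_ h1
      rw [differentiableAt_conj_conj_iff]
      exact hd'.differentiableAt ((isOpen_hd R).mem_nhds ⟨by simpa using hn, by simpa using h⟩)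
    · have h1 : W =ᶠ[𝓝 s] w := by
        filter_upwards [(isOpen_lt continuous_const Complex.continuous_im).mem_nhds h] with x hx
        have : 0 ≤ x.im := le_of_lt hx
        simp [hW, this]
      refine DifferentiableAt.congr_of_eventuallyEq ?_ h1
      exact hd'.differentiableAt ((isOpen_hd R).mem_nhds ⟨hn, h⟩)

/-- A holomorphic function on the half-disc vanishing on the flat part vanishes identically. -/
theorem eq_zero_of_flat_eq_zero {R : ℝ} (hR : 0 < R) {w : ℂ → ℂ} (hw : ContinuousOn w (chd R))
    (hd' : DifferentiableOn ℂ w (hd R)) (hz : ∀ s ∈ chd R, s.im = 0 → w s = 0) :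
    ∀ s ∈ hd R, w s = 0 := by
  obtain ⟨W, hW, hWw⟩ := exists_reflection hw hd' fun s hs h => by simp [hz s hs h]
  have han : AnalyticOnNhd ℂ W (Metric.ball 0 R) := hW.analyticOnNhd Metric.isOpen_ball
  have hfr : ∃ᶠ s in 𝓝[≠] (0 : ℂ), W s = 0 := by
    have ht : Tendsto (fun x : ℝ => (x : ℂ)) (𝓝[>] 0) (𝓝[≠] 0) := by
      refine tendsto_nhdsWithin_iff.2 ⟨?_, ?_⟩
      · exact (Complex.continuous_ofReal.tendsto' 0 0 (by simp)).mono_left nhdsWithin_le_nhds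
      · filter_upwards [self_mem_nhdsWithin] with x hx
        simpa using (ne_of_gt hx)
    refine ht.frequently (Eventually.frequently ?_)
    have : ∀ᶠ x : ℝ in 𝓝[>] 0, x ∈ Ioo 0 R := Ioo_mem_nhdsGT hR
    filter_upwards [this] with x hx
    have hn : ‖(x : ℂ)‖ < R := by simpa [abs_of_pos hx.1] using hx.2
    rw [hWw x hn (by simp)]
    exact hz x ⟨hn.le, by simp⟩ (by simp)
  have := han.eqOn_zero_of_preconnected_of_frequently_eq_zero
    (convex_ball (0 : ℂ) R).isPreconnected (Metric.mem_ball_self hR) hfr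
  intro s hs
  rw [← hWw s hs.1 hs.2.le]
  exact this (by simpa using hs.1)

/-- Consequences of the reflection principle for a function real on the flat part. -/
theorem flat_real_estimates {R : ℝ} (hR : 0 < R) {w : ℂ → ℂ} (hw : ContinuousOn w (chd R))
    (hd' : DifferentiableOn ℂ w (hd R)) (hreal : ∀ s ∈ chd R, s.im = 0 → (w s).im = 0)
    (h0 : w 0 = 0) :
    ∃ r C : ℝ, 0 < r ∧ r ≤ R ∧ 0 < C ∧ (∀ s ∈ chd r, ‖w s‖ ≤ C * ‖s‖) ∧
      (∀ s ∈ chd r, |(w s).im| ≤ C * s.im) ∧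
      ((∀ x : ℝ, 0 < x → x ≤ r → 0 ≤ (w x).re) ∨ (∀ x : ℝ, 0 < x → x ≤ r → (w x).re ≤ 0)) ∧
      ((∀ x : ℝ, 0 < x → x ≤ r → 0 ≤ (w (-x)).re) ∨ (∀ x : ℝ, 0 < x → x ≤ r → (w (-x)).re ≤ 0)) := by
  obtain ⟨W, hW, hWw⟩ := exists_reflection hw hd' hreal
  have hmem0 : Metric.ball (0 : ℂ) R ∈ 𝓝 (0 : ℂ) := Metric.ball_mem_nhds _ hR
  have han : AnalyticAt ℂ W 0 := hW.analyticAt hmem0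
  obtain ⟨K, t, ht, hK⟩ := (han.contDiffAt (n := 1)).exists_lipschitzOnWith
  obtain ⟨δ, hδ, hδt⟩ := Metric.mem_nhds_iff.1 ht
  have hW0 : W 0 = 0 := by rw [hWw 0 (by simpa using hR) (by simp), h0]
  -- Isolated zeros give the sign alternatives: a real function that is continuous and without zeros
  -- on an interval keeps its sign.
  have hiso : ∃ δ' > 0, (∀ s : ℂ, ‖s‖ < δ' → W s = 0) ∨ (∀ s : ℂ, ‖s‖ < δ' → s ≠ 0 → W s ≠ 0) := by
    rcases han.eventually_eq_zero_or_eventually_ne_zero with h | h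
    · obtain ⟨δ', h1, h2⟩ := Metric.eventually_nhds_iff.1 h
      exact ⟨δ', h1, Or.inl fun s hs => h2 (by simpa using hs)⟩
    · rw [eventually_nhdsWithin_iff] at h
      obtain ⟨δ', h1, h2⟩ := Metric.eventually_nhds_iff.1 h
      exact ⟨δ', h1, Or.inr fun s hs hs0 => h2 (by simpa using hs) hs0⟩
  obtain ⟨δ', hδ', hsign⟩ := hiso
  set r : ℝ := min (min δ δ') R / 2 with hr
  have hmin : 0 < min (min δ δ') R := lt_min (lt_min hδ hδ') hR
  have hrpos : 0 < r := by positivity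
  have hr1 : r < δ := by
    have := (min_le_left (min δ δ') R).trans (min_le_left _ _); linarith
  have hr2 : r < δ' := by
    have := (min_le_left (min δ δ') R).trans (min_le_right _ _); linarith
  have hr3 : r < R := by have := min_le_right (min δ δ') R; linarith
  have hball : ∀ s : ℂ, ‖s‖ ≤ r → s ∈ t := fun s hs => hδt (by simpa using hs.trans_lt hr1)
  have hlip : ∀ a b : ℂ, ‖a‖ ≤ r → ‖b‖ ≤ r → ‖W a - W b‖ ≤ (K + 1) * ‖a - b‖ := by
    intro a b ha hb
    have := hK.dist_le_mul a (hball a ha) b (hball b hb)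
    rw [dist_eq_norm, dist_eq_norm] at this
    nlinarith [norm_nonneg (a - b)]
  have sgn : ∀ e : ℝ, (e = 1 ∨ e = -1) → ((∀ x : ℝ, 0 < x → x ≤ r → 0 ≤ (w ((e * x : ℝ) : ℂ)).re) ∨
      (∀ x : ℝ, 0 < x → x ≤ r → (w ((e * x : ℝ) : ℂ)).re ≤ 0)) := by
    intro e he
    have hn : ∀ x : ℝ, 0 < x → ‖((e * x : ℝ) : ℂ)‖ = x := by
      intro x hx
      rcases he with rfl | rfl <;> simp [abs_of_pos hx]
    rcases hsign with h | h
    · left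
      intro x hx hxr
      have := h ((e * x : ℝ) : ℂ) (by rw [hn x hx]; linarith)
      rw [hWw _ (by rw [hn x hx]; linarith) (by simp)] at this
      rw [this]; simp
    · have hcont : ContinuousOn (fun x : ℝ => (w ((e * x : ℝ) : ℂ)).re) (Ioc 0 r) := by
        refine Complex.continuous_re.comp_continuousOn (hw.comp (by fun_prop) ?_)
        intro x hx
        exact ⟨by rw [hn x hx.1]; linarith [hx.2], by simp⟩
      have hne : ∀ x ∈ Ioc 0 r, (w ((e * x : ℝ) : ℂ)).re ≠ 0 := by
        intro x hx hx0
        have h1 := hn x hx.1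
        have h2 := h ((e * x : ℝ) : ℂ) (by rw [h1]; linarith [hx.2])
          (by rw [← norm_pos_iff, h1]; exact hx.1)
        rw [hWw _ (by rw [h1]; linarith [hx.2]) (by simp)] at h2
        apply h2
        exact Complex.ext hx0 (hreal _ ⟨by rw [h1]; linarith [hx.2], by simp⟩ (by simp))
      have hpre : IsPreconnected (Ioc (0 : ℝ) r) := isPreconnected_Ioc
      by_contra! hcon
      obtain ⟨⟨x, hx, hxr, hx0⟩, ⟨y, hy, hyr, hy0⟩⟩ := hcon
      obtain ⟨c, hc, hc0⟩ := hpre.intermediate_value ⟨hx, hxr⟩ ⟨hy, hyr⟩ hcont ⟨hx0.le, hy0.le⟩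
      exact hne c hc hc0
  refine ⟨r, K + 1, hrpos, hr3.le, by positivity, ?_, ?_, ?_, ?_⟩
  · intro s hs
    have := hlip s 0 hs.1 (by simpa using hrpos.le)
    rw [hW0, hWw s (hs.1.trans_lt hr3) hs.2] at this
    simpa using this
  · intro s hs
    have hre : ‖((s.re : ℝ) : ℂ)‖ ≤ r := by
      simpa using (Complex.abs_re_le_norm s).trans hs.1
    -- The Lipschitz bound is applied between `s` and its projection to the real axis, where `Im w =
    -- 0`.
    have h1 := hlip s (s.re : ℂ) hs.1 hre
    rw [hWw s (hs.1.trans_lt hr3) hs.2, hWw _ (hre.trans_lt hr3) (by simp)] at h1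
    have h2 : s - (s.re : ℂ) = s.im * Complex.I := by
      apply Complex.ext <;> simp
    rw [h2] at h1
    have h3 : (w (s.re : ℂ)).im = 0 := hreal _ ⟨hre.trans hr3.le, by simp⟩ (by simp)
    have h4 := (Complex.abs_im_le_norm (w s - w (s.re : ℂ))).trans h1
    rw [Complex.sub_im, h3] at h4
    simpa [abs_of_nonneg hs.2] using h4
  · simpa using sgn 1 (Or.inl rfl)
  · simpa using sgn (-1) (Or.inr rfl)

/-! ### Logarithms on the half-disc -/

/-- A continuous logarithm on the closed half-disc without the centre. -/
theorem exists_log {R : ℝ} (hR : 0 < R) {z : ℂ → ℂ} (hz : ContinuousOn z (chd R))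
    (hd' : DifferentiableOn ℂ z (hd R)) (hnz : ∀ s ∈ chd R, s ≠ 0 → z s ≠ 0) :
    ∃ L : ℂ → ℂ, ContinuousOn L (chd R \ {0}) ∧ DifferentiableOn ℂ L (hd R) ∧
      ∀ s ∈ chd R, s ≠ 0 → Complex.exp (L s) = z s := by
  -- A clamped exponential from the simply connected plane to the punctured closed half-disc, so
  -- that `z ∘ φ` has a global logarithm.
  set φ : ℂ → ℂ := fun σ => Complex.exp ((min σ.re (Real.log R) : ℝ) +
    (max 0 (min σ.im Real.pi) : ℝ) * Complex.I) with hφ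
  have hφc : Continuous φ := by
    have h1 : Continuous fun σ : ℂ => ((min σ.re (Real.log R) : ℝ) : ℂ) :=
      Complex.continuous_ofReal.comp (Complex.continuous_re.min continuous_const)
    have h2 : Continuous fun σ : ℂ => ((max 0 (min σ.im Real.pi) : ℝ) : ℂ) :=
      Complex.continuous_ofReal.comp (continuous_const.max (Complex.continuous_im.min continuous_const))
    exact Complex.continuous_exp.comp (h1.add (h2.mul continuous_const))
  have hφm : ∀ σ, φ σ ∈ chd R := by
    intro σ
    constructor
    · simp only [hφ, Complex.norm_exp]
      have : Real.exp (min σ.re (Real.log R)) ≤ R := by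
        calc _ ≤ Real.exp (Real.log R) := Real.exp_le_exp.2 (min_le_right _ _)
          _ = R := Real.exp_log hR
      simpa using this
    · simp only [hφ, Complex.exp_im]
      refine mul_nonneg (Real.exp_pos _).le (Real.sin_nonneg_of_nonneg_of_le_pi ?_ ?_)
      · simp
      · simp [Real.pi_pos.le]
  have hφ0 : ∀ σ, φ σ ≠ 0 := fun σ => Complex.exp_ne_zero _
  have hsc : IsSimplyConnected (univ : Set ℂ) := by
    have := (convex_univ (𝕜 := ℝ) (E := ℂ)).contractibleSpace univ_nonempty
    exact (inferInstance : SimplyConnectedSpace (univ : Set ℂ))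
  obtain ⟨f, hf, hfe⟩ := Complex.exists_continuousOn_eqOn_exp_comp (X := ℂ) (U := univ)
    (g := fun σ => z (φ σ)) hsc isOpen_univ
    (hz.comp hφc.continuousOn fun σ _ => hφm σ)
    (by rintro ⟨σ, -, h⟩; exact hnz _ (hφm σ) (hφ0 σ) h)
  -- The branch cut along the negative imaginary axis: on the closed upper half-plane its imaginary
  -- part lies in `[0, π]`, where the clamping is inactive.
  set lg : ℂ → ℂ := fun s => Complex.log (-Complex.I * s) + (Real.pi / 2 : ℝ) * Complex.I with hlg
  have hslit : ∀ s : ℂ, 0 ≤ s.im → s ≠ 0 → -Complex.I * s ∈ Complex.slitPlane := by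
    intro s hs h0
    rw [Complex.mem_slitPlane_iff]
    rcases hs.lt_or_eq with h | h
    · left; simpa using h
    · right
      have : s.re ≠ 0 := fun h' => h0 (Complex.ext h' h.symm)
      simpa using this
  have hexp : ∀ s : ℂ, s ≠ 0 → Complex.exp (lg s) = s := by
    intro s h0
    have h1 : -Complex.I * s ≠ 0 := mul_ne_zero (by simp) h0
    simp only [hlg]
    rw [Complex.exp_add, Complex.exp_log h1]
    push_cast
    rw [Complex.exp_pi_div_two_mul_I]
    linear_combination (-s) * Complex.I_mul_I
  have hφlg : ∀ s ∈ chd R, s ≠ 0 → φ (lg s) = s := by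
    intro s hs h0
    have h1 : -Complex.I * s ≠ 0 := mul_ne_zero (by simp) h0
    have hre : (lg s).re = Real.log ‖s‖ := by simp [hlg, Complex.log_re]
    have him : (lg s).im = Complex.arg (-Complex.I * s) + Real.pi / 2 := by
      simp [hlg, Complex.log_im]
    have habs : |Complex.arg (-Complex.I * s)| ≤ Real.pi / 2 := by
      rw [Complex.abs_arg_le_pi_div_two_iff]; simpa using hs.2
    rw [abs_le] at habs
    have e1 : min (lg s).re (Real.log R) = (lg s).re := by
      rw [hre]; exact min_eq_left (Real.log_le_log (norm_pos_iff.2 h0) hs.1)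
    have e2 : max 0 (min (lg s).im Real.pi) = (lg s).im := by
      rw [him, min_eq_left (by linarith), max_eq_right (by linarith)]
    simp only [hφ]
    rw [e1, e2, Complex.re_add_im, hexp s h0]
  have hlgc : ContinuousOn lg (chd R \ {0}) := by
    intro s hs
    apply ContinuousAt.continuousWithinAt
    have : ContinuousAt (fun s => Complex.log (-Complex.I * s)) s :=
      (continuousAt_clog (hslit s hs.1.2 hs.2)).comp (by fun_prop)
    exact this.add continuousAt_const
  have hLc : ContinuousOn (fun s => f (lg s)) (chd R \ {0}) :=
    hf.comp hlgc fun _ _ => mem_univ _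
  have hLe : ∀ s ∈ chd R, s ≠ 0 → Complex.exp (f (lg s)) = z s := by
    intro s hs h0
    have := hfe (mem_univ (lg s))
    simp only [Function.comp] at this
    rw [this, hφlg s hs h0]
  refine ⟨fun s => f (lg s), hLc, ?_, hLe⟩
  intro s hs
  have hsub : hd R ⊆ chd R \ {0} := fun x hx => ⟨hd_subset_chd R hx, by
    rintro rfl; simpa using hx.2⟩
  have hnhds := (isOpen_hd R).mem_nhds hs
  have hcs : ContinuousAt (fun s => f (lg s)) s := (hLc.mono hsub).continuousAt hnhds
  have hs0 : s ≠ 0 := (hsub hs).2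
  have hz0 : z s ≠ 0 := hnz s (hd_subset_chd R hs) hs0
  -- A continuous logarithm differs locally by a constant from the principal branch of `log (z x / z
  -- s)`, hence is holomorphic.
  have hev : (fun x => f (lg x)) =ᶠ[𝓝 s] fun x => f (lg s) + Complex.log (z x / z s) := by
    have him : ∀ᶠ x in 𝓝 s, |(f (lg x) - f (lg s)).im| < Real.pi := by
      have : Tendsto (fun x => |(f (lg x) - f (lg s)).im|) (𝓝 s) (𝓝 |(f (lg s) - f (lg s)).im|) :=
        ((Complex.continuous_im.tendsto _).comp (hcs.tendsto.sub_const _)).abs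
      apply this.eventually_lt_const
      simp [Real.pi_pos]
    filter_upwards [him, hnhds] with x hx hxR
    have hx0 : x ≠ 0 := (hsub hxR).2
    rw [← hLe x (hd_subset_chd R hxR) hx0, ← hLe s (hd_subset_chd R hs) hs0, ← Complex.exp_sub]
    rw [abs_lt] at hx
    rw [Complex.log_exp hx.1 hx.2.le]
    ring
  apply DifferentiableAt.differentiableWithinAt
  refine DifferentiableAt.congr_of_eventuallyEq ?_ hev
  refine DifferentiableAt.const_add _ (DifferentiableAt.clog ?_ ?_)
  · exact (hd'.differentiableAt hnhds).div_const _
  · simp [div_self hz0]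

end HyperbolicDiscs

namespace HyperbolicDiscs

/-! ### The model quadric -/

theorem psi_eq (γ : ℝ) (z : ℂ) : psi γ z = (1 + γ) * z.re ^ 2 + (1 - γ) * z.im ^ 2 := by
  simp [psi, Complex.normSq_apply, pow_two]
  ring

theorem abs_psi_le {γ : ℝ} (hγ : 1 < γ) (z : ℂ) : |psi γ z| ≤ (1 + γ) * ‖z‖ ^ 2 := by
  rw [psi_eq, Complex.sq_norm, Complex.normSq_apply, abs_le]
  constructor <;> nlinarith [sq_nonneg z.re, sq_nonneg z.im]

theorem continuous_psi (γ : ℝ) : Continuous (psi γ) := by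
  have := Complex.continuous_normSq
  unfold psi
  fun_prop

theorem norm_pow_sub_pow_le_mul {r : ℝ} {a b : ℂ} (ha : ‖a‖ ≤ r) (hb : ‖b‖ ≤ r) (n : ℕ) :
    ‖a ^ (n + 1) - b ^ (n + 1)‖ ≤ (n + 1) * r ^ n * ‖a - b‖ := by
  have hr : 0 ≤ r := (norm_nonneg a).trans ha
  induction n with
  | zero => simp
  | succ n ih =>
    have e : a ^ (n + 1 + 1) - b ^ (n + 1 + 1) =
        a * (a ^ (n + 1) - b ^ (n + 1)) + (a - b) * b ^ (n + 1) := by ring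
    rw [e]
    refine (norm_add_le _ _).trans ?_
    rw [norm_mul, norm_mul, norm_pow]
    have h1 : ‖a‖ * ‖a ^ (n + 1) - b ^ (n + 1)‖ ≤ r * ((n + 1) * r ^ n * ‖a - b‖) :=
      mul_le_mul ha ih (norm_nonneg _) hr
    have h2 : ‖a - b‖ * ‖b‖ ^ (n + 1) ≤ ‖a - b‖ * r ^ (n + 1) :=
      mul_le_mul_of_nonneg_left (pow_le_pow_left₀ (norm_nonneg _) hb _) (norm_nonneg _)
    calc _ ≤ r * ((n + 1) * r ^ n * ‖a - b‖) + ‖a - b‖ * r ^ (n + 1) := add_le_add h1 h2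
      _ = _ := by push_cast; ring

theorem reflection₁_reflection₂ (γ : ℝ) (p : ℂ × ℂ) : reflection₁ (reflection₂ γ p) =
    ((((2 / γ : ℝ) : ℂ) ^ 2 - 1) * p.1 + ((2 / γ : ℝ) : ℂ) * p.2,
      -((2 / γ : ℝ) : ℂ) * p.1 - p.2) := by
  simp only [reflection₁, reflection₂, Complex.star_def, map_sub, map_add, map_mul, map_neg, map_pow,
    map_one, Complex.conj_ofReal, Complex.conj_conj]

/-- For a good parameter the asymptotic directions of the quadric are given by a root of unity. -/
theorem exists_pow_eq_one {γ : ℝ} (hγ : 1 < γ) (hg : γ ∈ goodParameters) {q : ℂ}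
    (hq : q ^ 2 + ((2 / γ : ℝ) : ℂ) * q + 1 = 0) : ∃ k : ℕ, 0 < k ∧ (q ^ 2) ^ k = 1 := by
  obtain ⟨-, n, hn, ⟨e⟩⟩ := hg
  have : NeZero n := ⟨hn.ne'⟩
  set r₁ : Equiv.Perm (ℂ × ℂ) := reflection₁_involutive.toPerm
  set r₂ : Equiv.Perm (ℂ × ℂ) := (reflection₂_involutive γ).toPerm
  have m1 : r₁ ∈ reflectionGroup γ := Subgroup.subset_closure (by simp [r₁])
  have m2 : r₂ ∈ reflectionGroup γ := Subgroup.subset_closure (by simp [r₂])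
  set g : reflectionGroup γ := ⟨r₁ * r₂, mul_mem m1 m2⟩ with hgdef
  obtain ⟨k, hk, hk1⟩ := isOfFinOrder_iff_pow_eq_one.1 (isOfFinOrder_of_finite (e g))
  refine ⟨k, hk, ?_⟩
  have hgk : g ^ k = 1 := by
    apply e.injective
    rw [map_pow, hk1, map_one]
  have hrk : (r₁ * r₂) ^ k = 1 := by
    simpa [hgdef] using congrArg (Subtype.val) hgk
  set κ : ℂ := ((2 / γ : ℝ) : ℂ) with hκ
  have hκ0 : κ ≠ 0 := by
    rw [hκ]; exact Complex.ofReal_ne_zero.2 (by positivity)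
  -- `(-(q² + 1), κ)` is an eigenvector of the composed reflections with eigenvalue `q²`, so finite
  -- order makes `q²` a root of unity.
  have hstep : ∀ c : ℂ, (r₁ * r₂) (c * (-(q ^ 2 + 1)), c * κ) =
      (c * q ^ 2 * (-(q ^ 2 + 1)), c * q ^ 2 * κ) := by
    intro c
    have h1 : (r₁ * r₂) (c * (-(q ^ 2 + 1)), c * κ) =
      reflection₁ (reflection₂ γ (c * (-(q ^ 2 + 1)), c * κ)) := rfl
    rw [h1, reflection₁_reflection₂]
    have hq' : q ^ 2 = - κ * q - 1 := by linear_combination hq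
    ext1
    · simp only [← hκ]
      have : (q ^ 2 + 1) ^ 2 = κ ^ 2 * q ^ 2 := by rw [hq']; ring_nf; rw [hq']; ring
      linear_combination c * this
    · simp only [← hκ]
      ring
  have hpow : ∀ j : ℕ, ((r₁ * r₂) ^ j) (-(q ^ 2 + 1), κ) =
      ((q ^ 2) ^ j * (-(q ^ 2 + 1)), (q ^ 2) ^ j * κ) := by
    intro j
    induction j with
    | zero => simp
    | succ j ih => rw [pow_succ', Equiv.Perm.mul_apply, ih, hstep, pow_succ (q ^ 2) j]
  have h2 := hpow k
  rw [hrk] at h2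
  have h3 : κ = (q ^ 2) ^ k * κ := congrArg Prod.snd h2
  exact mul_right_cancel₀ hκ0 (by rw [one_mul]; exact h3.symm)

open ComplexConjugate in
/-- For a good parameter some power of `z` is almost real on the quadric. -/
theorem exists_im_pow_le {γ : ℝ} (hγ : 1 < γ) (hg : γ ∈ goodParameters) :
    ∃ n : ℕ, 0 < n ∧ ∃ C : ℝ, 0 < C ∧ ∀ z : ℂ, ‖z‖ ≤ 1 → |(z ^ n).im| ≤ C * |psi γ z| := by
  have hγ0 : 0 < γ := by linarith
  set y : ℝ := Real.sqrt (1 - (1 / γ) ^ 2) with hy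
  have h1γ : (1 / γ) ^ 2 < 1 := by
    rw [div_pow, one_pow, div_lt_one (by positivity)]; nlinarith
  have hy2 : y ^ 2 = 1 - (1 / γ) ^ 2 := Real.sq_sqrt (by linarith)
  have hypos : 0 < y := Real.sqrt_pos.2 (by linarith)
  -- A unimodular root of `q² + (2/γ) q + 1`; the zero set of `ψ` consists of the lines `z̄ = q z`
  -- and `z̄ = q̄ z`.
  set q : ℂ := ⟨-(1 / γ), y⟩ with hq
  have hqeq : q ^ 2 + ((2 / γ : ℝ) : ℂ) * q + 1 = 0 := by
    apply Complex.ext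
    · simp [hq, pow_two]
      have := hy2
      field_simp at this ⊢
      nlinarith
    · simp [hq, pow_two]
      ring
  have hqn : q * conj q = 1 := by
    rw [Complex.mul_conj, Complex.normSq_apply]
    have : (-(1 / γ)) * (-(1 / γ)) + y * y = 1 := by nlinarith
    simp only [hq]
    rw [this]; simp
  have hqs : q + conj q = -((2 / γ : ℝ) : ℂ) := by
    rw [Complex.add_conj]; simp [hq]; ring
  have hqnorm : ‖q‖ = 1 := by
    have := congrArg norm hqn
    rw [norm_mul, Complex.norm_conj, norm_one] at this
    nlinarith [norm_nonneg q]
  obtain ⟨k, hk, hk1⟩ := exists_pow_eq_one hγ hg hqeq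
  rw [← pow_mul] at hk1
  -- The exponent is at least `2`, so one factor `‖z‖` survives in the estimate of `z̄^N - z^N`.
  obtain ⟨m, hm⟩ : ∃ m, 2 * k = m + 1 + 1 := ⟨2 * k - 2, by omega⟩
  rw [hm] at hk1
  have hk1' : (conj q) ^ (m + 1 + 1) = 1 := by rw [← map_pow, hk1, map_one]
  refine ⟨m + 1 + 1, by omega, (m + 1 + 1) / (γ * y), by positivity, ?_⟩
  intro z hz
  set a : ℂ := conj z - q * z with ha
  set b : ℂ := conj z - conj q * z with hb
  have hab : ‖a‖ * ‖b‖ = 2 / γ * |psi γ z| := by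
    have e : a * b = ((2 / γ * psi γ z : ℝ) : ℂ) := by
      have e1 : a * b = conj z ^ 2 - (q + conj q) * (z * conj z) + (q * conj q) * z ^ 2 := by
        rw [ha, hb]; ring
      rw [e1, hqs, hqn, Complex.mul_conj]
      have e2 : conj z ^ 2 + z ^ 2 = ((2 * (z ^ 2).re : ℝ) : ℂ) := by
        rw [← map_pow, add_comm, Complex.add_conj]
      have e3 : (2 / γ * psi γ z : ℝ) = 2 / γ * Complex.normSq z + 2 * (z ^ 2).re := by
        rw [psi]; field_simp
      rw [e3]
      push_cast at e2 ⊢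
      linear_combination e2
    rw [← norm_mul, e, Complex.norm_real, Real.norm_eq_abs, abs_mul, abs_of_pos (by positivity : 0 < 2 / γ)]
  have hsum : 2 * y * ‖z‖ ≤ ‖a‖ + ‖b‖ := by
    have e : b - a = (2 * y : ℝ) * Complex.I * z := by
      have : q - conj q = (2 * y : ℝ) * Complex.I := by rw [Complex.sub_conj]
      rw [ha, hb, ← this]; ring
    have h := norm_sub_le b a
    rw [e, norm_mul, norm_mul, Complex.norm_I, Complex.norm_real, Real.norm_eq_abs,
      abs_of_pos (by positivity : 0 < 2 * y)] at h
    linarith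
  have hpow : ‖conj z ^ (m + 1 + 1) - z ^ (m + 1 + 1)‖ = 2 * |(z ^ (m + 1 + 1)).im| := by
    rw [← map_pow, norm_sub_rev, Complex.sub_conj]
    simp
  -- As `p^N = 1`, the difference `z̄^N - z^N = z̄^N - (p z)^N` is divisible by `z̄ - p z`. Taking
  -- `p = q` and `p = q̄` bounds it by the smaller factor of `ψ`, while the larger factor is at
  -- least `y ‖z‖`.
  have hA : ∀ p : ℂ, ‖p‖ = 1 → p ^ (m + 1 + 1) = 1 →
      2 * |(z ^ (m + 1 + 1)).im| ≤ (m + 1 + 1) * ‖z‖ * ‖conj z - p * z‖ := by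
    intro p hp hp1
    have h := norm_pow_sub_pow_le_mul (r := ‖z‖) (a := conj z) (b := p * z) (by simp)
      (by simp [hp]) (m + 1)
    rw [mul_pow, hp1, one_mul, hpow] at h
    refine h.trans ?_
    have : ‖z‖ ^ (m + 1) ≤ ‖z‖ := by
      calc ‖z‖ ^ (m + 1) = ‖z‖ ^ m * ‖z‖ := pow_succ _ _
        _ ≤ 1 * ‖z‖ := by gcongr; exact pow_le_one₀ (norm_nonneg _) hz
        _ = _ := one_mul _
    push_cast
    gcongr
  have h1 := hA q hqnorm hk1
  have h2 := hA (conj q) (by simpa using hqnorm) hk1'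
  rw [div_mul_eq_mul_div, le_div_iff₀ (by positivity)]
  have hn := norm_nonneg a
  have hn' := norm_nonneg b
  have hz0 := norm_nonneg z
  set T := |(z ^ (m + 1 + 1)).im|
  have hN : (0 : ℝ) < (m : ℝ) + 1 + 1 := by positivity
  have hfin : y * ‖z‖ * min ‖a‖ ‖b‖ ≤ 2 / γ * |psi γ z| := by
    rw [← hab]
    rcases le_total ‖a‖ ‖b‖ with h | h
    · rw [min_eq_left h]; nlinarith
    · rw [min_eq_right h]; nlinarith
  have hT : 2 * T ≤ (m + 1 + 1) * ‖z‖ * min ‖a‖ ‖b‖ := by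
    rcases le_total ‖a‖ ‖b‖ with h | h
    · rw [min_eq_left h]; exact h1
    · rw [min_eq_right h]; exact h2
  have h5 : 2 * T * (y * γ) ≤ (m + 1 + 1) * (2 * |psi γ z|) := by
    calc 2 * T * (y * γ) ≤ ((m + 1 + 1) * ‖z‖ * min ‖a‖ ‖b‖) * (y * γ) := by gcongr
      _ = (m + 1 + 1) * γ * (y * ‖z‖ * min ‖a‖ ‖b‖) := by ring
      _ ≤ (m + 1 + 1) * γ * (2 / γ * |psi γ z|) := by gcongr
      _ = _ := by field_simp
  nlinarith

/-! ### The defining function near the hyperbolic point -/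

section DefiningFunction

variable {γ : ℝ} {ρ : ℂ × ℂ → ℝ} {W : Set (ℂ × ℂ)}

/-- Second derivative of a function along a curve. -/
theorem curve_derivs {ρ : ℂ × ℂ → ℝ} {G G' : ℝ → ℂ × ℂ} {G'' : ℂ × ℂ}
    (hρ : ContDiffAt ℝ 2 ρ (G 0)) (h1 : ∀ᶠ τ in 𝓝 0, HasDerivAt G (G' τ) τ)
    (h2 : HasDerivAt G' G'' 0) :
    (∀ᶠ τ in 𝓝 0, HasDerivAt (fun τ => ρ (G τ)) (fderiv ℝ ρ (G τ) (G' τ)) τ) ∧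
      HasDerivAt (fun τ => fderiv ℝ ρ (G τ) (G' τ))
        (fderiv ℝ (fderiv ℝ ρ) (G 0) (G' 0) (G' 0) + fderiv ℝ ρ (G 0) G'') 0 := by
  have hc : ContinuousAt G 0 := h1.self_of_nhds.continuousAt
  constructor
  · have he : ∀ᶠ p in 𝓝 (G 0), ContDiffAt ℝ 2 ρ p := hρ.eventually (by simp)
    filter_upwards [h1, hc.eventually he] with τ a b
    exact (b.differentiableAt (by norm_num)).hasFDerivAt.comp_hasDerivAt τ a
  · have hd : DifferentiableAt ℝ (fderiv ℝ ρ) (G 0) :=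
      (hρ.fderiv_right (m := 1) (by norm_num)).differentiableAt (by norm_num)
    have h3 : HasDerivAt (fun τ => fderiv ℝ ρ (G τ)) (fderiv ℝ (fderiv ℝ ρ) (G 0) (G' 0)) 0 :=
      hd.hasFDerivAt.comp_hasDerivAt (0 : ℝ) h1.self_of_nhds
    exact h3.clm_apply h2

theorem IsGoodHyperbolicOrigin.contDiffAt (h : IsGoodHyperbolicOrigin γ ρ W) {p : ℂ × ℂ}
    (hp : p ∈ W) : ContDiffAt ℝ 2 ρ p := h.contDiffOn.contDiffAt (h.isOpen.mem_nhds hp)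

theorem IsGoodHyperbolicOrigin.apply_zero (h : IsGoodHyperbolicOrigin γ ρ W) : ρ 0 = 0 :=
  h.quadric_subset 0 h.zero_mem (by simp [quadric, psi])

/-- The curve `τ ↦ (τ z, τ² ψ(z))` lies in the quadric, so `ρ` vanishes along it; these are its
first two derivatives at `0`. -/
theorem IsGoodHyperbolicOrigin.quadric_derivs (h : IsGoodHyperbolicOrigin γ ρ W) (z : ℂ) :
    fderiv ℝ ρ 0 (z, 0) = 0 ∧
      fderiv ℝ (fderiv ℝ ρ) 0 (z, 0) (z, 0) + fderiv ℝ ρ 0 (0, ((2 * psi γ z : ℝ) : ℂ)) = 0 := by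
  set G : ℝ → ℂ × ℂ := fun τ => ((τ : ℂ) * z, ((psi γ z : ℝ) : ℂ) * (τ : ℂ) ^ 2) with hG
  set G' : ℝ → ℂ × ℂ := fun τ => (z, ((psi γ z : ℝ) : ℂ) * (2 * (τ : ℂ))) with hG'
  have hτ : ∀ τ : ℝ, HasDerivAt (fun τ : ℝ => (τ : ℂ)) 1 τ := fun τ => Complex.ofRealCLM.hasDerivAt
  have h1 : ∀ τ, HasDerivAt G (G' τ) τ := by
    intro τ
    have a1 : HasDerivAt (fun τ : ℝ => (τ : ℂ) * z) z τ := by simpa using (hτ τ).mul_const z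
    have a2 : HasDerivAt (fun τ : ℝ => ((psi γ z : ℝ) : ℂ) * (τ : ℂ) ^ 2)
        (((psi γ z : ℝ) : ℂ) * (2 * (τ : ℂ))) τ := by
      simpa using ((hτ τ).pow 2).const_mul ((psi γ z : ℝ) : ℂ)
    exact a1.prodMk a2
  have h2 : HasDerivAt G' (0, ((2 * psi γ z : ℝ) : ℂ)) 0 := by
    have a2 : HasDerivAt (fun τ : ℝ => ((psi γ z : ℝ) : ℂ) * (2 * (τ : ℂ)))
        (((2 * psi γ z : ℝ) : ℂ)) 0 := by
      refine (((hτ 0).const_mul 2).const_mul ((psi γ z : ℝ) : ℂ)).congr_deriv ?_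
      push_cast; ring
    exact (hasDerivAt_const (0 : ℝ) z).prodMk a2
  have hG0 : G 0 = 0 := by simp [hG]
  have hG0' : G' 0 = (z, 0) := by simp [hG']
  obtain ⟨c1, c2⟩ := curve_derivs (ρ := ρ) (G := G) (G' := G') (by rw [hG0]; exact h.contDiffAt h.zero_mem)
    (Eventually.of_forall h1) h2
  have hzero : ∀ᶠ τ in 𝓝 (0 : ℝ), ρ (G τ) = 0 := by
    have : ∀ᶠ τ in 𝓝 (0 : ℝ), G τ ∈ W :=
      (h1 0).continuousAt.eventually (by rw [hG0]; exact h.isOpen.mem_nhds h.zero_mem)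
    filter_upwards [this] with τ hτW
    refine h.quadric_subset _ hτW ?_
    simp [quadric, hG, psi_eq]
    ring
  have hder : ∀ᶠ τ in 𝓝 (0 : ℝ), fderiv ℝ ρ (G τ) (G' τ) = 0 := by
    filter_upwards [hzero.eventually_nhds, c1] with τ a b
    have : HasDerivAt (fun τ => ρ (G τ)) 0 τ :=
      (hasDerivAt_const τ (0 : ℝ)).congr_of_eventuallyEq a
    exact b.unique this
  have e1 := hder.self_of_nhds
  have e2 := c2.unique ((hasDerivAt_const (0 : ℝ) (0 : ℝ)).congr_of_eventuallyEq hder)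
  rw [hG0, hG0'] at e1 e2
  exact ⟨e1, e2⟩

/-- The derivative at the origin in the direction of the positive `w`-axis is negative. -/
theorem IsGoodHyperbolicOrigin.fderiv_neg (h : IsGoodHyperbolicOrigin γ ρ W) :
    fderiv ℝ ρ 0 (0, 1) < 0 := by
  have hl := h.strictly_levi_convex 0 h.zero_mem h.apply_zero (1, 0) (by simp)
    (h.quadric_derivs 1).1 (by simpa using (h.quadric_derivs Complex.I).1)
  have e1 := (h.quadric_derivs 1).2
  have e2 := (h.quadric_derivs Complex.I).2
  have key : ∀ t : ℝ, fderiv ℝ ρ 0 (0, (t : ℂ)) = t * fderiv ℝ ρ 0 (0, 1) := by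
    intro t
    have : ((0 : ℂ), (t : ℂ)) = t • ((0 : ℂ), (1 : ℂ)) := by simp
    rw [this, map_smul, smul_eq_mul]
  -- Since `ψ(1) + ψ(i) = 2`, the Levi form in the direction `(1, 0)` is `-4` times the derivative
  -- in question.
  rw [key, psi_eq] at e1 e2
  simp [leviForm] at hl e1 e2
  linarith

/-- The hypersurface as a perturbation of a real hyperplane, compared with the quadric. -/
theorem IsGoodHyperbolicOrigin.linear_estimate (h : IsGoodHyperbolicOrigin γ ρ W) {ε : ℝ}
    (hε : 0 < ε) : ∃ δ > 0, ∀ p : ℂ × ℂ, ‖p‖ < δ → p ∈ W ∧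
      |ρ p - fderiv ℝ ρ 0 (0, p.2 - (psi γ p.1 : ℂ))| ≤ ε * ‖p.2 - (psi γ p.1 : ℂ)‖ := by
  -- Strict differentiability compares `p` with the point of the quadric over the same `z`, where `ρ
  -- = 0`.
  have hs : HasStrictFDerivAt ρ (fderiv ℝ ρ 0) 0 :=
    (h.contDiffAt h.zero_mem).hasStrictFDerivAt (by norm_num)
  have h1 := hs.isLittleO.def hε
  have hc : Continuous fun p : ℂ × ℂ => (p, (p.1, ((psi γ p.1 : ℝ) : ℂ))) := by
    have := continuous_psi γ
    fun_prop
  have ht : Tendsto (fun p : ℂ × ℂ => (p, (p.1, ((psi γ p.1 : ℝ) : ℂ)))) (𝓝 0) (𝓝 (0, 0)) :=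
    hc.tendsto' 0 _ (by simp [psi])
  have hW : ∀ᶠ p : ℂ × ℂ in 𝓝 0, p ∈ W := h.isOpen.mem_nhds h.zero_mem
  have ht2 : Tendsto (fun p : ℂ × ℂ => (p.1, ((psi γ p.1 : ℝ) : ℂ))) (𝓝 0) (𝓝 0) :=
    (continuous_snd.comp hc).tendsto' 0 _ (by simp [psi])
  obtain ⟨δ, hδ, hh⟩ := Metric.eventually_nhds_iff.1 ((ht.eventually h1).and (hW.and (ht2.eventually hW)))
  refine ⟨δ, hδ, fun p hp => ?_⟩
  obtain ⟨a, b, c⟩ := hh (by simpa using hp)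
  refine ⟨b, ?_⟩
  have hz : ρ (p.1, ((psi γ p.1 : ℝ) : ℂ)) = 0 := h.quadric_subset _ c rfl
  have e : p - (p.1, ((psi γ p.1 : ℝ) : ℂ)) = (0, p.2 - ((psi γ p.1 : ℝ) : ℂ)) := by
    ext1 <;> simp
  simp only [hz, sub_zero, e] at a
  simpa [Prod.norm_def] using a

/-- The complex covector of the tangent hyperplane at the origin. -/
theorem IsGoodHyperbolicOrigin.exists_covector (h : IsGoodHyperbolicOrigin γ ρ W) :
    ∃ c : ℂ, ∃ k : ℝ, c.re = 1 ∧ 0 < k ∧ ∀ w : ℂ, fderiv ℝ ρ 0 (0, w) = -k * (c * w).re := by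
  have hk := h.fderiv_neg
  set d := fderiv ℝ ρ 0 (0, 1) with hd
  set d' := fderiv ℝ ρ 0 (0, Complex.I) with hd'
  -- The normalisation `Re c = 1` keeps `Re (c ψ(z)) = ψ(z)` for the real number `ψ(z)`.
  refine ⟨⟨1, -(d' / d)⟩, -d, rfl, by linarith, fun w => ?_⟩
  have : ((0 : ℂ), w) = w.re • ((0 : ℂ), (1 : ℂ)) + w.im • ((0 : ℂ), Complex.I) := by
    ext1
    · simp
    · simp [Complex.re_add_im]
  rw [this, map_add, map_smul, map_smul, ← hd, ← hd']
  have hd0 : d ≠ 0 := hk.ne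
  simp [Complex.mul_re]
  field_simp

/-- Tangency read on the side `ρ < 0`: a lower bound for a pluriharmonic function, which later
places `c w - γ z²` in a sector. -/
theorem IsGoodHyperbolicOrigin.re_ge (h : IsGoodHyperbolicOrigin γ ρ W) :
    ∃ c : ℂ, c.re = 1 ∧ ∀ ε > 0, ∃ δ > 0, ∀ p : ℂ × ℂ, ‖p‖ < δ → ρ p < 0 →
      psi γ p.1 - ε * (‖p.1‖ ^ 2 + ‖p.2‖) ≤ (c * p.2).re := by
  obtain ⟨c, k, hc, hk, hck⟩ := h.exists_covector
  refine ⟨c, hc, fun ε hε => ?_⟩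
  have hγ := h.one_lt
  set ε' := k * ε / (1 + γ) with hε'
  have hε'0 : 0 < ε' := by positivity
  obtain ⟨δ, hδ, hh⟩ := h.linear_estimate hε'0
  refine ⟨δ, hδ, fun p hp hneg => ?_⟩
  have h1 := (hh p hp).2
  rw [hck, abs_le] at h1
  have h2 : ‖p.2 - (psi γ p.1 : ℂ)‖ ≤ (1 + γ) * (‖p.1‖ ^ 2 + ‖p.2‖) := by
    refine (norm_sub_le _ _).trans ?_
    rw [Complex.norm_real, Real.norm_eq_abs]
    have := abs_psi_le hγ p.1
    nlinarith [norm_nonneg p.2]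
  have h3 : (c * (p.2 - (psi γ p.1 : ℂ))).re = (c * p.2).re - psi γ p.1 := by
    rw [mul_sub, Complex.sub_re, Complex.re_mul_ofReal, hc, one_mul]
  rw [h3] at h1
  have h4 : ε' * ‖p.2 - (psi γ p.1 : ℂ)‖ ≤ k * (ε * (‖p.1‖ ^ 2 + ‖p.2‖)) := by
    calc _ ≤ ε' * ((1 + γ) * (‖p.1‖ ^ 2 + ‖p.2‖)) := by gcongr
      _ = _ := by rw [hε']; field_simp
  have h5 : k * ((psi γ p.1 - (c * p.2).re) - ε * (‖p.1‖ ^ 2 + ‖p.2‖)) < 0 := by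
    nlinarith [h1.2]
  by_contra! hcon
  have := mul_pos hk (sub_pos.2 hcon)
  linarith

/-- Converts smallness relative to `ρ` into smallness relative to `w - ψ(z)`, the quantity to which
`h` reduces on the flat part. -/
theorem IsGoodHyperbolicOrigin.abs_apply_le (h : IsGoodHyperbolicOrigin γ ρ W) :
    ∃ K > 0, ∃ δ > 0, ∀ p : ℂ × ℂ, ‖p‖ < δ → |ρ p| ≤ K * ‖p.2 - (psi γ p.1 : ℂ)‖ := by
  obtain ⟨δ, hδ, hh⟩ := h.linear_estimate one_pos
  refine ⟨‖fderiv ℝ ρ 0‖ + 1, by positivity, δ, hδ, fun p hp => ?_⟩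
  have h1 := (hh p hp).2
  have h2 := (fderiv ℝ ρ 0).le_opNorm (0, p.2 - (psi γ p.1 : ℂ))
  have h3 : ‖((0 : ℂ), p.2 - (psi γ p.1 : ℂ))‖ = ‖p.2 - (psi γ p.1 : ℂ)‖ := by simp [Prod.norm_def]
  rw [h3, Real.norm_eq_abs] at h2
  have h4 := abs_sub_abs_le_abs_sub (ρ p) (fderiv ℝ ρ 0 (0, p.2 - (psi γ p.1 : ℂ)))
  linarith

end DefiningFunction

end HyperbolicDiscs

namespace HyperbolicDiscs

/-! ### A strictly plurisubharmonic modification of the defining function -/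

section Plurisubharmonic

variable {γ : ℝ} {ρ : ℂ × ℂ → ℝ} {W : Set (ℂ × ℂ)}

/-- The Laplacian of `ρ + C ρ²` along a holomorphic disc. -/
theorem hasLaplacianAt_comp {ρ : ℂ × ℂ → ℝ} {F : ℂ → ℂ × ℂ} {U : Set ℂ} (hU : IsOpen U)
    (hF : DifferentiableOn ℂ F U) {s : ℂ} (hs : s ∈ U) (hρ : ContDiffAt ℝ 2 ρ (F s)) (C : ℝ) :
    HasLaplacianAt (fun s => ρ (F s) + C * (ρ (F s) * ρ (F s))) s
      (leviForm ρ (F s) (deriv F s) * (1 + 2 * C * ρ (F s)) +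
        2 * C * ((fderiv ℝ ρ (F s) (deriv F s)) ^ 2 +
          (fderiv ℝ ρ (F s) (Complex.I • deriv F s)) ^ 2)) := by
  have key : ∀ v : ℂ, ∃ A : ℝ, A = fderiv ℝ (fderiv ℝ ρ) (F s) (v • deriv F s) (v • deriv F s) +
      fderiv ℝ ρ (F s) (v • v • deriv (deriv F) s) ∧
      HasDeriv2At (fun τ : ℝ => ρ (F (s + τ * v)) + C * (ρ (F (s + τ * v)) * ρ (F (s + τ * v))))
        (A * (1 + 2 * C * ρ (F s)) + 2 * C * (fderiv ℝ ρ (F s) (v • deriv F s)) ^ 2) := by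
    intro v
    obtain ⟨h1, h2⟩ := line_derivs hU hF hs v
    obtain ⟨c1, c2⟩ := curve_derivs (ρ := ρ) (G := fun τ : ℝ => F (s + τ * v))
      (G' := fun τ : ℝ => v • deriv F (s + τ * v)) (by simpa using hρ) h1 h2
    refine ⟨_, rfl, ?_⟩
    have hφ : HasDeriv2At (fun τ : ℝ => ρ (F (s + τ * v))) _ := ⟨_, c1, c2⟩
    have := hφ.add ((HasDeriv2At.mul c1 c2 c1 c2).const_mul C)
    simp only [Complex.ofReal_zero, zero_mul, add_zero] at this
    refine Eq.subst (motive := fun x => HasDeriv2At _ x) ?_ this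
    ring
  obtain ⟨A, hA, a⟩ := key 1
  obtain ⟨B, hB, b⟩ := key Complex.I
  refine ⟨_, _, ?_, a, b⟩
  have hI : Complex.I • Complex.I • deriv (deriv F) s = -deriv (deriv F) s := by
    rw [smul_smul, Complex.I_mul_I, neg_one_smul]
  rw [hI, map_neg] at hB
  simp only [one_smul] at hA ⊢
  have hAB : A + B = leviForm ρ (F s) (deriv F s) := by
    rw [hA, hB, leviForm]; ring
  rw [← hAB]
  ring

/-- In the `z`-direction the Hessian is `-2 ψ(z) dρ(0, 1)`, and `ψ(z) + ψ(iz) = 2 |z|²`; the other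
terms are bounded by the norm of the Hessian. -/
theorem IsGoodHyperbolicOrigin.leviForm_zero_ge (h : IsGoodHyperbolicOrigin γ ρ W) (v : ℂ × ℂ) :
    -4 * fderiv ℝ ρ 0 (0, 1) * ‖v.1‖ ^ 2 - 4 * ‖fderiv ℝ (fderiv ℝ ρ) 0‖ * (‖v.1‖ * ‖v.2‖) -
      2 * ‖fderiv ℝ (fderiv ℝ ρ) 0‖ * ‖v.2‖ ^ 2 ≤ leviForm ρ 0 v := by
  set H := fderiv ℝ (fderiv ℝ ρ) 0 with hH
  set d := fderiv ℝ ρ 0 (0, 1) with hd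
  have key : ∀ t : ℝ, fderiv ℝ ρ 0 (0, (t : ℂ)) = t * d := by
    intro t
    have : ((0 : ℂ), (t : ℂ)) = t • ((0 : ℂ), (1 : ℂ)) := by simp
    rw [this, map_smul, smul_eq_mul]
  have hb : ∀ a b : ℂ × ℂ, |H a b| ≤ ‖H‖ * (‖a‖ * ‖b‖) := by
    intro a b
    have := H.le_opNorm₂ a b
    rw [Real.norm_eq_abs] at this
    linarith
  have one : ∀ z w : ℂ, -2 * psi γ z * d - 2 * ‖H‖ * (‖z‖ * ‖w‖) - ‖H‖ * ‖w‖ ^ 2 ≤ H (z, w) (z, w) := by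
    intro z w
    have e : ((z, w) : ℂ × ℂ) = (z, 0) + (0, w) := by simp
    have e1 := (h.quadric_derivs z).2
    rw [key, ← hH] at e1
    rw [e]
    simp only [map_add, add_apply]
    have b1 := (abs_le.1 (hb (z, 0) (0, w))).1
    have b2 := (abs_le.1 (hb (0, w) (z, 0))).1
    have b3 := (abs_le.1 (hb (0, w) (0, w))).1
    have n1 : ‖((z, 0) : ℂ × ℂ)‖ = ‖z‖ := by simp [Prod.norm_def]
    have n2 : ‖((0, w) : ℂ × ℂ)‖ = ‖w‖ := by simp [Prod.norm_def]
    rw [n1, n2] at b1 b2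
    rw [n2] at b3
    nlinarith
  obtain ⟨z, w⟩ := v
  have h1 := one z w
  have h2 := one (Complex.I * z) (Complex.I * w)
  have hps : psi γ z + psi γ (Complex.I * z) = 2 * ‖z‖ ^ 2 := by
    rw [psi_eq, psi_eq, Complex.sq_norm, Complex.normSq_apply]
    simp
    ring
  simp only [norm_mul, Complex.norm_I, one_mul] at h2
  have hL : leviForm ρ 0 (z, w) = H (z, w) (z, w) + H (Complex.I * z, Complex.I * w) (Complex.I * z, Complex.I * w) := by
    simp [leviForm, hH]
  rw [hL]
  simp only
  have : psi γ z * d + psi γ (Complex.I * z) * d = 2 * ‖z‖ ^ 2 * d := by rw [← add_mul, hps]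
  nlinarith

/-- As `dρ(v) = -k Re (c v₂)` at the origin, the sum is `k² |c|² |v₂|²`, and `|c| ≥ Re c = 1`. This
is the positivity that `ρ²` supplies transversally. -/
theorem IsGoodHyperbolicOrigin.fderiv_sq_eq (h : IsGoodHyperbolicOrigin γ ρ W) :
    ∃ κ > 0, ∀ v : ℂ × ℂ, κ * ‖v.2‖ ^ 2 ≤
      (fderiv ℝ ρ 0 v) ^ 2 + (fderiv ℝ ρ 0 (Complex.I • v)) ^ 2 := by
  obtain ⟨c, k, hc, hk, hck⟩ := h.exists_covector
  refine ⟨k ^ 2, by positivity, fun v => ?_⟩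
  have e : ∀ v : ℂ × ℂ, fderiv ℝ ρ 0 v = -k * (c * v.2).re := by
    intro v
    have : v = (v.1, 0) + (0, v.2) := by ext1 <;> simp
    conv_lhs => rw [this]
    rw [map_add, (h.quadric_derivs v.1).1, hck, zero_add]
  rw [e, e]
  have e2 : (c * (Complex.I • v).2).re = -(c * v.2).im := by
    simp [Complex.mul_re, Complex.mul_im]; ring
  rw [e2]
  have e3 : (c * v.2).re ^ 2 + (c * v.2).im ^ 2 = Complex.normSq c * ‖v.2‖ ^ 2 := by
    rw [Complex.sq_norm, ← Complex.normSq_mul, Complex.normSq_apply]; ring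
  have e4 : 1 ≤ Complex.normSq c := by
    rw [Complex.normSq_apply, hc]; nlinarith [mul_self_nonneg c.im]
  calc k ^ 2 * ‖v.2‖ ^ 2 ≤ k ^ 2 * (Complex.normSq c * ‖v.2‖ ^ 2) := by
        gcongr; nlinarith [sq_nonneg ‖v.2‖]
    _ = _ := by rw [← e3]; ring

theorem continuousAt_norm_sub {X E : Type*} [TopologicalSpace X] [NormedAddCommGroup E] {f : X → E}
    {x : X} (hf : ContinuousAt f x) : ContinuousAt (fun y => ‖f y - f x‖) x :=
  (hf.sub continuousAt_const).norm

theorem norm_sub_apply_self {X E : Type*} [NormedAddCommGroup E] (f : X → E) (x : X) :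
    ‖f x - f x‖ = 0 := by simp

set_option maxHeartbeats 2000000 in
/-- `ρ + C ρ²` is strictly plurisubharmonic near the origin. -/
theorem IsGoodHyperbolicOrigin.exists_psh (h : IsGoodHyperbolicOrigin γ ρ W) :
    ∃ C ε δ : ℝ, 0 ≤ C ∧ 0 < ε ∧ 0 < δ ∧ ∀ p : ℂ × ℂ, ‖p‖ < δ → p ∈ W ∧ C * |ρ p| ≤ 1 / 2 ∧
      ∀ v : ℂ × ℂ, 4 * ε * Complex.normSq v.1 ≤ leviForm ρ p v * (1 + 2 * C * ρ p) +
        2 * C * ((fderiv ℝ ρ p v) ^ 2 + (fderiv ℝ ρ p (Complex.I • v)) ^ 2) := by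
  obtain ⟨κ, hκ, hκv⟩ := h.fderiv_sq_eq
  have hd := h.fderiv_neg
  set a := -4 * fderiv ℝ ρ 0 (0, 1) with ha
  have hapos : 0 < a := by linarith
  set K := ‖fderiv ℝ (fderiv ℝ ρ) 0‖ with hK
  have hK0 : 0 ≤ K := norm_nonneg (fderiv ℝ (fderiv ℝ ρ) 0)
  -- In the `v₂`-direction `C κ` has to absorb `2K` from the Hessian, `16 K² / a` from the cross
  -- term and at most `1` from the perturbation away from the origin.
  set C := (2 * K + 16 * K ^ 2 / a + 1) / κ with hC
  have hC0 : 0 ≤ C := by positivity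
  have hCκ : C * κ = 2 * K + 16 * K ^ 2 / a + 1 := by rw [hC]; field_simp
  set m := min (a / 4) 1 with hm
  have hmpos : 0 < m := lt_min (by linarith) one_pos
  have hcd := h.contDiffAt h.zero_mem
  have hc1 : ContinuousAt (fderiv ℝ ρ) 0 := (hcd.fderiv_right (m := 1) (by norm_num)).continuousAt
  have hc2 : ContinuousAt (fderiv ℝ (fderiv ℝ ρ)) 0 :=
    ((hcd.fderiv_right (m := 1) (by norm_num)).fderiv_right (m := 0) (by norm_num)).continuousAt
  have hc0 : ContinuousAt ρ 0 := hcd.continuousAt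
  set η : (ℂ × ℂ) → ℝ := fun p => ‖fderiv ℝ ρ p - fderiv ℝ ρ 0‖ with hη
  set θ : (ℂ × ℂ) → ℝ := fun p => ‖fderiv ℝ (fderiv ℝ ρ) p - fderiv ℝ (fderiv ℝ ρ) 0‖ with hθ
  have hηc : ContinuousAt η 0 := (hc1.sub continuousAt_const).norm
  have hθc : ContinuousAt θ 0 := continuousAt_norm_sub (f := fderiv ℝ (fderiv ℝ ρ)) (x := 0) hc2
  have hθ00 : θ 0 = 0 := norm_sub_apply_self (fderiv ℝ (fderiv ℝ ρ)) 0
  have herr : ContinuousAt (fun p => 2 * θ p + 4 * (C * |ρ p|) * (K + θ p) + 4 * C * (η p) ^ 2) 0 := by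
    have := hc0.abs
    fun_prop
  have h0 : ρ 0 = 0 := h.apply_zero
  have ev1 := herr.eventually_lt (continuousAt_const (y := m)) (by simp [hη, hθ00, h0, hmpos])
  have ev2 := (continuousAt_const.mul hc0.abs : ContinuousAt (fun p => C * |ρ p|) 0).eventually_lt
    (continuousAt_const (y := 1 / 2)) (by simp [h0])
  have ev3 : ∀ᶠ p in 𝓝 (0 : ℂ × ℂ), p ∈ W := h.isOpen.mem_nhds h.zero_mem
  obtain ⟨δ, hδ, hh⟩ := Metric.eventually_nhds_iff.1 (ev1.and (ev2.and ev3))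
  -- Of `a |v₁|²` one quarter pays for the cross term and at most one quarter for the perturbation;
  -- the remaining half is `4 · (a / 8)`.
  refine ⟨C, a / 8, δ, hC0, by positivity, hδ, fun p hp => ?_⟩
  obtain ⟨q1, q2, q3⟩ := hh (by simpa using hp)
  refine ⟨q3, q2.le, fun v => ?_⟩
  have hLv := h.leviForm_zero_ge v
  rw [← ha, ← hK] at hLv
  have hv2 : ‖v‖ ^ 2 ≤ ‖v.1‖ ^ 2 + ‖v.2‖ ^ 2 := by
    rcases max_choice ‖v.1‖ ‖v.2‖ with e | e <;> rw [Prod.norm_def, e] <;> nlinarith [sq_nonneg ‖v.1‖, sq_nonneg ‖v.2‖]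
  have hIv : ‖Complex.I • v‖ = ‖v‖ := by rw [norm_smul, Complex.norm_I, one_mul]
  have hθ0 : 0 ≤ θ p := norm_nonneg (fderiv ℝ (fderiv ℝ ρ) p - fderiv ℝ (fderiv ℝ ρ) 0)
  have hη0 : 0 ≤ η p := norm_nonneg _
  have hH : ∀ u : ℂ × ℂ, ‖u‖ = ‖v‖ →
      |fderiv ℝ (fderiv ℝ ρ) p u u - fderiv ℝ (fderiv ℝ ρ) 0 u u| ≤ θ p * ‖v‖ ^ 2 := by
    intro u hu
    have := (fderiv ℝ (fderiv ℝ ρ) p - fderiv ℝ (fderiv ℝ ρ) 0).le_opNorm₂ u u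
    rw [hu] at this
    simpa [hθ, pow_two, mul_assoc] using this
  have hH0 : ∀ u : ℂ × ℂ, ‖u‖ = ‖v‖ → |fderiv ℝ (fderiv ℝ ρ) 0 u u| ≤ K * ‖v‖ ^ 2 := by
    intro u hu
    have := (fderiv ℝ (fderiv ℝ ρ) 0).le_opNorm₂ u u
    rw [hu] at this
    simpa [hK, pow_two, mul_assoc] using this
  have hL1 : |leviForm ρ p v - leviForm ρ 0 v| ≤ 2 * θ p * ‖v‖ ^ 2 := by
    have a1 := abs_le.1 (hH v rfl)
    have a2 := abs_le.1 (hH (Complex.I • v) hIv)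
    rw [leviForm, leviForm, abs_le]
    constructor <;> linarith [a1.1, a1.2, a2.1, a2.2]
  have hL0 : |leviForm ρ 0 v| ≤ 2 * K * ‖v‖ ^ 2 := by
    have a1 := abs_le.1 (hH0 v rfl)
    have a2 := abs_le.1 (hH0 (Complex.I • v) hIv)
    rw [leviForm, abs_le]
    constructor <;> linarith [a1.1, a1.2, a2.1, a2.2]
  have hL2 : |leviForm ρ p v| ≤ 2 * (K + θ p) * ‖v‖ ^ 2 := by
    have := abs_sub_abs_le_abs_sub (leviForm ρ p v) (leviForm ρ 0 v)
    linarith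
  have hL3 : |leviForm ρ p v * (2 * C * ρ p)| ≤ 4 * (C * |ρ p|) * (K + θ p) * ‖v‖ ^ 2 := by
    rw [abs_mul, abs_mul, abs_of_nonneg (by positivity : 0 ≤ 2 * C)]
    calc _ ≤ (2 * (K + θ p) * ‖v‖ ^ 2) * (2 * C * |ρ p|) := by gcongr
      _ = _ := by ring
  have hD : ∀ u : ℂ × ℂ, ‖u‖ = ‖v‖ →
      (fderiv ℝ ρ 0 u) ^ 2 / 2 - (η p) ^ 2 * ‖v‖ ^ 2 ≤ (fderiv ℝ ρ p u) ^ 2 := by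
    intro u hu
    have := (fderiv ℝ ρ p - fderiv ℝ ρ 0).le_opNorm u
    rw [hu, sub_apply, Real.norm_eq_abs] at this
    have h2 : (fderiv ℝ ρ p u - fderiv ℝ ρ 0 u) ^ 2 ≤ (η p * ‖v‖) ^ 2 := sq_le_sq' (abs_le.1 this).1 (abs_le.1 this).2
    nlinarith [sq_nonneg (2 * fderiv ℝ ρ p u - fderiv ℝ ρ 0 u)]
  have hD1 := hD v rfl
  have hD2 := hD (Complex.I • v) hIv
  have hD3 := hκv v
  have hDs : κ * ‖v.2‖ ^ 2 / 2 - 2 * (η p) ^ 2 * ‖v‖ ^ 2 ≤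
      (fderiv ℝ ρ p v) ^ 2 + (fderiv ℝ ρ p (Complex.I • v)) ^ 2 := by linarith
  have hDC := mul_le_mul_of_nonneg_left hDs (by positivity : 0 ≤ 2 * C)
  have hE : (2 * θ p + 4 * (C * |ρ p|) * (K + θ p) + 4 * C * (η p) ^ 2) * ‖v‖ ^ 2 ≤
      m * (‖v.1‖ ^ 2 + ‖v.2‖ ^ 2) := by
    apply mul_le_mul q1.le hv2 (sq_nonneg _) hmpos.le
  have hm1 : m ≤ a / 4 := min_le_left _ _
  have hm2 : m ≤ 1 := min_le_right _ _
  have hcross : 4 * K * (‖v.1‖ * ‖v.2‖) ≤ a / 4 * ‖v.1‖ ^ 2 + 16 * K ^ 2 / a * ‖v.2‖ ^ 2 := by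
    have : 0 ≤ (a * ‖v.1‖ - 8 * K * ‖v.2‖) ^ 2 / (4 * a) := by positivity
    have e : (a * ‖v.1‖ - 8 * K * ‖v.2‖) ^ 2 / (4 * a) =
        a / 4 * ‖v.1‖ ^ 2 + 16 * K ^ 2 / a * ‖v.2‖ ^ 2 - 4 * K * (‖v.1‖ * ‖v.2‖) := by
      field_simp; ring
    linarith
  have hz : Complex.normSq v.1 = ‖v.1‖ ^ 2 := by rw [Complex.sq_norm]
  rw [hz]
  have e5 : 2 * C * (κ * ‖v.2‖ ^ 2 / 2 - 2 * (η p) ^ 2 * ‖v‖ ^ 2) =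
      (2 * K + 16 * K ^ 2 / a + 1) * ‖v.2‖ ^ 2 - 4 * C * (η p) ^ 2 * ‖v‖ ^ 2 := by
    rw [← hCκ]; ring
  rw [e5] at hDC
  have a1 := (abs_le.1 hL1).1
  have a3 := (abs_le.1 hL3).1
  have b1 := mul_le_mul_of_nonneg_right hm1 (sq_nonneg ‖v.1‖)
  have b2 := mul_le_mul_of_nonneg_right hm2 (sq_nonneg ‖v.2‖)
  nlinarith

end Plurisubharmonic

end HyperbolicDiscs

namespace HyperbolicDiscs

/-! ### Holomorphic functions with values in sectors -/

theorem exists_pos_lower_bound_mid {R : ℝ} (hR : 0 < R) {q : ℂ → ℝ} (hq : ContinuousOn q (chd R))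
    (hpos : ∀ s ∈ chd R, 0 < s.im → 0 < q s) :
    ∃ m > 0, ∀ s ∈ chd R, ‖s‖ = R → R / 2 ≤ s.im → m ≤ q s := by
  set A : Set ℂ := {s | s ∈ chd R ∧ R / 2 ≤ s.im} with hA
  have hAc : IsCompact A :=
    (isCompact_chd R).inter_right (isClosed_le continuous_const Complex.continuous_im)
  have hne : A.Nonempty := by
    refine ⟨R * Complex.I, ⟨?_, ?_⟩, ?_⟩ <;> simp [abs_of_pos hR, hR.le]
  obtain ⟨x, hx, hmin⟩ := hAc.exists_isMinOn hne (hq.mono fun s hs => hs.1)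
  refine ⟨q x, hpos x hx.1 (by linarith [hx.2]), fun s hs _ h => ?_⟩
  exact hmin (⟨hs, h⟩ : s ∈ A)

theorem sector_lower_bound {R α p : ℝ} (hR : 0 < R) (hp : 0 < p) (hα : p * α < Real.pi / 2)
    {h : ℂ → ℂ} (hc : ContinuousOn h (chd R)) (hd' : DifferentiableOn ℂ h (hd R))
    (hre : ∀ s ∈ chd R, 0 ≤ (h s).re) (harg : ∀ s ∈ chd R, |Complex.arg (h s)| ≤ α)
    (hne : ∀ s ∈ chd R, 0 < s.im → h s ≠ 0) :
    ∃ c > 0, ∀ s ∈ chd (R / 2), c * s.im ≤ ‖h s‖ ^ p := by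
  set q : ℂ → ℝ := fun s => ((h s) ^ (p : ℂ)).re with hq
  have hqeq : ∀ s, q s = ‖h s‖ ^ p * Real.cos (Complex.arg (h s) * p) := fun s =>
    Complex.cpow_ofReal_re _ _
  have hcos : ∀ s ∈ chd R, 0 < Real.cos (Complex.arg (h s) * p) := by
    intro s hs
    apply Real.cos_pos_of_mem_Ioo
    have : |Complex.arg (h s) * p| < Real.pi / 2 := by
      rw [abs_mul, abs_of_pos hp]
      nlinarith [harg s hs]
    exact abs_lt.1 this
  have hqc : ContinuousOn q (chd R) := by
    refine Complex.continuous_re.comp_continuousOn fun s hs => ?_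
    exact (Complex.continuousAt_cpow_const_of_re_pos (w := (p : ℂ)) (Or.inl (hre s hs))
      (by simpa using hp)).comp_continuousWithinAt (hc s hs)
  have hslit : ∀ s ∈ hd R, h s ∈ Complex.slitPlane := by
    intro s hs
    rw [Complex.mem_slitPlane_iff_arg]
    refine ⟨fun hpi => ?_, hne s (hd_subset_chd R hs) hs.2⟩
    have h2 := hre s (hd_subset_chd R hs)
    rw [Complex.arg_eq_pi_iff] at hpi
    linarith [hpi.1]
  have hdq : DifferentiableOn ℂ (fun s => (h s) ^ (p : ℂ)) (hd R) :=
    hd'.cpow (differentiableOn_const _) hslit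
  have hpos : ∀ s ∈ chd R, 0 < s.im → 0 < q s := by
    intro s hs h0
    rw [hqeq]
    exact mul_pos (Real.rpow_pos_of_pos (norm_pos_iff.2 (hne s hs h0)) _) (hcos s hs)
  have hnn : ∀ s ∈ chd R, 0 ≤ q s := by
    intro s hs
    rw [hqeq]
    exact mul_nonneg (Real.rpow_nonneg (norm_nonneg _) _) (hcos s hs).le
  obtain ⟨m, hm, hmid⟩ := exists_pos_lower_bound_mid hR hqc hpos
  refine ⟨5 / 12 * m / R, by positivity, fun s hs => ?_⟩
  have hsR : s ∈ chd R := chd_mono (by linarith) hs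
  have := hopf_lower_bound hR hm.le hqc
    (fun s hs => ⟨0, le_rfl, hasLaplacianAt_re (isOpen_hd R) hdq hs⟩) (fun s hs _ => hnn s hs) hmid
    s hsR hs.1
  refine this.trans ?_
  rw [hqeq]
  have h1 := Real.rpow_nonneg (norm_nonneg (h s)) p
  nlinarith [Real.cos_le_one (Complex.arg (h s) * p)]

theorem abs_arg_le_of_abs_im_le {ε : ℝ} {x : ℂ} (hε : 0 < ε) (h : |x.im| ≤ ε * x.re) :
    |Complex.arg x| ≤ ε := by
  have hre : 0 ≤ x.re := nonneg_of_mul_nonneg_right ((abs_nonneg _).trans h) hε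
  rcases hre.lt_or_eq with h0 | h0
  · have h1 := Complex.abs_arg_lt_pi_div_two_iff.2 (Or.inl h0)
    have h2 := Complex.tan_arg x
    have h3 : |Real.tan (Complex.arg x)| ≤ ε := by
      rw [h2, abs_div, abs_of_pos h0, div_le_iff₀ h0]; exact h
    refine le_trans ?_ h3
    rw [abs_lt] at h1
    rcases le_total 0 (Complex.arg x) with h4 | h4
    · rw [abs_of_nonneg h4]
      exact (Real.le_tan h4 h1.2).trans (le_abs_self _)
    · rw [abs_of_nonpos h4]
      have := Real.le_tan (x := -Complex.arg x) (by linarith) (by linarith [h1.1])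
      rw [Real.tan_neg] at this
      exact this.trans (neg_le_abs _)
  · rw [← h0, mul_zero] at h
    have : x = 0 := Complex.ext h0.symm (abs_nonpos_iff.1 h)
    simp [this, hε.le]

/-- A Phragmén–Lindelöf principle for the argument, with exceptional set the zeros of `h`. -/
theorem abs_arg_le_barrier {R ε : ℝ} (hR : 0 < R) (hε : 0 < ε) {h : ℂ → ℂ}
    (hc : ContinuousOn h (chd R)) (hd' : DifferentiableOn ℂ h (hd R))
    (hle : ∀ s ∈ chd R, ‖h s‖ ≤ 1) (hpos : ∀ s ∈ chd R, 0 < s.im → 0 < (h s).re)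
    (hflat : ∀ s ∈ chd R, s.im = 0 → |(h s).im| ≤ ε * (h s).re) :
    ∀ s ∈ chd R, 0 < s.im →
      |Complex.arg (h s)| ≤ ε + Real.pi / 2 * ((s ^ 2).re / R ^ 2 + 3 * s.im / R) := by
  set β : ℂ → ℝ := fun s => (s ^ 2).re / R ^ 2 + 3 * s.im / R with hβ
  have hre : ∀ s ∈ chd R, 0 ≤ (h s).re := by
    intro s hs
    rcases hs.2.lt_or_eq with h0 | h0
    · exact (hpos s hs h0).le
    · have := (abs_nonneg _).trans (hflat s hs h0.symm)
      exact nonneg_of_mul_nonneg_right this hε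
  have hargb : ∀ s ∈ chd R, (s.im = 0 ∨ ‖s‖ = R) → |Complex.arg (h s)| ≤ ε + Real.pi / 2 * β s := by
    intro s hs hb
    by_cases h0 : s.im = 0
    · have h1 := abs_arg_le_of_abs_im_le hε (hflat s hs h0)
      have : 0 ≤ β s := by
        simp only [hβ, pow_two s, Complex.mul_re, h0]
        have := mul_self_nonneg s.re
        have : 0 ≤ s.re * s.re / R ^ 2 := by positivity
        simpa using this
      have := mul_nonneg Real.pi_div_two_pos.le this
      linarith
    · have hn := hb.resolve_left h0
      have h1 : |Complex.arg (h s)| ≤ Real.pi / 2 :=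
        Complex.abs_arg_le_pi_div_two_iff.2 (hre s hs)
      -- On the arc only `|arg h| ≤ π / 2` is known; with `t = Im s / R` in `[0, 1]` one has `β = 1
      -- - 2t² + 3t ≥ 1`.
      have h2 : 1 ≤ β s := by
        have e : s.re ^ 2 = R ^ 2 - s.im ^ 2 := by
          rw [← hn, Complex.sq_norm, Complex.normSq_apply]; ring
        have e1 : 0 ≤ s.im / R := div_nonneg hs.2 hR.le
        have e2 : s.im / R ≤ 1 := by
          rw [div_le_one hR, ← hn]; exact (le_abs_self _).trans (Complex.abs_im_le_norm s)
        have e3 : β s = 1 - 2 * (s.im / R) ^ 2 + 3 * (s.im / R) := by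
          simp only [hβ, pow_two s, Complex.mul_re]
          have : s.re * s.re - s.im * s.im = R ^ 2 - 2 * s.im ^ 2 := by linarith
          rw [this]; field_simp
        rw [e3]; nlinarith
      have := mul_le_mul_of_nonneg_left h2 Real.pi_div_two_pos.le
      linarith
  have main : ∀ σ : ℝ, (σ = 1 ∨ σ = -1) → ∀ s ∈ chd R, 0 < s.im →
      σ * Complex.arg (h s) ≤ ε + Real.pi / 2 * β s := by
    intro σ hσ s hs h0
    have hη : ∀ η : ℝ, 0 < η → ‖h s‖ ^ η * Real.exp (σ * Complex.arg (h s)) ≤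
        Real.exp (ε + Real.pi / 2 * β s) := by
      intro η hη
      -- `|h^e| = |h|^η exp(σ arg h)`: the imaginary part of the exponent records the argument, and
      -- the small real part makes the power continuous at the zeros of `h`.
      set e : ℂ := ⟨η, -σ⟩ with he
      set P : ℂ → ℂ := fun s => -((Real.pi / 2 : ℝ) : ℂ) * (s ^ 2 * ((1 / R ^ 2 : ℝ) : ℂ)
        - 3 * Complex.I * s * ((1 / R : ℝ) : ℂ)) with hP
      have hPre : ∀ s, (P s).re = -(Real.pi / 2 * β s) := by
        intro s
        simp only [hP, ← Complex.ofReal_neg, Complex.re_ofReal_mul, Complex.sub_re,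
          Complex.re_mul_ofReal, hβ]
        simp
        ring
      set Φ : ℂ → ℂ := fun s => (h s) ^ e * Complex.exp (P s) with hΦ
      have hΦn : ∀ s, h s ≠ 0 → ‖Φ s‖ = ‖h s‖ ^ η * Real.exp (σ * Complex.arg (h s)) *
          Real.exp (-(Real.pi / 2 * β s)) := by
        intro s hs
        simp only [hΦ, norm_mul, Complex.norm_exp, hPre, Complex.norm_cpow_of_ne_zero hs, he]
        rw [div_eq_mul_inv, ← Real.exp_neg]
        congr 3
        ring
      have hΦ0 : ∀ s, h s = 0 → Φ s = 0 := by
        intro s hs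
        have : e ≠ 0 := fun h => hη.ne' (congrArg Complex.re h)
        simp [hΦ, hs, Complex.zero_cpow this]
      have hb := norm_le_of_boundary (R := R) (C := Real.exp ε) (F := Φ) ?_ ?_ ?_ s hs
      · have hne : h s ≠ 0 := fun h1 => by
          have := hpos s hs h0; rw [h1] at this; simp at this
        rw [hΦn s hne, Real.exp_neg, ← div_eq_mul_inv, div_le_iff₀ (Real.exp_pos _), ← Real.exp_add] at hb
        exact hb
      · refine ContinuousOn.mul (fun s hs => ?_) ?_
        · exact (Complex.continuousAt_cpow_const_of_re_pos (Or.inl (hre s hs))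
            (by simpa [he] using hη)).comp_continuousWithinAt (hc s hs)
        · have : Continuous P := by fun_prop
          exact (Complex.continuous_exp.comp this).continuousOn
      · refine DifferentiableOn.mul ?_ ?_
        · exact hd'.cpow (differentiableOn_const _) fun s hs =>
            Or.inl (hpos s (hd_subset_chd R hs) hs.2)
        · have : Differentiable ℂ P := by fun_prop
          exact this.cexp.differentiableOn
      · intro s hs hbd
        by_cases hz : h s = 0
        · rw [hΦ0 s hz, norm_zero]; exact (Real.exp_pos _).le
        · rw [hΦn s hz]
          have h1 : ‖h s‖ ^ η ≤ 1 := Real.rpow_le_one (norm_nonneg _) (hle s hs) hη.le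
          have h2 : σ * Complex.arg (h s) ≤ |Complex.arg (h s)| := by
            rcases hσ with rfl | rfl
            · rw [one_mul]; exact le_abs_self _
            · rw [neg_one_mul]; exact neg_le_abs _
          have h3 := h2.trans (hargb s hs hbd)
          calc _ ≤ 1 * Real.exp (σ * Complex.arg (h s)) * Real.exp (-(Real.pi / 2 * β s)) := by gcongr
            _ = Real.exp (σ * Complex.arg (h s) - Real.pi / 2 * β s) := by
              rw [one_mul, ← Real.exp_add]; rfl
            _ ≤ _ := Real.exp_le_exp.2 (by linarith)
    have hne : ‖h s‖ ≠ 0 := by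
      intro h1
      have := hpos s hs h0; rw [norm_eq_zero.1 h1] at this; simp at this
    -- At a point where `h ≠ 0` the auxiliary factor `|h|^η` disappears as `η → 0`.
    have hlim : Tendsto (fun η : ℝ => ‖h s‖ ^ η * Real.exp (σ * Complex.arg (h s))) (𝓝[>] 0)
        (𝓝 (‖h s‖ ^ (0 : ℝ) * Real.exp (σ * Complex.arg (h s)))) :=
      (((Real.continuousAt_const_rpow hne).tendsto).mono_left nhdsWithin_le_nhds).mul_const _
    have h4 := le_of_tendsto hlim (by filter_upwards [self_mem_nhdsWithin] with η hη' using hη η hη')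
    rw [Real.rpow_zero, one_mul] at h4
    exact Real.exp_le_exp.1 h4
  intro s hs h0
  rw [abs_le]
  have h1 := main 1 (Or.inl rfl) s hs h0
  have h2 := main (-1) (Or.inr rfl) s hs h0
  constructor <;> linarith

/-- The square root `(-is)^{1/2}` on the upper half-plane. -/
theorem re_sqrt_ge {s : ℂ} (hs : 0 ≤ s.im) :
    Real.sqrt ‖s‖ / 2 ≤ ((-Complex.I * s) ^ ((1 / 2 : ℝ) : ℂ)).re := by
  rw [Complex.cpow_ofReal_re]
  have h1 : |Complex.arg (-Complex.I * s)| ≤ Real.pi / 2 := by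
    rw [Complex.abs_arg_le_pi_div_two_iff]; simpa using hs
  have h2 : ‖-Complex.I * s‖ = ‖s‖ := by simp
  rw [h2, ← Real.sqrt_eq_rpow, div_eq_mul_inv]
  apply mul_le_mul_of_nonneg_left _ (Real.sqrt_nonneg _)
  have h3 : Real.cos (Real.pi / 3) ≤ Real.cos (Complex.arg (-Complex.I * s) * (1 / 2)) := by
    rw [← Real.cos_abs (Complex.arg (-Complex.I * s) * (1 / 2))]
    apply Real.cos_le_cos_of_nonneg_of_le_pi (abs_nonneg _)
    · linarith [Real.pi_pos]
    · rw [abs_mul, abs_of_pos (by norm_num : (0 : ℝ) < 1 / 2)]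
      linarith [Real.pi_pos]
  rw [Real.cos_pi_div_three] at h3
  linarith

theorem norm_sqrt (s : ℂ) : ‖(-Complex.I * s) ^ ((1 / 2 : ℝ) : ℂ)‖ = Real.sqrt ‖s‖ := by
  rw [Complex.norm_cpow_real, Real.sqrt_eq_rpow]
  simp

/-- The maximum principle against `C' Re √(-is)`, a harmonic function comparable with `√|s|` on the
closed half-disc. -/
theorem abs_im_le_sqrt {R C : ℝ} (hR : 0 < R) {X : ℂ → ℂ} (hc : ContinuousOn X (chd R))
    (hd' : DifferentiableOn ℂ X (hd R))
    (hflat : ∀ s ∈ chd R, s.im = 0 → |(X s).im| ≤ C * Real.sqrt ‖s‖) :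
    ∃ C' > 0, ∀ s ∈ chd R, |(X s).im| ≤ C' * Real.sqrt ‖s‖ := by
  obtain ⟨B, hB⟩ := (isCompact_chd R).exists_bound_of_continuousOn hc
  have hB0 : 0 ≤ B := (norm_nonneg _).trans (hB 0 (zero_mem_chd hR.le))
  have hsR : 0 < Real.sqrt R := Real.sqrt_pos.2 hR
  -- The factor `2` compensates for `re_sqrt_ge`; `|C|` serves the flat part and `B / √R` the arc.
  set C' := 2 * (|C| + B / Real.sqrt R + 1) with hC'
  have hC'0 : 0 < C' := by positivity
  set E : ℂ → ℂ := fun s => (-Complex.I * s) ^ ((1 / 2 : ℝ) : ℂ) with hE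
  have hEc : ContinuousOn E (chd R) := by
    intro s hs
    refine (Complex.continuousAt_cpow_const_of_re_pos (z := -Complex.I * s) (Or.inl ?_) ?_).comp_continuousWithinAt
      (f := fun s => -Complex.I * s) (by fun_prop)
    · simpa using hs.2
    · norm_num
  have hEd : DifferentiableOn ℂ E (hd R) := by
    refine DifferentiableOn.cpow (by fun_prop) (differentiableOn_const _) fun s hs => Or.inl ?_
    simpa using hs.2
  have main : ∀ σ : ℝ, (σ = 1 ∨ σ = -1) → ∀ s ∈ chd R, σ * (X s).im ≤ C' * Real.sqrt ‖s‖ := by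
    intro σ hσ s hs
    set F : ℂ → ℂ := fun s => -((σ : ℂ) * Complex.I) * X s - (C' : ℂ) * E s with hF
    have hFre : ∀ s, (F s).re = σ * (X s).im - C' * (E s).re := by
      intro s; simp [hF]
    have hFc : ContinuousOn F (chd R) := (continuousOn_const.mul hc).sub (continuousOn_const.mul hEc)
    have hFd : DifferentiableOn ℂ F (hd R) := (hd'.const_mul _).sub (hEd.const_mul _)
    have h1 := le_zero_of_laplacian_nonneg (q := fun s => (F s).re)
      (Complex.continuous_re.comp_continuousOn hFc)
      (fun s hs => ⟨0, le_rfl, hasLaplacianAt_re (isOpen_hd R) hFd hs⟩) ?_ s hs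
    · rw [hFre] at h1
      have h2 : (E s).re ≤ Real.sqrt ‖s‖ := (Complex.re_le_norm _).trans (norm_sqrt s).le
      nlinarith
    · intro s hs hb
      simp only [hFre]
      have h2 := re_sqrt_ge hs.2
      have h3 : σ * (X s).im ≤ |(X s).im| := by
        rcases hσ with rfl | rfl
        · rw [one_mul]; exact le_abs_self _
        · rw [neg_one_mul]; exact neg_le_abs _
      have h4 : |(X s).im| ≤ C' * (Real.sqrt ‖s‖ / 2) := by
        have h6 := Real.sqrt_nonneg ‖s‖
        rcases hb with h | h
        · have h5 := hflat s hs h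
          have h7 : 0 ≤ B / Real.sqrt R := by positivity
          have h8 := le_abs_self C
          have : C * Real.sqrt ‖s‖ ≤ (|C| + B / Real.sqrt R + 1) * Real.sqrt ‖s‖ := by gcongr; linarith
          rw [hC']; linarith
        · have h5 := (Complex.abs_im_le_norm _).trans (hB s hs)
          rw [h]
          have e : C' * (Real.sqrt R / 2) = |C| * Real.sqrt R + B + Real.sqrt R := by
            rw [hC']; field_simp
          rw [e]
          have := mul_nonneg (abs_nonneg C) hsR.le
          linarith
      have := mul_le_mul_of_nonneg_left h2 hC'0.le
      simp only [hE]
      linarith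
  refine ⟨C', hC'0, fun s hs => ?_⟩
  rw [abs_le]
  have h1 := main 1 (Or.inl rfl) s hs
  have h2 := main (-1) (Or.inr rfl) s hs
  constructor <;> linarith

/-- A holomorphic function almost real on the flat part decays along the imaginary axis. -/
theorem norm_le_sqrt_of_flat {R C : ℝ} (hR : 0 < R) {X : ℂ → ℂ} (hc : ContinuousOn X (chd R))
    (hd' : DifferentiableOn ℂ X (hd R)) (h0 : X 0 = 0)
    (hflat : ∀ s ∈ chd R, s.im = 0 → |(X s).im| ≤ C * Real.sqrt ‖s‖) :
    ∃ C' > 0, ∀ t : ℝ, 0 < t → t ≤ R / 2 → ‖X (t * Complex.I)‖ ≤ C' * Real.sqrt t := by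
  obtain ⟨K, hK, hKX⟩ := abs_im_le_sqrt hR hc hd' hflat
  set M := 4 * K * Real.exp 2 with hM
  have hmem : ∀ t : ℝ, 0 < t → t ≤ R / 2 → (t : ℂ) * Complex.I ∈ hd R := fun t h1 h2 =>
    I_mul_mem_hd h1 (by linarith)
  have hderiv : ∀ t : ℝ, 0 < t → t ≤ R / 2 → ‖deriv X (t * Complex.I)‖ ≤ M / Real.sqrt t := by
    intro t ht htR
    have hst : 0 < Real.sqrt t := Real.sqrt_pos.2 ht
    set m := 2 * K * Real.sqrt t with hm
    have hm0 : 0 < m := by positivity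
    set c : ℂ := (t : ℂ) * Complex.I with hcdef
    have hball : ∀ s ∈ Metric.closedBall c (t / 2), s ∈ hd R ∧ ‖s‖ ≤ 4 * t := by
      intro s hs
      rw [mem_closedBall_iff_norm] at hs
      have hcn : ‖c‖ = t := by simp [hcdef, abs_of_pos ht]
      have h1 : ‖s‖ ≤ t / 2 + t := by
        calc ‖s‖ = ‖(s - c) + c‖ := by ring_nf
          _ ≤ _ := (norm_add_le _ _).trans (by rw [hcn]; linarith)
      have h2 := (abs_le.1 ((Complex.abs_im_le_norm (s - c)).trans hs)).1
      have h3 : (s - c).im = s.im - t := by simp [hcdef]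
      rw [h3] at h2
      exact ⟨⟨by linarith, by linarith⟩, by linarith⟩
    have him : ∀ s ∈ Metric.closedBall c (t / 2), |(X s).im| ≤ m := by
      intro s hs
      obtain ⟨h1, h2⟩ := hball s hs
      refine (hKX s (hd_subset_chd R h1)).trans ?_
      have : Real.sqrt ‖s‖ ≤ 2 * Real.sqrt t := by
        have : Real.sqrt (4 * t) = 2 * Real.sqrt t := by
          rw [Real.sqrt_mul (by norm_num), show (4 : ℝ) = 2 ^ 2 by norm_num, Real.sqrt_sq (by norm_num)]
        rw [← this]; exact Real.sqrt_le_sqrt h2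
      rw [hm]; nlinarith
    -- `|Y| = exp(Im X / m)` lies between `e⁻¹` and `e` on the disc of radius `t / 2`, so Cauchy's
    -- estimate for `Y'` bounds `X'` using only `Im X`.
    set Y : ℂ → ℂ := fun s => Complex.exp (-Complex.I * ((1 / m : ℝ) : ℂ) * X s) with hY
    have hYn : ∀ s, ‖Y s‖ = Real.exp ((X s).im / m) := by
      intro s
      simp only [hY, Complex.norm_exp]
      congr 1
      rw [mul_assoc, Complex.mul_re, Complex.re_ofReal_mul, Complex.im_ofReal_mul]
      simp
      ring
    have hXd : ∀ s ∈ Metric.closedBall c (t / 2), DifferentiableAt ℂ X s := fun s hs =>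
      hd'.differentiableAt ((isOpen_hd R).mem_nhds (hball s hs).1)
    have hYd : DifferentiableOn ℂ Y (Metric.closedBall c (t / 2)) := fun s hs =>
      (((hXd s hs).const_mul _).cexp).differentiableWithinAt
    have ht2 : 0 < t / 2 := by linarith
    have hbound := Complex.norm_deriv_le_of_forall_mem_sphere_norm_le (f := Y) (C := Real.exp 1) ht2
      (hYd.diffContOnCl_ball subset_rfl) (fun s hs => by
        rw [hYn]
        apply Real.exp_le_exp.2
        rw [div_le_one hm0]
        exact (le_abs_self _).trans (him s (Metric.sphere_subset_closedBall hs)))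
    have hcc : c ∈ Metric.closedBall c (t / 2) := Metric.mem_closedBall_self ht2.le
    have hYder : deriv Y c = Y c * (-Complex.I * ((1 / m : ℝ) : ℂ) * deriv X c) := by
      have := ((hXd c hcc).hasDerivAt.const_mul (-Complex.I * ((1 / m : ℝ) : ℂ))).cexp
      exact this.deriv
    rw [hYder, norm_mul, hYn, norm_mul, norm_mul, norm_neg, Complex.norm_I, one_mul, Complex.norm_real,
      Real.norm_eq_abs, abs_of_pos (by positivity : 0 < 1 / m)] at hbound
    have hlow : Real.exp (-1) ≤ Real.exp ((X c).im / m) := by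
      apply Real.exp_le_exp.2
      rw [le_div_iff₀ hm0]
      have := (abs_le.1 (him c hcc)).1
      linarith
    have h5 : Real.exp (-1) * (1 / m * ‖deriv X c‖) ≤ Real.exp 1 / (t / 2) :=
      (mul_le_mul_of_nonneg_right hlow (by positivity)).trans hbound
    have h6 : ‖deriv X c‖ ≤ Real.exp 2 * (m * (2 / t)) := by
      have e2 : Real.exp 2 = Real.exp 1 * Real.exp 1 := by rw [← Real.exp_add]; norm_num
      have e1 : Real.exp 1 * Real.exp (-1) = 1 := by rw [← Real.exp_add]; simp
      have := mul_le_mul_of_nonneg_left h5 (by positivity : 0 ≤ Real.exp 1 * m)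
      have l : Real.exp 1 * m * (Real.exp (-1) * (1 / m * ‖deriv X c‖)) = ‖deriv X c‖ := by
        calc _ = (Real.exp 1 * Real.exp (-1)) * (m * (1 / m)) * ‖deriv X c‖ := by ring
          _ = _ := by rw [e1, mul_one_div_cancel hm0.ne']; ring
      rw [l] at this
      refine this.trans_eq ?_
      rw [e2]; field_simp
    refine h6.trans_eq ?_
    rw [hM, hm, eq_div_iff hst.ne']
    have : Real.sqrt t * Real.sqrt t = t := Real.mul_self_sqrt ht.le
    field_simp
    nlinarith
  have hM0 : 0 < M := by positivity
  refine ⟨2 * M, by positivity, fun t ht htR => ?_⟩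
  -- Integration of `M / √x` from `η` to `t`; afterwards `η → 0`, where `X` vanishes.
  have hη : ∀ η : ℝ, 0 < η → η < t → ‖X (t * Complex.I)‖ ≤ ‖X (η * Complex.I)‖ + 2 * M * Real.sqrt t := by
    intro η hη hηt
    have hX' : ∀ x ∈ Icc η t, HasDerivAt (fun x : ℝ => X (x * Complex.I))
        (Complex.I • deriv X (x * Complex.I)) x := by
      intro x hx
      have h1 := (hd'.differentiableAt ((isOpen_hd R).mem_nhds
        (hmem x (by linarith [hx.1]) (by linarith [hx.2])))).hasDerivAt
      have h2 := hasDerivAt_comp_line (F := X) (F' := deriv X) (s := 0) (v := Complex.I) (τ := x)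
        (by simpa using h1)
      simpa using h2
    have := image_norm_le_of_norm_deriv_right_le_deriv_boundary' (a := η) (b := t)
      (f := fun x : ℝ => X (x * Complex.I)) (f' := fun x : ℝ => Complex.I • deriv X (x * Complex.I))
      (B := fun x => ‖X (η * Complex.I)‖ + 2 * M * Real.sqrt x) (B' := fun x => M / Real.sqrt x)
      (fun x hx => (hX' x hx).continuousAt.continuousWithinAt)
      (fun x hx => (hX' x (Ico_subset_Icc_self hx)).hasDerivWithinAt)
      (by have := Real.sqrt_nonneg η; have : 0 ≤ 2 * M * Real.sqrt η := by positivity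
          simpa using this)
      (by fun_prop)
      (fun x hx => by
        have hx0 : x ≠ 0 := (hη.trans_le hx.1).ne'
        have h3 := ((Real.hasDerivAt_sqrt hx0).const_mul (2 * M)).const_add ‖X (η * Complex.I)‖
        refine HasDerivAt.hasDerivWithinAt (h3.congr_deriv ?_)
        field_simp)
      (fun x hx => by
        rw [norm_smul, Complex.norm_I, one_mul]
        exact hderiv x (hη.trans_le hx.1) (by linarith [hx.2]))
    exact this (right_mem_Icc.2 hηt.le)
  have hlim : Tendsto (fun η : ℝ => ‖X (η * Complex.I)‖ + 2 * M * Real.sqrt t) (𝓝[>] 0)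
      (𝓝 (‖X 0‖ + 2 * M * Real.sqrt t)) := by
    refine Tendsto.add_const _ (Tendsto.norm ?_)
    have hin : Tendsto (fun η : ℝ => (η : ℂ) * Complex.I) (𝓝[>] 0) (𝓝[chd R] 0) := by
      refine tendsto_nhdsWithin_iff.2 ⟨?_, ?_⟩
      · have : Continuous fun η : ℝ => (η : ℂ) * Complex.I := by fun_prop
        exact (this.tendsto' 0 0 (by simp)).mono_left nhdsWithin_le_nhds
      · filter_upwards [Ioo_mem_nhdsGT (by linarith : (0 : ℝ) < R / 2)] with η hη
        exact hd_subset_chd R (hmem η hη.1 hη.2.le)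
    exact (hc 0 (zero_mem_chd hR.le)).tendsto.comp hin
  have := ge_of_tendsto hlim (by
    filter_upwards [Ioo_mem_nhdsGT ht] with η h using hη η h.1 h.2)
  simpa [h0] using this

end HyperbolicDiscs

namespace HyperbolicDiscs

/-! ### Half-discs attached to the quadric at the hyperbolic point -/

/-- A disc attached to the quadric near a boundary point mapped to the hyperbolic point, read on a
half-disc. -/
structure IsLocalDisc (γ : ℝ) (ρ : ℂ × ℂ → ℝ) (R : ℝ) (z w : ℂ → ℂ) : Prop where
  pos : 0 < R
  cont_z : ContinuousOn z (chd R)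
  cont_w : ContinuousOn w (chd R)
  diff_z : DifferentiableOn ℂ z (hd R)
  diff_w : DifferentiableOn ℂ w (hd R)
  z_zero : z 0 = 0
  z_ne : ∀ s ∈ chd R, s ≠ 0 → z s ≠ 0
  flat : ∀ s ∈ chd R, s.im = 0 → w s = (psi γ (z s) : ℂ)
  neg : ∀ s ∈ chd R, 0 < s.im → ρ (z s, w s) < 0

namespace IsLocalDisc

variable {γ : ℝ} {ρ : ℂ × ℂ → ℝ} {W : Set (ℂ × ℂ)} {R : ℝ} {z w : ℂ → ℂ}

theorem mono (h : IsLocalDisc γ ρ R z w) {r : ℝ} (hr : 0 < r) (hrR : r ≤ R) :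
    IsLocalDisc γ ρ r z w where
  pos := hr
  cont_z := h.cont_z.mono (chd_mono hrR)
  cont_w := h.cont_w.mono (chd_mono hrR)
  diff_z := h.diff_z.mono (hd_mono hrR)
  diff_w := h.diff_w.mono (hd_mono hrR)
  z_zero := h.z_zero
  z_ne := fun s hs => h.z_ne s (chd_mono hrR hs)
  flat := fun s hs => h.flat s (chd_mono hrR hs)
  neg := fun s hs => h.neg s (chd_mono hrR hs)

theorem w_zero (h : IsLocalDisc γ ρ R z w) : w 0 = 0 := by
  rw [h.flat 0 (zero_mem_chd h.pos.le) (by simp), h.z_zero]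
  simp [psi]

theorem exists_small (h : IsLocalDisc γ ρ R z w) {δ : ℝ} (hδ : 0 < δ) :
    ∃ r, 0 < r ∧ r ≤ R ∧ ∀ s ∈ chd r, ‖(z s, w s)‖ < δ := by
  have hc : ContinuousOn (fun s => (z s, w s)) (chd R) := h.cont_z.prodMk h.cont_w
  have h0 := Metric.continuousOn_iff.1 hc 0 (zero_mem_chd h.pos.le) δ hδ
  obtain ⟨η, hη, hh⟩ := h0
  have hpos := h.pos
  refine ⟨min (η / 2) R, lt_min (by linarith) h.pos, min_le_right _ _, fun s hs => ?_⟩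
  have h1 : ‖s‖ < η := lt_of_le_of_lt (hs.1.trans (min_le_left _ _)) (by linarith)
  have := hh s (chd_mono (min_le_right _ _) hs) (by simpa using h1)
  have e : ((0 : ℂ), (0 : ℂ)) = (0 : ℂ × ℂ) := rfl
  rwa [h.z_zero, h.w_zero, e, dist_zero_right] at this

/-- Two values more than `π` apart would have a zero `kπ + π/2` of the cosine between them. -/
theorem abs_sub_le_pi_of_cos_ne_zero {r : ℝ} {φ : ℝ → ℝ} (hφ : ContinuousOn φ (Ioc 0 r))
    (hcos : ∀ x ∈ Ioc 0 r, Real.cos (φ x) ≠ 0) {x y : ℝ} (hx : x ∈ Ioc 0 r) (hy : y ∈ Ioc 0 r) :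
    φ y ≤ φ x + Real.pi := by
  by_contra! hlt
  set k : ℤ := ⌈(φ x - Real.pi / 2) / Real.pi⌉ with hk
  have hpi := Real.pi_pos
  have h1 : (φ x - Real.pi / 2) / Real.pi ≤ k := Int.le_ceil _
  have h2 : (k : ℝ) < (φ x - Real.pi / 2) / Real.pi + 1 := Int.ceil_lt_add_one _
  rw [div_le_iff₀ hpi] at h1
  have h3 : (k : ℝ) * Real.pi < φ x - Real.pi / 2 + Real.pi := by
    have := mul_lt_mul_of_pos_right h2 hpi
    rwa [add_mul, div_mul_cancel₀ _ hpi.ne', one_mul] at this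
  obtain ⟨c, hc, hc0⟩ := isPreconnected_Ioc.intermediate_value hx hy hφ
    (show (k : ℝ) * Real.pi + Real.pi / 2 ∈ Icc (φ x) (φ y) from ⟨by linarith, by linarith⟩)
  refine hcos c hc ?_
  rw [hc0, Real.cos_eq_zero_iff]
  exact ⟨k, by ring⟩

/-- If `Re (e^{f})` or `Im (e^f)` does not vanish on an interval then `Im f` is bounded there. -/
theorem exists_im_bound {r : ℝ} (hr : 0 < r) {f : ℝ → ℂ} (hf : ContinuousOn f (Ioc 0 r))
    (h : (∀ x ∈ Ioc 0 r, (Complex.exp (f x)).re ≠ 0) ∨ (∀ x ∈ Ioc 0 r, (Complex.exp (f x)).im ≠ 0)) :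
    ∃ M, ∀ x ∈ Ioc 0 r, |(f x).im| ≤ M := by
  have hc : ContinuousOn (fun x => (f x).im) (Ioc 0 r) := Complex.continuous_im.comp_continuousOn hf
  have hrr : r ∈ Ioc 0 r := ⟨hr, le_rfl⟩
  have key : ∃ a : ℝ, ∀ x ∈ Ioc 0 r, Real.cos ((f x).im - a) ≠ 0 := by
    rcases h with h | h
    · refine ⟨0, fun x hx h0 => h x hx ?_⟩
      rw [sub_zero] at h0
      rw [Complex.exp_re, h0, mul_zero]
    · refine ⟨Real.pi / 2, fun x hx h0 => h x hx ?_⟩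
      rw [Real.cos_sub_pi_div_two] at h0
      rw [Complex.exp_im, h0, mul_zero]
  obtain ⟨a, ha⟩ := key
  refine ⟨|(f r).im| + Real.pi, fun x hx => ?_⟩
  have h1 := abs_sub_le_pi_of_cos_ne_zero (hc.sub continuousOn_const) ha hx hrr
  have h2 := abs_sub_le_pi_of_cos_ne_zero (hc.sub continuousOn_const) ha hrr hx
  simp only [Pi.sub_apply] at h1 h2
  rw [abs_le]
  constructor <;> linarith [le_abs_self (f r).im, neg_abs_le (f r).im]

/-- `ψ = (1 + γ) x² - (γ - 1) y²`: on `x = 0` it is negative off the origin, on `y = 0` positive. A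
constant sign of `ψ` therefore keeps the curve off one axis. -/
theorem re_ne_zero_or_im_ne_zero (hγ : 1 < γ) {r : ℝ} {u : ℝ → ℂ}
    (hu : ∀ x ∈ Ioc 0 r, u x ≠ 0)
    (h : (∀ x ∈ Ioc 0 r, 0 ≤ psi γ (u x)) ∨ (∀ x ∈ Ioc 0 r, psi γ (u x) ≤ 0)) :
    (∀ x ∈ Ioc 0 r, (u x).re ≠ 0) ∨ (∀ x ∈ Ioc 0 r, (u x).im ≠ 0) := by
  rcases h with h | h
  · refine Or.inl fun x hx h0 => hu x hx ?_
    have := h x hx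
    rw [psi_eq, h0] at this
    have h1 : (u x).im ^ 2 ≤ 0 := by nlinarith
    exact Complex.ext h0 (pow_eq_zero_iff (two_ne_zero)|>.1 (le_antisymm h1 (sq_nonneg _)))
  · refine Or.inr fun x hx h0 => hu x hx ?_
    have := h x hx
    rw [psi_eq, h0] at this
    have h1 : (u x).re ^ 2 ≤ 0 := by nlinarith
    exact Complex.ext (pow_eq_zero_iff (two_ne_zero)|>.1 (le_antisymm h1 (sq_nonneg _))) h0

theorem normSq_one_add_mul {ε : ℝ} (G : ℂ) :
    Complex.normSq (1 + (ε : ℂ) * G) = 1 + 2 * ε * G.re + ε ^ 2 * Complex.normSq G := by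
  simp [Complex.normSq_apply]; ring

/-- `G / (1 + εG)` regularises `G` in the Phragmén–Lindelöf argument: it is bounded, tends to `G` as
`ε → 0`, and does not increase the real part where `|Im G| ≤ Re G`. -/
theorem re_div_one_add_le {ε : ℝ} (hε : 0 < ε) {G : ℂ} (hG : 0 < G.re) (him : |G.im| ≤ G.re) :
    (G / (1 + (ε : ℂ) * G)).re ≤ G.re := by
  have h1 : 0 < Complex.normSq (1 + (ε : ℂ) * G) := by
    rw [normSq_one_add_mul]; have := Complex.normSq_nonneg G; positivity
  have h2 : (G / (1 + (ε : ℂ) * G)).re = (G.re + ε * Complex.normSq G) / Complex.normSq (1 + (ε : ℂ) * G) := by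
    rw [Complex.div_re, ← add_div]
    congr 1
    simp [Complex.normSq_apply]; ring
  rw [h2, div_le_iff₀ h1, normSq_one_add_mul]
  have h3 : G.im ^ 2 ≤ G.re ^ 2 := sq_le_sq' (abs_le.1 him).1 (abs_le.1 him).2
  have h4 : Complex.normSq G = G.re ^ 2 + G.im ^ 2 := by rw [Complex.normSq_apply]; ring
  have h5 := Complex.normSq_nonneg G
  have h6 : ε * Complex.normSq G ≤ 2 * ε * G.re * G.re := by rw [h4]; nlinarith
  have h7 : 0 ≤ ε ^ 2 * Complex.normSq G * G.re := by positivity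
  nlinarith

theorem norm_one_add_mul_ge {ε : ℝ} (hε : 0 < ε) {G : ℂ} (hG : 0 ≤ G.re) :
    1 ≤ ‖1 + (ε : ℂ) * G‖ ∧ ε * ‖G‖ ≤ ‖1 + (ε : ℂ) * G‖ := by
  have e := normSq_one_add_mul (ε := ε) G
  rw [Complex.normSq_eq_norm_sq, Complex.normSq_eq_norm_sq] at e
  have h1 := norm_nonneg (1 + (ε : ℂ) * G)
  have h2 := norm_nonneg G
  have h3 : 0 ≤ 2 * ε * G.re := by positivity
  constructor
  · nlinarith [sq_nonneg (ε * ‖G‖)]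
  · apply le_of_sq_le_sq _ h1
    nlinarith

/-- On the disc `w = O(z²)`. -/
theorem exists_norm_w_le (h : IsLocalDisc γ ρ R z w) (hγ : 1 < γ) :
    ∃ r M : ℝ, 0 < r ∧ r ≤ R ∧ 0 < M ∧ ∀ s ∈ chd r, ‖w s‖ ≤ M * ‖z s‖ ^ 2 := by
  obtain ⟨r₁, -, hr₁, hr₁R, -, -, -, hsR, hsL⟩ := flat_real_estimates h.pos h.cont_w h.diff_w
    (fun s hs h0 => by rw [h.flat s hs h0]; simp) h.w_zero
  have h₁ := h.mono hr₁ hr₁R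
  obtain ⟨L, hLc, hLd, hLe⟩ := exists_log hr₁ h₁.cont_z h₁.diff_z h₁.z_ne
  -- On each side of `0` the sign of `w = ψ(z)` is constant, so `z` avoids an axis and its argument
  -- is bounded.
  have side : ∀ e : ℝ, (e = 1 ∨ e = -1) →
      ((∀ x : ℝ, 0 < x → x ≤ r₁ → 0 ≤ (w ((e * x : ℝ) : ℂ)).re) ∨
        (∀ x : ℝ, 0 < x → x ≤ r₁ → (w ((e * x : ℝ) : ℂ)).re ≤ 0)) →
      ∃ M, ∀ x ∈ Ioc 0 r₁, |(L ((e * x : ℝ) : ℂ)).im| ≤ M := by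
    intro e he hs
    have hm : ∀ x ∈ Ioc 0 r₁, ((e * x : ℝ) : ℂ) ∈ chd r₁ ∧ ((e * x : ℝ) : ℂ) ≠ 0 := by
      intro x hx
      have : e ≠ 0 := by rcases he with rfl | rfl <;> norm_num
      refine ⟨⟨?_, by simp⟩, Complex.ofReal_ne_zero.2 (mul_ne_zero this hx.1.ne')⟩
      rcases he with rfl | rfl <;> simpa [abs_of_pos hx.1] using hx.2
    apply exists_im_bound hr₁ (f := fun x => L ((e * x : ℝ) : ℂ))
    · exact hLc.comp (by fun_prop) fun x hx => hm x hx
    · have := re_ne_zero_or_im_ne_zero hγ (r := r₁) (u := fun x => z ((e * x : ℝ) : ℂ))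
        (fun x hx => h₁.z_ne _ (hm x hx).1 (hm x hx).2) ?_
      · refine this.imp (fun h x hx => ?_) (fun h x hx => ?_)
        · rw [hLe _ (hm x hx).1 (hm x hx).2]; exact h x hx
        · rw [hLe _ (hm x hx).1 (hm x hx).2]; exact h x hx
      · have hw : ∀ x ∈ Ioc 0 r₁, (w ((e * x : ℝ) : ℂ)).re = psi γ (z ((e * x : ℝ) : ℂ)) := fun x hx => by
          rw [h₁.flat _ (hm x hx).1 (by simp), Complex.ofReal_re]
        refine hs.imp (fun h x hx => ?_) (fun h x hx => ?_)
        · rw [← hw x hx]; exact h x hx.1 hx.2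
        · rw [← hw x hx]; exact h x hx.1 hx.2
  obtain ⟨M₁, hM₁⟩ := side 1 (Or.inl rfl) (by simpa using hsR)
  obtain ⟨M₂, hM₂⟩ := side (-1) (Or.inr rfl) (by simpa using hsL)
  set M₀ := max (max M₁ M₂) 0 with hM₀
  -- So small that `-log |z|` exceeds the bound `M₀` on the argument; then `|Im G| ≤ Re G` on the
  -- flat part.
  obtain ⟨r, hr, hrr₁, hsmall⟩ := h₁.exists_small (Real.exp_pos (-(M₀ + 1)))
  have h₂ := h₁.mono hr hrr₁
  set G : ℂ → ℂ := fun s => -L s with hG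
  have hGre : ∀ s ∈ chd r, s ≠ 0 → M₀ + 1 < (G s).re := by
    intro s hs h0
    have h3 := hLe s (chd_mono hrr₁ hs) h0
    have h4 : ‖z s‖ < Real.exp (-(M₀ + 1)) := lt_of_le_of_lt (by simp [Prod.norm_def]) (hsmall s hs)
    rw [← h3, Complex.norm_exp, Real.exp_lt_exp] at h4
    simp only [hG, Complex.neg_re]
    linarith
  have hM₀0 : 0 ≤ M₀ := le_max_right _ _
  have hGpos : ∀ s ∈ chd r, s ≠ 0 → 0 < (G s).re := fun s hs h0 => by linarith [hGre s hs h0]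
  have hGim : ∀ s ∈ chd r, s ≠ 0 → s.im = 0 → |(G s).im| ≤ (G s).re := by
    intro s hs h0 him
    refine le_trans ?_ ((by linarith : M₀ ≤ M₀ + 1).trans (hGre s hs h0).le)
    simp only [hG, Complex.neg_im, abs_neg]
    have hsr : s = (s.re : ℂ) := Complex.ext rfl (by simpa using him)
    have hn : |s.re| ≤ r₁ := (Complex.abs_re_le_norm s).trans (hs.1.trans hrr₁)
    have hre0 : s.re ≠ 0 := fun h' => h0 (by rw [hsr, h']; simp)
    rcases lt_or_gt_of_ne hre0 with h' | h'
    · rw [abs_of_neg h'] at hn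
      have := hM₂ (-s.re) ⟨by linarith, hn⟩
      have e : (((-1 : ℝ) * -s.re : ℝ) : ℂ) = s := by rw [neg_one_mul, neg_neg]; exact hsr.symm
      rw [e] at this
      exact this.trans ((le_max_right _ _).trans (le_max_left _ _))
    · rw [abs_of_pos h'] at hn
      have := hM₁ s.re ⟨h', hn⟩
      have e : (((1 : ℝ) * s.re : ℝ) : ℂ) = s := by rw [one_mul]; exact hsr.symm
      rw [e] at this
      exact this.trans ((le_max_left _ _).trans (le_max_left _ _))
  have hzG : ∀ s ∈ chd r, s ≠ 0 → Real.exp (2 * (G s).re) * ‖z s‖ ^ 2 = 1 := by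
    intro s hs h0
    rw [← hLe s (chd_mono hrr₁ hs) h0, Complex.norm_exp, ← Real.exp_nat_mul, ← Real.exp_add]
    simp [hG]
  have hGc : ContinuousOn G (chd r \ {0}) := (hLc.mono (sdiff_subset_sdiff_left (chd_mono hrr₁))).neg
  have hGd : DifferentiableOn ℂ G (hd r) := (hLd.mono (hd_mono hrr₁)).neg
  -- bounds on the arc
  have harc : IsCompact {s : ℂ | s ∈ chd r ∧ ‖s‖ = r} :=
    (isCompact_chd r).inter_right (isClosed_eq continuous_norm continuous_const)
  have hr0 : ∀ s : ℂ, ‖s‖ = r → s ≠ 0 := fun s hs h0 => by rw [h0, norm_zero] at hs; exact hr.ne hs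
  obtain ⟨B, hB⟩ := harc.exists_bound_of_continuousOn (hGc.mono fun s hs => ⟨hs.1, hr0 s hs.2⟩)
  obtain ⟨A, hA⟩ := (isCompact_chd r).exists_bound_of_continuousOn h₂.cont_w
  have hA0 : 0 ≤ A := (norm_nonneg _).trans (hA 0 (zero_mem_chd hr.le))
  set M := max (1 + γ) (A * Real.exp (2 * B)) with hM
  have hMpos : 0 < M := lt_of_lt_of_le (by linarith) (le_max_left _ _)
  -- `w e^{2G}` is `w / z²`; regularising the exponent makes it continuous at the centre. The two
  -- terms of `M` bound it on the flat part and on the arc.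
  have key : ∀ ε : ℝ, 0 < ε → ∀ s ∈ chd r, s ≠ 0 →
      ‖w s‖ * Real.exp (2 * (G s / (1 + (ε : ℂ) * G s)).re) ≤ M := by
    intro ε hε s hs h0
    set H : ℂ → ℂ := fun s => G s / (1 + (ε : ℂ) * G s) with hH
    have hden : ∀ s ∈ chd r, s ≠ 0 → 1 + (ε : ℂ) * G s ≠ 0 := by
      intro s hs h0 hz
      have := (norm_one_add_mul_ge hε (hGpos s hs h0).le).1
      rw [hz, norm_zero] at this
      linarith
    have hHn : ∀ s ∈ chd r, s ≠ 0 → ‖H s‖ ≤ 1 / ε ∧ ‖H s‖ ≤ ‖G s‖ := by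
      intro s hs h0
      obtain ⟨a1, a2⟩ := norm_one_add_mul_ge hε (hGpos s hs h0).le
      simp only [hH, norm_div]
      constructor
      · rw [div_le_div_iff₀ (by linarith) hε]; linarith
      · exact div_le_self (norm_nonneg _) a1
    have hHc : ContinuousOn H (chd r \ {0}) :=
      hGc.div (continuousOn_const.add (continuousOn_const.mul hGc)) fun s hs => hden s hs.1 hs.2
    have hHd : DifferentiableOn ℂ H (hd r) := by
      refine hGd.div ((hGd.const_mul _).const_add _) fun s hs => hden s (hd_subset_chd r hs) ?_
      rintro rfl
      simpa using hs.2
    classical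
    -- The value `0` at the centre is the limit: `w → 0` and the exponential is bounded by
    -- `e^{2/ε}`.
    set Φ : ℂ → ℂ := fun s => if s = 0 then 0 else w s * Complex.exp (2 * H s) with hΦ
    have hΦn : ∀ s, s ≠ 0 → ‖Φ s‖ = ‖w s‖ * Real.exp (2 * (H s).re) := by
      intro s h0
      simp [hΦ, h0, Complex.norm_exp]
    have hΦle : ∀ s ∈ chd r, ‖Φ s‖ ≤ ‖w s‖ * Real.exp (2 * (1 / ε)) := by
      intro s hs
      by_cases h0 : s = 0
      · simp only [hΦ, h0, if_true, norm_zero]; positivity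
      · rw [hΦn s h0]
        have := (Complex.re_le_norm _).trans (hHn s hs h0).1
        gcongr
    have := norm_le_of_boundary (R := r) (C := M) (F := Φ) ?_ ?_ ?_ s hs
    · rwa [hΦn s h0] at this
    · intro x hx
      by_cases hx0 : x = 0
      · subst hx0
        have hΦ00 : Φ 0 = 0 := by simp [hΦ]
        rw [ContinuousWithinAt, hΦ00]
        refine squeeze_zero_norm' (a := fun s => ‖w s‖ * Real.exp (2 * (1 / ε))) ?_ ?_
        · filter_upwards [self_mem_nhdsWithin] with s hs using hΦle s hs
        · have := ((h₂.cont_w 0 (zero_mem_chd hr.le)).norm.mul_const (Real.exp (2 * (1 / ε))))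
          rw [ContinuousWithinAt] at this
          simpa [h₂.w_zero] using this
      · have h1 : ContinuousWithinAt (fun s => w s * Complex.exp (2 * H s)) (chd r \ {0}) x :=
          ((h₂.cont_w x hx).mono sdiff_subset).mul
            (Complex.continuous_exp.continuousAt.comp_continuousWithinAt
              ((hHc x ⟨hx, hx0⟩).const_mul 2))
        have h2 : ContinuousWithinAt Φ (chd r \ {0}) x :=
          h1.congr (fun y hy => by simp [hΦ, show y ≠ 0 from hy.2]) (by simp [hΦ, hx0])
        rw [sdiff_eq] at h2
        exact (continuousWithinAt_inter (isOpen_compl_singleton.mem_nhds hx0)).1 h2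
    · have h1 : DifferentiableOn ℂ (fun s => w s * Complex.exp (2 * H s)) (hd r) :=
        h₂.diff_w.mul ((hHd.const_mul 2).cexp)
      refine h1.congr fun y hy => ?_
      have : y ≠ 0 := by rintro rfl; simpa using hy.2
      simp [hΦ, this]
    · intro x hx hb
      by_cases hx0 : x = 0
      · simp only [hΦ, hx0, if_true, norm_zero]; exact hMpos.le
      · rw [hΦn x hx0]
        rcases hb with hb | hb
        · have h3 : (H x).re ≤ (G x).re := re_div_one_add_le hε (hGpos x hx hx0) (hGim x hx hx0 hb)
          have h4 : ‖w x‖ ≤ (1 + γ) * ‖z x‖ ^ 2 := by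
            rw [h₂.flat x hx hb, Complex.norm_real, Real.norm_eq_abs]
            exact abs_psi_le hγ _
          calc ‖w x‖ * Real.exp (2 * (H x).re) ≤ ((1 + γ) * ‖z x‖ ^ 2) * Real.exp (2 * (G x).re) := by gcongr
            _ = (1 + γ) * (Real.exp (2 * (G x).re) * ‖z x‖ ^ 2) := by ring
            _ = 1 + γ := by rw [hzG x hx hx0, mul_one]
            _ ≤ M := le_max_left _ _
        · have h3 : (H x).re ≤ B := (Complex.re_le_norm _).trans ((hHn x hx hx0).2.trans (hB x ⟨hx, hb⟩))
          calc ‖w x‖ * Real.exp (2 * (H x).re) ≤ A * Real.exp (2 * B) := by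
                gcongr
                exact hA x hx
            _ ≤ M := le_max_right _ _
  refine ⟨r, M, hr, hrr₁.trans hr₁R, hMpos, fun s hs => ?_⟩
  by_cases h0 : s = 0
  · rw [h0, h.w_zero, h.z_zero]; simp
  have hlim : Tendsto (fun ε : ℝ => ‖w s‖ * Real.exp (2 * (G s / (1 + (ε : ℂ) * G s)).re)) (𝓝[>] 0)
      (𝓝 (‖w s‖ * Real.exp (2 * (G s / (1 + ((0 : ℝ) : ℂ) * G s)).re))) := by
    refine Tendsto.mono_left ?_ nhdsWithin_le_nhds
    have h1 : ContinuousAt (fun ε : ℝ => G s / (1 + (ε : ℂ) * G s)) 0 := by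
      refine ContinuousAt.div continuousAt_const (by fun_prop) (by simp)
    have h2 : ContinuousAt (fun ε : ℝ => ‖w s‖ * Real.exp (2 * (G s / (1 + (ε : ℂ) * G s)).re)) 0 := by
      have h3 := Complex.continuous_re.continuousAt.comp h1
      exact continuousAt_const.mul (Real.continuous_exp.continuousAt.comp (continuousAt_const.mul h3))
    exact h2.tendsto
  have := le_of_tendsto hlim (by
    filter_upwards [self_mem_nhdsWithin] with ε hε using key ε hε s hs h0)
  simp only [Complex.ofReal_zero, zero_mul, add_zero, div_one] at this
  calc ‖w s‖ = ‖w s‖ * Real.exp (2 * (G s).re) * ‖z s‖ ^ 2 := by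
        rw [mul_assoc, hzG s hs h0, mul_one]
    _ ≤ M * ‖z s‖ ^ 2 := by gcongr

/-- Lower bound for `z` in terms of the distance to the flat part. -/
theorem exists_im_le_sq (h : IsLocalDisc γ ρ R z w) (hg : IsGoodHyperbolicOrigin γ ρ W) (Λ : ℝ)
    (hΛ : 0 < Λ) : ∃ r, 0 < r ∧ r ≤ R ∧ ∀ s ∈ chd r, Λ * s.im ≤ ‖z s‖ ^ 2 := by
  have hγ := hg.one_lt
  obtain ⟨r₁, M, hr₁, hr₁R, hM, hMw⟩ := h.exists_norm_w_le hγ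
  obtain ⟨c, hc, hcε⟩ := hg.re_ge
  obtain ⟨δ, hδ, hre⟩ := hcε (1 / (2 * (1 + M))) (by positivity)
  obtain ⟨r, hr, hrr₁, hsmall⟩ := (h.mono hr₁ hr₁R).exists_small hδ
  have hrR := hrr₁.trans hr₁R
  have h₂ := h.mono hr hrR
  -- Subtracting `γ z²` turns `ψ(z)` into `|z|²`, so `B` is comparable with `|z|²` and stays in a
  -- sector strictly inside the right half-plane.
  set B : ℂ → ℂ := fun s => c * w s - (γ : ℂ) * (z s) ^ 2 with hB
  have hBre : ∀ s ∈ chd r, ‖z s‖ ^ 2 / 2 ≤ (B s).re := by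
    intro s hs
    have e : (B s).re = (c * w s).re - γ * ((z s) ^ 2).re := by
      simp only [hB, Complex.sub_re, Complex.re_ofReal_mul]
    have e2 : psi γ (z s) - γ * ((z s) ^ 2).re = ‖z s‖ ^ 2 := by
      rw [psi, Complex.sq_norm]; ring
    rw [e]
    rcases hs.2.lt_or_eq with h0 | h0
    · have h1 := hre (z s, w s) (hsmall s hs) (h₂.neg s hs h0)
      simp only at h1
      have h2 := hMw s (chd_mono hrr₁ hs)
      have h3 : 1 / (2 * (1 + M)) * (‖z s‖ ^ 2 + ‖w s‖) ≤ ‖z s‖ ^ 2 / 2 := by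
        calc _ ≤ 1 / (2 * (1 + M)) * (‖z s‖ ^ 2 + M * ‖z s‖ ^ 2) := by gcongr
          _ = _ := by field_simp
      linarith
    · rw [h₂.flat s hs h0.symm, Complex.re_mul_ofReal, hc, one_mul]
      linarith [sq_nonneg ‖z s‖]
  set D := γ + ‖c‖ * M with hD
  have hDpos : 0 < D := by positivity
  have hBn : ∀ s ∈ chd r, ‖B s‖ ≤ D * ‖z s‖ ^ 2 := by
    intro s hs
    refine (norm_sub_le _ _).trans ?_
    rw [norm_mul, norm_mul, norm_pow, Complex.norm_real, Real.norm_eq_abs, abs_of_pos (by linarith)]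
    have := mul_le_mul_of_nonneg_left (hMw s (chd_mono hrr₁ hs)) (norm_nonneg c)
    rw [hD]; linarith
  have hBc : ContinuousOn B (chd r) :=
    (continuousOn_const.mul h₂.cont_w).sub (continuousOn_const.mul (h₂.cont_z.pow 2))
  have hBd : DifferentiableOn ℂ B (hd r) :=
    (h₂.diff_w.const_mul _).sub ((h₂.diff_z.pow 2).const_mul _)
  set κ := 1 / (2 * D) with hκ
  have hκpos : 0 < κ := by positivity
  have hκB : ∀ s ∈ chd r, κ * ‖B s‖ ≤ (B s).re := by
    intro s hs
    refine le_trans ?_ (hBre s hs)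
    calc κ * ‖B s‖ ≤ κ * (D * ‖z s‖ ^ 2) := by gcongr; exact hBn s hs
      _ = _ := by rw [hκ]; field_simp
  set α := Real.arccos κ with hα
  have hα1 : α < Real.pi / 2 := Real.arccos_lt_pi_div_two.2 hκpos
  have hα0 : 0 ≤ α := Real.arccos_nonneg _
  have harg : ∀ s ∈ chd r, |Complex.arg (B s)| ≤ α := by
    intro s hs
    by_cases h0 : B s = 0
    · rw [h0]; simpa using hα0
    · have h1 := Complex.cos_arg h0
      have h2 : κ ≤ Real.cos (Complex.arg (B s)) := by
        rw [h1, le_div_iff₀ (norm_pos_iff.2 h0)]; exact hκB s hs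
      rw [← Real.arccos_cos (abs_nonneg (Complex.arg (B s))) (Complex.abs_arg_le_pi _), Real.cos_abs]
      exact Real.arccos_le_arccos h2
  have hpi := Real.pi_pos
  -- Still `p α < π / 2`, but `p > 1`: a bound `|z|² < Λ Im s` would make `|B|^p` of order `(Im
  -- s)^p`, against the Hopf bound `c₀ Im s`.
  set p := 1 + (Real.pi / 2 - α) / Real.pi with hp
  have hp1 : 1 < p := by
    have : 0 < (Real.pi / 2 - α) / Real.pi := div_pos (by linarith) hpi
    linarith
  have hpα : p * α < Real.pi / 2 := by
    have e : p * α = α + (Real.pi / 2 - α) * (α / Real.pi) := by rw [hp]; field_simp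
    have : α / Real.pi < 1 := by rw [div_lt_one hpi]; linarith
    rw [e]; nlinarith
  obtain ⟨c₀, hc₀, hlow⟩ := sector_lower_bound hr (by linarith) hpα hBc hBd
    (fun s hs => le_trans (by positivity) (hBre s hs)) harg (fun s hs h0 hB0 => by
      have h1 := hBre s hs
      rw [hB0, Complex.zero_re] at h1
      have h2 : z s ≠ 0 := h₂.z_ne s hs (by rintro rfl; simp at h0)
      have : 0 < ‖z s‖ ^ 2 / 2 := by positivity
      linarith)
  -- conclude by comparing powers
  have hlim : Tendsto (fun y : ℝ => (D * Λ) ^ p * y ^ (p - 1)) (𝓝[>] 0) (𝓝 ((D * Λ) ^ p * 0)) := by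
    refine Tendsto.const_mul _ ?_
    have := (Real.continuousAt_rpow_const 0 (p - 1) (Or.inr (by linarith))).tendsto
    rw [Real.zero_rpow (by linarith)] at this
    exact this.mono_left nhdsWithin_le_nhds
  rw [mul_zero] at hlim
  obtain ⟨y₀, hy₀, hy₀'⟩ := mem_nhdsGT_iff_exists_Ioo_subset.1 (hlim.eventually_lt_const hc₀)
  set r' := min (r / 2) (y₀ / 2) with hr'
  have hy₀pos : 0 < y₀ := hy₀
  have hr'pos : 0 < r' := lt_min (by linarith) (by linarith)
  refine ⟨r', hr'pos, ((min_le_left _ _).trans (by linarith)).trans hrR, fun s hs => ?_⟩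
  rcases hs.2.lt_or_eq with h0 | h0
  swap
  · rw [← h0, mul_zero]; positivity
  have hs1 : s ∈ chd (r / 2) := chd_mono (min_le_left _ _) hs
  have hsr : s ∈ chd r := chd_mono (by linarith) hs1
  have hy : s.im < y₀ := by
    have : s.im ≤ y₀ / 2 := ((le_abs_self _).trans (Complex.abs_im_le_norm s)).trans (hs.1.trans (min_le_right _ _))
    linarith
  have h1 : (D * Λ) ^ p * s.im ^ (p - 1) < c₀ := hy₀' ⟨h0, hy⟩
  by_contra! hlt
  have h2 : ‖B s‖ ≤ D * Λ * s.im := by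
    refine (hBn s hsr).trans ?_
    rw [mul_assoc]; gcongr
  have h3 : ‖B s‖ ^ p ≤ (D * Λ * s.im) ^ p := Real.rpow_le_rpow (norm_nonneg _) h2 (by linarith)
  rw [Real.mul_rpow (by positivity) h0.le] at h3
  have h4 : s.im ^ p = s.im ^ (p - 1) * s.im := by
    conv_rhs => rw [← Real.rpow_one s.im, ← Real.rpow_mul h0.le, one_mul]
    rw [← Real.rpow_add h0]; ring_nf
  have h5 := hlow s hs1
  rw [h4] at h3
  have h6 := mul_lt_mul_of_pos_right h1 h0
  linarith

/-- The disc leaves the hypersurface with infinite speed at the hyperbolic point. -/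
theorem exists_im_le_neg (h : IsLocalDisc γ ρ R z w) (hg : IsGoodHyperbolicOrigin γ ρ W) (K : ℝ)
    (hK : 0 < K) : ∃ r, 0 < r ∧ r ≤ R ∧ ∀ s ∈ chd r, K * s.im ≤ -ρ (z s, w s) := by
  obtain ⟨C, ε, δ, hC, hε, hδ, hpsh⟩ := hg.exists_psh
  obtain ⟨r₁, hr₁, hr₁R, hsmall⟩ := h.exists_small hδ
  have h₁ := h.mono hr₁ hr₁R
  -- Solves `5/12 · ε Λ / 8 = K`, the slope produced by `hopf_lower_bound`.
  set Λ := 96 / 5 * K / ε with hΛ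
  have hΛpos : 0 < Λ := by positivity
  obtain ⟨r, hr, hrr₁, hz⟩ := h₁.exists_im_le_sq hg Λ hΛpos
  have h₂ := h₁.mono hr hrr₁
  -- `|a|² ≤ Λ r / 8` is a quarter of the lower bound `Λ r / 2` for `|z|²` on the upper arc, so `|z
  -- - a| ≥ |z| / 2` there.
  obtain ⟨r', hr', hr'r, hsmall'⟩ := h₂.exists_small (δ := Real.sqrt (Λ * r / 8)) (by positivity)
  refine ⟨min r' (r / 2), lt_min hr' (by linarith), (min_le_left _ _).trans (hr'r.trans (hrr₁.trans hr₁R)),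
    fun s₀ hs₀ => ?_⟩
  have hs₀r : s₀ ∈ chd r := chd_mono ((min_le_left _ _).trans hr'r) hs₀
  set a := z s₀ with ha
  have hasq : ‖a‖ ^ 2 ≤ Λ * r / 8 := by
    have h1 : ‖a‖ < Real.sqrt (Λ * r / 8) := lt_of_le_of_lt (by simp [ha, Prod.norm_def])
      (hsmall' s₀ (chd_mono (min_le_left _ _) hs₀))
    have := Real.sq_sqrt (by positivity : 0 ≤ Λ * r / 8)
    nlinarith [norm_nonneg a]
  set F : ℂ → ℂ × ℂ := fun s => (z s, w s) with hF
  have hFd : DifferentiableOn ℂ F (hd r) := h₂.diff_z.prodMk h₂.diff_w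
  have hFc : ContinuousOn F (chd r) := h₂.cont_z.prodMk h₂.cont_w
  have hFδ : ∀ s ∈ chd r, ‖F s‖ < δ := fun s hs => hsmall s (chd_mono hrr₁ hs)
  have hFW : ∀ s ∈ chd r, F s ∈ W := fun s hs => (hpsh _ (hFδ s hs)).1
  have hρle : ∀ s ∈ chd r, ρ (F s) ≤ 0 := by
    intro s hs
    rcases hs.2.lt_or_eq with h0 | h0
    · exact (h₂.neg s hs h0).le
    · refine (hg.quadric_subset _ (hFW s hs) ?_).le
      exact h₂.flat s hs h0.symm
  -- The strict plurisubharmonicity leaves room for `ε |z - a|²`: `q` stays superharmonic, and the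
  -- added term is large on the upper arc but vanishes at `s₀`.
  set q : ℂ → ℝ := fun s => (-1) * (ρ (F s) + C * (ρ (F s) * ρ (F s))) + ε * Complex.normSq (z s - a) with hq
  have hu : ∀ s ∈ chd r, 0 ≤ (-1) * (ρ (F s) + C * (ρ (F s) * ρ (F s))) := by
    intro s hs
    have h1 := (hpsh _ (hFδ s hs)).2.1
    have h2 := hρle s hs
    rw [abs_of_nonpos h2] at h1
    nlinarith
  have hρc : ContinuousOn (fun s => ρ (F s)) (chd r) := hg.contDiffOn.continuousOn.comp hFc hFW
  have hqc : ContinuousOn q (chd r) := by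
    refine (continuousOn_const.mul (hρc.add (continuousOn_const.mul (hρc.mul hρc)))).add
      (continuousOn_const.mul ?_)
    exact Complex.continuous_normSq.comp_continuousOn (h₂.cont_z.sub continuousOn_const)
  have hmid : ∀ s ∈ chd r, ‖s‖ = r → r / 2 ≤ s.im → ε * (Λ * r / 8) ≤ q s := by
    intro s hs _ him
    have h1 := hz s hs
    have h2 : Λ * (r / 2) ≤ ‖z s‖ ^ 2 := le_trans (by gcongr) h1
    have h3 : Λ * r / 8 ≤ Complex.normSq (z s - a) := by
      rw [Complex.normSq_eq_norm_sq]
      have h4 : ‖z s‖ ≤ ‖z s - a‖ + ‖a‖ := by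
        calc ‖z s‖ = ‖(z s - a) + a‖ := by rw [sub_add_cancel]
          _ ≤ _ := norm_add_le _ _
      nlinarith [norm_nonneg (z s - a), norm_nonneg a, norm_nonneg (z s), sq_nonneg (‖z s - a‖ - ‖a‖)]
    have h5 := hu s hs
    have h6 := mul_le_mul_of_nonneg_left h3 hε.le
    simp only [hq]
    linarith
  have hhopf := hopf_lower_bound hr (by positivity) hqc ?_
    (fun s hs _ => add_nonneg (hu s hs) (mul_nonneg hε.le (Complex.normSq_nonneg _))) hmid s₀ hs₀r
    (hs₀.1.trans (min_le_right _ _))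
  · have e : 5 / 12 * (ε * (Λ * r / 8)) / r * s₀.im = K * s₀.im := by
      rw [hΛ]; field_simp; norm_num
    rw [e] at hhopf
    simp only [hq, ha, sub_self, map_zero, mul_zero, add_zero] at hhopf
    have : 0 ≤ C * (ρ (F s₀) * ρ (F s₀)) := mul_nonneg hC (mul_self_nonneg _)
    have : K * s₀.im ≤ -ρ (F s₀) := by linarith
    exact this
  · intro s hs
    have hs' := hd_subset_chd r hs
    have h1 := hasLaplacianAt_comp (isOpen_hd r) hFd hs (hg.contDiffAt (hFW s hs')) C
    have h2 := hasLaplacianAt_normSq (isOpen_hd r) h₂.diff_z hs a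
    refine ⟨_, ?_, (h1.const_mul (-1)).add (h2.const_mul ε)⟩
    have h3 := (hpsh _ (hFδ s hs')).2.2 (deriv F s)
    have h4 : (deriv F s).1 = deriv z s := by
      have hz' := (h₂.diff_z.differentiableAt ((isOpen_hd r).mem_nhds hs)).hasDerivAt
      have hw' := (h₂.diff_w.differentiableAt ((isOpen_hd r).mem_nhds hs)).hasDerivAt
      rw [(hz'.prodMk hw').deriv]
    rw [h4] at h3
    linarith

/-- `Im w` is negligible with respect to `ρ` on the disc. -/
theorem exists_abs_im_le (h : IsLocalDisc γ ρ R z w) (hg : IsGoodHyperbolicOrigin γ ρ W) {ε : ℝ}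
    (hε : 0 < ε) : ∃ r, 0 < r ∧ r ≤ R ∧ ∀ s ∈ chd r, |(w s).im| ≤ ε * -ρ (z s, w s) := by
  obtain ⟨r₁, C, hr₁, hr₁R, hC, -, him, -, -⟩ := flat_real_estimates h.pos h.cont_w h.diff_w
    (fun s hs h0 => by rw [h.flat s hs h0]; simp) h.w_zero
  obtain ⟨r, hr, hrr₁, hρ⟩ := (h.mono hr₁ hr₁R).exists_im_le_neg hg (C / ε) (by positivity)
  refine ⟨r, hr, hrr₁.trans hr₁R, fun s hs => (him s (chd_mono hrr₁ hs)).trans ?_⟩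
  have := mul_le_mul_of_nonneg_left (hρ s hs) hε.le
  calc C * s.im = ε * (C / ε * s.im) := by field_simp
    _ ≤ _ := this

/-- The disc is Hölder continuous at the hyperbolic point along the imaginary axis. -/
theorem exists_pow_le_sqrt (h : IsLocalDisc γ ρ R z w) (hg : IsGoodHyperbolicOrigin γ ρ W) :
    ∃ n : ℕ, 0 < n ∧ ∃ r C : ℝ, 0 < r ∧ r ≤ R ∧ 0 < C ∧ ∀ t : ℝ, 0 < t → t ≤ r →
      ‖z (t * Complex.I)‖ ^ n ≤ C * Real.sqrt t := by
  obtain ⟨n, hn, C₁, hC₁, him⟩ := exists_im_pow_le hg.one_lt hg.mem_goodParameters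
  obtain ⟨r₁, C₂, hr₁, hr₁R, hC₂, hw, -, -, -⟩ := flat_real_estimates h.pos h.cont_w h.diff_w
    (fun s hs h0 => by rw [h.flat s hs h0]; simp) h.w_zero
  obtain ⟨r₂, hr₂, hr₂r₁, hsmall⟩ := (h.mono hr₁ hr₁R).exists_small one_pos
  set r := min r₂ 1 with hr
  have hrpos : 0 < r := lt_min hr₂ one_pos
  have hrr₁ : r ≤ r₁ := (min_le_left _ _).trans hr₂r₁
  have h₂ := h.mono hrpos (hrr₁.trans hr₁R)
  -- On the flat part `|Im zⁿ| ≤ C₁ |ψ(z)| = C₁ |w| = O(|s|)`, weakened to `√|s|` to match the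
  -- barrier.
  have hflat : ∀ s ∈ chd r, s.im = 0 → |(z s ^ n).im| ≤ C₁ * C₂ * Real.sqrt ‖s‖ := by
    intro s hs h0
    have h1 : ‖z s‖ ≤ 1 := le_of_lt (lt_of_le_of_lt (by simp [Prod.norm_def])
      (hsmall s (chd_mono (min_le_left _ _) hs)))
    have h2 := him (z s) h1
    have h3 := hw s (chd_mono hrr₁ hs)
    rw [h₂.flat s hs h0, Complex.norm_real, Real.norm_eq_abs] at h3
    have h4 : ‖s‖ ≤ 1 := hs.1.trans (min_le_right _ _)
    have h5 : ‖s‖ ≤ Real.sqrt ‖s‖ := by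
      apply Real.le_sqrt_of_sq_le
      nlinarith [norm_nonneg s]
    calc |(z s ^ n).im| ≤ C₁ * |psi γ (z s)| := h2
      _ ≤ C₁ * (C₂ * Real.sqrt ‖s‖) := by gcongr; exact h3.trans (by gcongr)
      _ = _ := by ring
  obtain ⟨C, hC, hb⟩ := norm_le_sqrt_of_flat hrpos (X := fun s => z s ^ n)
    (h₂.cont_z.pow n) (h₂.diff_z.pow n) (by simp [h.z_zero, hn.ne']) hflat
  refine ⟨n, hn, r / 2, C, by linarith, by linarith [hrr₁.trans hr₁R], hC, fun t ht htr => ?_⟩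
  rw [← norm_pow]
  exact hb t ht htr

end IsLocalDisc

end HyperbolicDiscs

namespace HyperbolicDiscs

/-! ### A uniqueness theorem for functions nearly real on the flat part of a half-disc -/

theorem chd_subset_closure_hd {r R : ℝ} (hrR : r < R) : chd r ⊆ closure (hd R) := by
  intro s hs
  have hc : Tendsto (fun t : ℝ => s + t * Complex.I) (𝓝[>] 0) (𝓝 s) := by
    have : Continuous fun t : ℝ => s + t * Complex.I := by fun_prop
    simpa using (this.tendsto 0).mono_left nhdsWithin_le_nhds
  refine mem_closure_of_tendsto hc ?_
  have hev : ∀ᶠ t : ℝ in 𝓝[>] 0, ‖s + t * Complex.I‖ < R :=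
    hc.norm.eventually_lt_const (hs.1.trans_lt hrR)
  filter_upwards [hev, self_mem_nhdsWithin] with t ht ht0
  have : 0 < t := ht0
  exact ⟨ht, by simpa using add_pos_of_nonneg_of_pos hs.2 this⟩

/-- Open mapping: a value on the imaginary axis would have neighbouring values with negative real
part; a constant must equal `h 0 = 0`. -/
theorem eqOn_zero_or_re_pos {R : ℝ} (hR : 0 < R) {h : ℂ → ℂ} (hc : ContinuousOn h (chd R))
    (hd' : DifferentiableOn ℂ h (hd R)) (h0 : h 0 = 0) (hre : ∀ s ∈ hd R, 0 ≤ (h s).re) :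
    (∀ s ∈ hd R, h s = 0) ∨ ∀ s ∈ hd R, 0 < (h s).re := by
  rcases (hd'.analyticOnNhd (isOpen_hd R)).is_constant_or_isOpen (convex_hd R).isPreconnected with
    ⟨c, hcst⟩ | hopen
  · left
    have hz := chd_subset_closure_hd (half_lt_self hR) (zero_mem_chd (half_pos hR).le)
    have h1 := ((hc 0 (zero_mem_chd hR.le)).mono (hd_subset_chd R)).mem_closure (t := {c}) hz hcst
    rw [closure_singleton, mem_singleton_iff, h0] at h1
    intro s hs
    rw [hcst s hs, h1]
  · right
    intro s hs
    refine lt_of_le_of_ne (hre s hs) fun hs0 => ?_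
    have h1 : h '' hd R ∈ 𝓝 (h s) := (hopen _ Subset.rfl (isOpen_hd R)).mem_nhds ⟨s, hs, rfl⟩
    have h2 : Tendsto (fun t : ℝ => h s - t) (𝓝[>] 0) (𝓝 (h s)) := by
      have : Continuous fun t : ℝ => h s - t := by fun_prop
      simpa using (this.tendsto 0).mono_left nhdsWithin_le_nhds
    obtain ⟨t, ⟨s', hs', he⟩, ht⟩ :=
      ((h2.eventually (eventually_mem_set.2 h1)).and self_mem_nhdsWithin).exists
    have ht' : 0 < t := ht
    have h3 := hre s' hs'
    rw [he, Complex.sub_re, ← hs0, Complex.ofReal_re] at h3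
    linarith

/-- A function with non-negative real part on a half-disc, whose values on the flat part are
tangent to the real axis, vanishes at the origin slower than any positive power. -/
theorem eq_zero_of_flat_im_le {R : ℝ} (hR : 0 < R) {h : ℂ → ℂ} (hc : ContinuousOn h (chd R))
    (hd' : DifferentiableOn ℂ h (hd R)) (h0 : h 0 = 0) (hre : ∀ s ∈ hd R, 0 ≤ (h s).re)
    (hflat : ∀ ε > 0, ∃ r > 0, ∀ s ∈ chd r, s.im = 0 → |(h s).im| ≤ ε * ‖h s‖)
    {n : ℕ} {C r₀ : ℝ} (hr₀ : 0 < r₀)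
    (hpow : ∀ t : ℝ, 0 < t → t ≤ r₀ → ‖h (t * Complex.I)‖ ^ n ≤ C * t) :
    ∀ s ∈ hd R, h s = 0 := by
  refine (eqOn_zero_or_re_pos hR hc hd' h0 hre).resolve_right fun hpos => ?_
  have hpi := Real.pi_pos
  -- The argument will be bounded by `2ε`, and `(n + 1) · 2ε < π / 2` is needed.
  set ε : ℝ := min (Real.pi / (8 * (n + 1))) 1 with hε
  have hεpos : 0 < ε := lt_min (by positivity) one_pos
  have hε1 : ε ≤ 1 := min_le_right _ _
  -- Half of `ε`, because `|h| ≤ Re h + |Im h|` and `ε ≤ 1` then give `|Im h| ≤ ε Re h`.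
  obtain ⟨r₁, hr₁, hfl⟩ := hflat (ε / 2) (by positivity)
  have hsm : ∃ r > 0, ∀ s ∈ chd R, ‖s‖ < r → ‖h s‖ ≤ 1 := by
    obtain ⟨r, hr, hh⟩ := Metric.continuousOn_iff.1 hc 0 (zero_mem_chd hR.le) 1 one_pos
    refine ⟨r, hr, fun s hs hsr => ?_⟩
    have := hh s hs (by simpa using hsr)
    rw [h0, dist_zero_right] at this
    exact this.le
  obtain ⟨r₂, hr₂, hle⟩ := hsm
  set r := min (R / 2) (min r₁ (r₂ / 2)) with hr
  have hrpos : 0 < r := lt_min (by linarith) (lt_min hr₁ (by linarith))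
  have hrR : r ≤ R / 2 := min_le_left _ _
  have hrr₁ : r ≤ r₁ := (min_le_right _ _).trans (min_le_left _ _)
  have hrr₂ : r ≤ r₂ / 2 := (min_le_right _ _).trans (min_le_right _ _)
  have hrec : ∀ s ∈ chd r, 0 ≤ (h s).re := by
    intro s hs
    have h1 := chd_subset_closure_hd (half_lt_self hR) (chd_mono hrR hs)
    have h2 := ((hc s (chd_mono (hrR.trans (by linarith)) hs)).mono (hd_subset_chd R)).mem_closure
      (t := {x : ℂ | 0 ≤ x.re}) h1 hre
    rwa [(isClosed_le continuous_const Complex.continuous_re).closure_eq] at h2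
  have hflat' : ∀ s ∈ chd r, s.im = 0 → |(h s).im| ≤ ε * (h s).re := by
    intro s hs hs0
    have h1 := hfl s (chd_mono hrr₁ hs) hs0
    have h2 := Complex.norm_le_abs_re_add_abs_im (h s)
    rw [abs_of_nonneg (hrec s hs)] at h2
    nlinarith [hrec s hs, abs_nonneg (h s).im]
  have hcr := hc.mono (chd_mono (show r ≤ R by linarith))
  have hdr := hd'.mono (hd_mono (show r ≤ R by linarith))
  have harg := abs_arg_le_barrier hrpos hεpos hcr hdr
    (fun s hs => hle s (chd_mono (by linarith) hs) (hs.1.trans_lt (by linarith)))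
    (fun s hs h1 => hpos s ⟨hs.1.trans_lt (by linarith), h1⟩) hflat'
  -- Within this radius the barrier is at most `ε / 2`, and `π/2 · ε/2 ≤ ε`.
  set δ := min r (ε * r / 8) with hδ
  have hδpos : 0 < δ := lt_min hrpos (by positivity)
  have hδr : δ ≤ r := min_le_left _ _
  have hδε : δ ≤ ε * r / 8 := min_le_right _ _
  have harg' : ∀ s ∈ chd δ, |Complex.arg (h s)| ≤ 2 * ε := by
    intro s hs
    rcases hs.2.lt_or_eq with him | him
    · refine (harg s (chd_mono hδr hs) him).trans ?_
      have e1 : (s ^ 2).re ≤ δ ^ 2 := (Complex.re_le_norm _).trans (by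
        rw [norm_pow]; exact pow_le_pow_left₀ (norm_nonneg _) hs.1 2)
      have e2 : s.im ≤ δ := (Complex.im_le_norm s).trans hs.1
      have e3 : (s ^ 2).re / r ^ 2 + 3 * s.im / r ≤ 4 * (ε / 8) := by
        have e4 : (s ^ 2).re / r ^ 2 ≤ ε / 8 := by
          rw [div_le_iff₀ (by positivity)]
          nlinarith
        have e5 : 3 * s.im / r ≤ 3 * (ε / 8) := by
          rw [div_le_iff₀ (by positivity)]
          nlinarith
        linarith
      have := Real.pi_lt_four
      nlinarith
    · exact (abs_arg_le_of_abs_im_le hεpos (hflat' s (chd_mono hδr hs) him.symm)).trans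
        (by linarith)
  have hα : ((n + 1 : ℕ) : ℝ) * (2 * ε) < Real.pi / 2 := by
    have h1 : ε ≤ Real.pi / (8 * (n + 1)) := min_le_left _ _
    rw [le_div_iff₀ (by positivity)] at h1
    push_cast
    nlinarith
  obtain ⟨c, hcpos, hlow⟩ := sector_lower_bound hδpos (by positivity) hα
    (hcr.mono (chd_mono hδr)) (hdr.mono (hd_mono hδr)) (fun s hs => hrec s (chd_mono hδr hs)) harg'
    (fun s hs h1 h2 => by
      have := hpos s ⟨hs.1.trans_lt (by linarith), h1⟩
      simp [h2] at this)
  -- `c t ≤ |h|^(n+1) ≤ C t |h|` on the imaginary axis would give `c ≤ C |h(it)|`, although `h(it) →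
  -- 0`.
  have hlim : Tendsto (fun t : ℝ => C * ‖h (t * Complex.I)‖) (𝓝[>] 0) (𝓝 0) := by
    have h1 : Tendsto (fun t : ℝ => (t : ℂ) * Complex.I) (𝓝[>] 0) (𝓝[chd R] 0) := by
      refine tendsto_nhdsWithin_iff.2 ⟨?_, ?_⟩
      · have : Continuous fun t : ℝ => (t : ℂ) * Complex.I := by fun_prop
        simpa using (this.tendsto 0).mono_left nhdsWithin_le_nhds
      · filter_upwards [Ioo_mem_nhdsGT hR] with t ht using
          hd_subset_chd R (I_mul_mem_hd ht.1 ht.2)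
    have h2 := ((hc 0 (zero_mem_chd hR.le)).tendsto.comp h1).norm.const_mul C
    simpa [h0, Function.comp_def] using h2
  obtain ⟨t, ht, htlt⟩ := ((eventually_mem_set.2 (Ioo_mem_nhdsGT (lt_min hr₀ (half_pos hδpos)))).and
    (hlim.eventually_lt_const hcpos)).exists
  have ht0 : t ≤ r₀ := ht.2.le.trans (min_le_left _ _)
  have ht1 : t < δ / 2 := ht.2.trans_le (min_le_right _ _)
  have h1 := hlow _ (chd_mono ht1.le (show (t : ℂ) * Complex.I ∈ chd t by
    simp [chd, abs_of_pos ht.1, ht.1.le]))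
  rw [Real.rpow_natCast, pow_succ] at h1
  have h2 := mul_le_mul_of_nonneg_right (hpow t ht.1 ht0) (norm_nonneg (h (t * Complex.I)))
  have h3 : ((t : ℂ) * Complex.I).im = t := by simp
  rw [h3] at h1
  nlinarith [ht.1]

/-! ### Half-disc coordinates at the points mapped to the origin -/

/-- The Cayley map of the upper half-plane to the unit disc, with `0` mapped to `ζ`. -/
noncomputable def cayley (ζ s : ℂ) : ℂ := ζ * (Complex.I - s) / (Complex.I + s)

theorem cayley_zero (ζ : ℂ) : cayley ζ 0 = ζ := by
  simp [cayley]

theorem I_add_ne_zero {s : ℂ} (hs : 0 ≤ s.im) : Complex.I + s ≠ 0 := by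
  intro h
  have := congrArg Complex.im h
  simp at this
  linarith

theorem one_sub_normSq_cayley {ζ s : ℂ} (hζ : ‖ζ‖ = 1) (hs : 0 ≤ s.im) :
    1 - ‖cayley ζ s‖ ^ 2 = 4 * s.im / ‖Complex.I + s‖ ^ 2 := by
  have h1 : ‖Complex.I + s‖ ^ 2 ≠ 0 := by simpa using I_add_ne_zero hs
  rw [cayley, norm_div, norm_mul, hζ, one_mul, div_pow, eq_div_iff h1, sub_mul, div_mul_cancel₀ _ h1]
  simp only [← Complex.normSq_eq_norm_sq, Complex.normSq_apply]
  simp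
  ring

theorem norm_cayley_of_im_eq_zero {ζ s : ℂ} (hζ : ‖ζ‖ = 1) (hs : s.im = 0) :
    ‖cayley ζ s‖ = 1 := by
  have := one_sub_normSq_cayley hζ hs.ge
  rw [hs, mul_zero, zero_div] at this
  nlinarith [norm_nonneg (cayley ζ s)]

theorem norm_cayley_lt_one {ζ s : ℂ} (hζ : ‖ζ‖ = 1) (hs : 0 < s.im) : ‖cayley ζ s‖ < 1 := by
  have := one_sub_normSq_cayley hζ hs.le
  have h1 : 0 < ‖Complex.I + s‖ := norm_pos_iff.2 (I_add_ne_zero hs.le)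
  have h2 : 0 < 4 * s.im / ‖Complex.I + s‖ ^ 2 := by positivity
  nlinarith [norm_nonneg (cayley ζ s)]

theorem norm_cayley_le_one {ζ s : ℂ} (hζ : ‖ζ‖ = 1) (hs : 0 ≤ s.im) : ‖cayley ζ s‖ ≤ 1 :=
  hs.lt_or_eq.elim (fun h => (norm_cayley_lt_one hζ h).le)
    fun h => (norm_cayley_of_im_eq_zero hζ h.symm).le

theorem differentiableAt_cayley (ζ : ℂ) {s : ℂ} (hs : 0 ≤ s.im) :
    DifferentiableAt ℂ (cayley ζ) s :=
  DifferentiableAt.div (by fun_prop) (by fun_prop) (I_add_ne_zero hs)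

theorem cayley_injective {ζ s : ℂ} (hζ : ζ ≠ 0) (hs : 0 ≤ s.im) (h : cayley ζ s = ζ) : s = 0 := by
  rw [cayley, div_eq_iff (I_add_ne_zero hs)] at h
  have := mul_left_cancel₀ hζ h
  have h2 : 2 * s = 0 := by linear_combination -this
  simpa using h2

/-- Points of the closed unit disc near `ζ` are covered by the Cayley map. -/
theorem exists_cayley_eq {ζ η : ℂ} (hζ : ‖ζ‖ = 1) (hη : ‖η‖ ≤ 1) (h : ‖ζ - η‖ ≤ 1) :
    ∃ s, ‖s‖ ≤ ‖ζ - η‖ ∧ 0 ≤ s.im ∧ cayley ζ s = η := by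
  have h1 : 1 ≤ ‖ζ + η‖ := by
    have h2 : ‖(ζ + η) + (ζ - η)‖ = 2 := by
      rw [show (ζ + η) + (ζ - η) = 2 * ζ by ring, norm_mul, hζ]; simp
    linarith [norm_add_le (ζ + η) (ζ - η)]
  have h2 : ζ + η ≠ 0 := norm_pos_iff.1 (by linarith)
  have hζ0 : ζ ≠ 0 := norm_pos_iff.1 (by linarith)
  refine ⟨Complex.I * (ζ - η) / (ζ + η), ?_, ?_, ?_⟩
  · rw [norm_div, norm_mul, Complex.norm_I, one_mul]
    exact div_le_self (norm_nonneg _) h1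
  · have e : (Complex.I * (ζ - η) / (ζ + η)).im =
        (Complex.normSq ζ - Complex.normSq η) / Complex.normSq (ζ + η) := by
      rw [Complex.div_im]
      simp [Complex.normSq_apply]
      ring
    rw [e, Complex.normSq_eq_norm_sq, Complex.normSq_eq_norm_sq, hζ]
    refine div_nonneg ?_ (Complex.normSq_nonneg _)
    nlinarith [norm_nonneg η]
  · have h3 : Complex.I + Complex.I * (ζ - η) / (ζ + η) ≠ 0 := by
      have : Complex.I + Complex.I * (ζ - η) / (ζ + η) = 2 * Complex.I * ζ / (ζ + η) := by
        field_simp; ring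
      rw [this]
      exact div_ne_zero (mul_ne_zero (by simp) hζ0) h2
    rw [cayley, div_eq_iff h3]
    field_simp
    ring

end HyperbolicDiscs

namespace HyperbolicDiscs

/-! ### Hyperbolic discs near the origin -/

variable {γ : ℝ} {ρ : ℂ × ℂ → ℝ} {W : Set (ℂ × ℂ)} {Ω : Set ℂ} {f : ℂ → ℂ × ℂ}

namespace IsHyperbolicDisc

theorem norm_le_one (hf : IsHyperbolicDisc γ ρ W Ω f) {η : ℂ} (hη : η ∈ Ω) : ‖η‖ ≤ 1 := by
  obtain ⟨O, -, rfl⟩ := hf.relatively_open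
  simpa using hη.2

theorem norm_eq_one_of_apply_eq_zero (hf : IsHyperbolicDisc γ ρ W Ω f)
    (hg : IsGoodHyperbolicOrigin γ ρ W) {ζ : ℂ} (hζ : ζ ∈ Ω) (h0 : f ζ = 0) : ‖ζ‖ = 1 := by
  refine le_antisymm (hf.norm_le_one hζ) (not_lt.1 fun hlt => ?_)
  have := hf.interior ζ ⟨hζ, by simpa using hlt⟩
  rw [h0, hg.apply_zero] at this
  exact lt_irrefl _ this

theorem neg_of_mem_discImage (hf : IsHyperbolicDisc γ ρ W Ω f) {y : ℂ × ℂ}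
    (hy : y ∈ discImage Ω f) : ρ y < 0 := by
  obtain ⟨η, hη, rfl⟩ := hy
  exact hf.interior η hη

theorem discImage_subset (hf : IsHyperbolicDisc γ ρ W Ω f) : discImage Ω f ⊆ W := by
  rintro _ ⟨η, hη, rfl⟩
  exact hf.mapsTo hη.1

/-- By properness a limit point in `W` is attained, at a parameter in the open disc or on the
circle. -/
theorem mem_or_mem_quadric_of_mem_closure (hf : IsHyperbolicDisc γ ρ W Ω f) (hW : IsOpen W)
    {y : ℂ × ℂ} (hy : y ∈ closure (discImage Ω f)) (hyW : y ∈ W) :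
    y ∈ discImage Ω f ∨ y ∈ quadric γ := by
  obtain ⟨δ, hδ, hball⟩ := Metric.nhds_basis_closedBall.mem_iff.1 (hW.mem_nhds hyW)
  have hK := hf.proper _ hball (isCompact_closedBall y δ)
  have hcl : IsClosed (f '' (Ω ∩ f ⁻¹' Metric.closedBall y δ)) :=
    (hK.image_of_continuousOn (hf.continuousOn.mono inter_subset_left)).isClosed
  have h1 : y ∈ closure (discImage Ω f ∩ Metric.ball y δ) :=
    inter_comm (Metric.ball y δ) _ ▸
      Metric.isOpen_ball.inter_closure ⟨Metric.mem_ball_self hδ, hy⟩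
  have h2 : discImage Ω f ∩ Metric.ball y δ ⊆ f '' (Ω ∩ f ⁻¹' Metric.closedBall y δ) := by
    rintro _ ⟨⟨η, hη, rfl⟩, hb⟩
    exact ⟨η, ⟨hη.1, Metric.ball_subset_closedBall hb⟩, rfl⟩
  obtain ⟨η, hη, rfl⟩ := closure_minimal h2 hcl h1
  rcases (hf.norm_le_one hη.1).lt_or_eq with h | h
  · exact Or.inl ⟨η, ⟨hη.1, by simpa using h⟩, rfl⟩
  · exact Or.inr (hf.boundary η ⟨hη.1, by simpa using h⟩)

/-- Near the origin the disc consists of small neighbourhoods of the zeros of `f`. -/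
theorem exists_forall_eq_cayley (hf : IsHyperbolicDisc γ ρ W Ω f)
    (hg : IsGoodHyperbolicOrigin γ ρ W) {r : ℂ → ℝ} (hr : ∀ ζ ∈ Ω, f ζ = 0 → 0 < r ζ) :
    ∃ δ > 0, ∀ η ∈ Ω, ‖f η‖ < δ → ∃ ζ ∈ Ω, f ζ = 0 ∧ ∃ s ∈ chd (r ζ), cayley ζ s = η := by
  obtain ⟨δ₀, hδ₀, hball⟩ := Metric.nhds_basis_closedBall.mem_iff.1 (hg.isOpen.mem_nhds hg.zero_mem)
  have hK := hf.proper _ hball (isCompact_closedBall 0 δ₀)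
  -- Outside these balls `|f|` has a positive lower bound on the compact set; radius at most `1` is
  -- what `exists_cayley_eq` requires.
  set O : Set ℂ := ⋃ ζ ∈ {ζ ∈ Ω | f ζ = 0}, Metric.ball ζ (min (r ζ) 1)
  have hO : IsOpen O := isOpen_biUnion fun _ _ => Metric.isOpen_ball
  have hK' := hK.diff hO
  obtain ⟨δ₁, hδ₁, hle⟩ := hK'.exists_forall_le' (f := fun η => ‖f η‖) (a := 0)
    ((hf.continuousOn.mono (sdiff_subset.trans inter_subset_left)).norm) fun η hη => by
      refine norm_pos_iff.2 fun h0 => hη.2 ?_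
      exact mem_biUnion (show η ∈ {ζ ∈ Ω | f ζ = 0} from ⟨hη.1.1, h0⟩)
        (Metric.mem_ball_self (lt_min (hr η hη.1.1 h0) one_pos))
  refine ⟨min δ₀ δ₁, lt_min hδ₀ hδ₁, fun η hη hlt => ?_⟩
  have hmem : η ∈ O := by
    by_contra hn
    have := hle η ⟨⟨hη, by simpa using (hlt.trans_le (min_le_left _ _)).le⟩, hn⟩
    exact absurd (hlt.trans_le (min_le_right _ _)) this.not_gt
  obtain ⟨ζ, hζ, hb⟩ := mem_iUnion₂.1 hmem
  rw [Metric.mem_ball, dist_comm, dist_eq_norm] at hb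
  obtain ⟨s, hs, him, he⟩ := exists_cayley_eq (hf.norm_eq_one_of_apply_eq_zero hg hζ.1 hζ.2)
    (hf.norm_le_one hη) (hb.le.trans (min_le_right _ _))
  exact ⟨ζ, hζ.1, hζ.2, s, ⟨hs.trans (hb.le.trans (min_le_left _ _)), him⟩, he⟩

/-- The disc near a point mapped to the origin, in half-disc coordinates. -/
theorem exists_isLocalDisc (hf : IsHyperbolicDisc γ ρ W Ω f) (hg : IsGoodHyperbolicOrigin γ ρ W)
    {δ : ℝ} (hδ : 0 < δ) (hne : ∀ y ∈ discImage Ω f, ‖y‖ < δ → y.1 ≠ 0) {ζ : ℂ} (hζ : ζ ∈ Ω)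
    (h0 : f ζ = 0) : ∃ R, (∀ s ∈ chd R, cayley ζ s ∈ Ω) ∧
      IsLocalDisc γ ρ R (fun s => (f (cayley ζ s)).1) (fun s => (f (cayley ζ s)).2) := by
  have hζ1 := hf.norm_eq_one_of_apply_eq_zero hg hζ h0
  have hζ0 : ζ ≠ 0 := norm_pos_iff.1 (by linarith)
  obtain ⟨O, hO, hΩ⟩ := hf.relatively_open
  -- The other zeros are finitely many and can be avoided. This gives `z ≠ 0` on the flat part,
  -- where `z = 0` forces `f = 0`.
  set Z := {η ∈ Ω | f η = 0} \ {ζ} with hZ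
  have hZf : Z.Finite := hf.finite_hyperbolic.subset sdiff_subset
  have hnhds : (f ∘ cayley ζ) ⁻¹' Metric.ball 0 δ ∩ (cayley ζ ⁻¹' (O ∩ Zᶜ)) ∈ 𝓝[{s | 0 ≤ s.im}] (0 : ℂ) := by
    have hcc : Tendsto (cayley ζ) (𝓝[{s | 0 ≤ s.im}] (0 : ℂ)) (𝓝 ζ) := by
      have := (differentiableAt_cayley ζ (s := 0) (by simp)).continuousAt.tendsto
      rw [cayley_zero] at this
      exact this.mono_left nhdsWithin_le_nhds
    have hO' : O ∈ 𝓝 ζ := hO.mem_nhds (by rw [hΩ] at hζ; exact hζ.1)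
    have hcΩ : Tendsto (cayley ζ) (𝓝[{s | 0 ≤ s.im}] (0 : ℂ)) (𝓝[Ω] ζ) := by
      refine tendsto_nhdsWithin_iff.2 ⟨hcc, ?_⟩
      filter_upwards [hcc hO', self_mem_nhdsWithin] with s hs him
      rw [hΩ]
      exact ⟨hs, by simpa using norm_cayley_le_one hζ1 him⟩
    refine inter_mem ?_ (hcc (inter_mem hO' (hZf.isClosed.isOpen_compl.mem_nhds (by simp [hZ]))))
    refine ((hf.continuousOn ζ hζ).tendsto.comp hcΩ) ?_
    rw [h0]
    exact Metric.ball_mem_nhds _ hδ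
  obtain ⟨R', hR', hsub⟩ := Metric.mem_nhdsWithin_iff.1 hnhds
  set R := R' / 2 with hR
  have hRpos : 0 < R := by positivity
  have hmem : ∀ s ∈ chd R, ‖f (cayley ζ s)‖ < δ ∧ cayley ζ s ∈ O ∧ cayley ζ s ∉ Z := by
    intro s hs
    have := hsub ⟨by simpa using hs.1.trans_lt (by linarith), hs.2⟩
    exact ⟨by simpa using this.1, this.2⟩
  have hmΩ : ∀ s ∈ chd R, cayley ζ s ∈ Ω := by
    intro s hs
    rw [hΩ]
    exact ⟨(hmem s hs).2.1, by simpa using norm_cayley_le_one hζ1 hs.2⟩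
  have hcont : ContinuousOn (fun s => f (cayley ζ s)) (chd R) :=
    hf.continuousOn.comp (fun s hs => (differentiableAt_cayley ζ hs.2).continuousAt.continuousWithinAt)
      hmΩ
  have hball : ∀ s ∈ chd R, 0 < s.im → cayley ζ s ∈ Ω ∩ Metric.ball 0 1 := fun s hs him =>
    ⟨hmΩ s hs, by simpa using norm_cayley_lt_one hζ1 him⟩
  have hdiff : DifferentiableOn ℂ (fun s => f (cayley ζ s)) (hd R) :=
    hf.holomorphic.comp
      (fun s hs => (differentiableAt_cayley ζ hs.2.le).differentiableWithinAt)
      fun s hs => hball s (hd_subset_chd R hs) hs.2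
  have hflat : ∀ s ∈ chd R, s.im = 0 → (f (cayley ζ s)).2 = (psi γ (f (cayley ζ s)).1 : ℂ) :=
    fun s hs him => hf.boundary _ ⟨hmΩ s hs, by simpa using norm_cayley_of_im_eq_zero hζ1 him⟩
  refine ⟨R, hmΩ, hRpos, hcont.fst, hcont.snd, hdiff.fst, hdiff.snd, by simp [cayley_zero, h0], ?_,
    hflat, fun s hs him => hf.interior _ (hball s hs him)⟩
  intro s hs hs0 hz
  rcases hs.2.lt_or_eq with him | him
  · exact hne _ ⟨_, hball s hs him, rfl⟩ (hmem s hs).1 hz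
  · have h1 := hflat s hs him.symm
    rw [hz] at h1
    have h2 : f (cayley ζ s) = 0 := Prod.ext hz (by rw [h1]; simp [psi])
    refine (hmem s hs).2.2 ⟨⟨hmΩ s hs, h2⟩, fun h3 => hs0 (cayley_injective hζ0 hs.2 h3)⟩

/-- Half-discs at the zeros of `f` cover the disc near the origin; finiteness of the zeros gives a
common constant. -/
theorem exists_norm_snd_le (hf : IsHyperbolicDisc γ ρ W Ω f) (hg : IsGoodHyperbolicOrigin γ ρ W)
    {δ : ℝ} (hδ : 0 < δ) (hne : ∀ y ∈ discImage Ω f, ‖y‖ < δ → y.1 ≠ 0) :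
    ∃ M > 0, ∃ δ' > 0, ∀ y ∈ discImage Ω f, ‖y‖ < δ' → ‖y.2‖ ≤ M * ‖y.1‖ ^ 2 := by
  have key : ∀ ζ, ∃ r M : ℝ, ζ ∈ Ω → f ζ = 0 → 0 < r ∧
      ∀ s ∈ chd r, ‖(f (cayley ζ s)).2‖ ≤ M * ‖(f (cayley ζ s)).1‖ ^ 2 := by
    intro ζ
    by_cases h : ζ ∈ Ω ∧ f ζ = 0
    · obtain ⟨R, -, hR⟩ := hf.exists_isLocalDisc hg hδ hne h.1 h.2
      obtain ⟨r, M, hr, -, -, hM⟩ := hR.exists_norm_w_le hg.one_lt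
      exact ⟨r, M, fun _ _ => ⟨hr, hM⟩⟩
    · exact ⟨0, 0, fun h1 h2 => absurd ⟨h1, h2⟩ h⟩
  choose r M hrM using key
  obtain ⟨δ', hδ', hcov⟩ := hf.exists_forall_eq_cayley hg fun ζ h1 h2 => (hrM ζ h1 h2).1
  obtain ⟨B, hB⟩ := (hf.finite_hyperbolic.image M).bddAbove
  refine ⟨max B 1, by positivity, δ', hδ', ?_⟩
  rintro _ ⟨η, hη, rfl⟩ hlt
  obtain ⟨ζ, hζ, hζ0, s, hs, rfl⟩ := hcov η hη.1 hlt
  refine ((hrM ζ hζ hζ0).2 s hs).trans ?_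
  gcongr
  exact (hB ⟨ζ, ⟨hζ, hζ0⟩, rfl⟩).trans (le_max_left _ _)

theorem exists_abs_im_snd_le (hf : IsHyperbolicDisc γ ρ W Ω f)
    (hg : IsGoodHyperbolicOrigin γ ρ W) {δ : ℝ} (hδ : 0 < δ)
    (hne : ∀ y ∈ discImage Ω f, ‖y‖ < δ → y.1 ≠ 0) {ε : ℝ} (hε : 0 < ε) :
    ∃ δ' > 0, ∀ y ∈ discImage Ω f, ‖y‖ < δ' → |y.2.im| ≤ ε * -ρ y := by
  have key : ∀ ζ, ∃ r : ℝ, ζ ∈ Ω → f ζ = 0 → 0 < r ∧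
      ∀ s ∈ chd r, |(f (cayley ζ s)).2.im| ≤ ε * -ρ (f (cayley ζ s)) := by
    intro ζ
    by_cases h : ζ ∈ Ω ∧ f ζ = 0
    · obtain ⟨R, -, hR⟩ := hf.exists_isLocalDisc hg hδ hne h.1 h.2
      obtain ⟨r, hr, -, hM⟩ := hR.exists_abs_im_le hg hε
      exact ⟨r, fun _ _ => ⟨hr, hM⟩⟩
    · exact ⟨0, fun h1 h2 => absurd ⟨h1, h2⟩ h⟩
  choose r hr using key
  obtain ⟨δ', hδ', hcov⟩ := hf.exists_forall_eq_cayley hg fun ζ h1 h2 => (hr ζ h1 h2).1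
  refine ⟨δ', hδ', ?_⟩
  rintro _ ⟨η, hη, rfl⟩ hlt
  obtain ⟨ζ, hζ, hζ0, s, hs, rfl⟩ := hcov η hη.1 hlt
  exact (hr ζ hζ hζ0).2 s hs

/-- If the part of the disc near the origin is a graph, then its projection avoids `0`. -/
theorem exists_fst_ne_zero (hf : IsHyperbolicDisc γ ρ W Ω f) (hg : IsGoodHyperbolicOrigin γ ρ W)
    {U : Set (ℂ × ℂ)} (hU : U ∈ 𝓝 0) {D : Set ℂ} {g : ℂ → ℂ}
    (hG : IsHolomorphicGraph (discImage Ω f ∩ U) D g) :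
    ∃ δ > 0, ∀ y ∈ discImage Ω f, ‖y‖ < δ → y.1 ≠ 0 := by
  obtain ⟨δ₀, hδ₀, hball⟩ := Metric.mem_nhds_iff.1 hU
  by_contra! hcon
  obtain ⟨y, hy, hlt, hy0⟩ := hcon δ₀ hδ₀
  have hyne : 0 < ‖y‖ := norm_pos_iff.2 fun h => by
    have := hf.neg_of_mem_discImage hy
    rw [h, hg.apply_zero] at this
    exact lt_irrefl _ this
  obtain ⟨y', hy', hlt', hy0'⟩ := hcon ‖y‖ hyne
  have h1 : y ∈ discImage Ω f ∩ U := ⟨hy, hball (by simpa using hlt)⟩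
  have h2 : y' ∈ discImage Ω f ∩ U := ⟨hy', hball (by simpa using hlt'.trans hlt)⟩
  rw [hG.eq_graph] at h1 h2
  obtain ⟨z, -, rfl⟩ := h1
  obtain ⟨z', -, rfl⟩ := h2
  dsimp only at hy0 hy0'
  rw [hy0, hy0'] at hlt'
  exact lt_irrefl _ hlt'

end IsHyperbolicDisc

end HyperbolicDiscs

namespace HyperbolicDiscs

/-! ### Comparison of two graphs -/

variable {γ : ℝ} {ρ : ℂ × ℂ → ℝ} {W : Set (ℂ × ℂ)} {Ω Ω' : Set ℂ} {f f' : ℂ → ℂ × ℂ}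

namespace IsHolomorphicGraph

theorem mem {Y : Set (ℂ × ℂ)} {D : Set ℂ} {g : ℂ → ℂ} (h : IsHolomorphicGraph Y D g) {z : ℂ}
    (hz : z ∈ D) : (z, g z) ∈ Y := by
  rw [h.eq_graph]
  exact ⟨z, hz, rfl⟩

theorem of_mem {Y : Set (ℂ × ℂ)} {D : Set ℂ} {g : ℂ → ℂ} (h : IsHolomorphicGraph Y D g)
    {y : ℂ × ℂ} (hy : y ∈ Y) : y.1 ∈ D ∧ g y.1 = y.2 := by
  rw [h.eq_graph] at hy
  obtain ⟨z, hz, rfl⟩ := hy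
  exact ⟨hz, rfl⟩

end IsHolomorphicGraph

open Classical in
/-- The extension of `g` by the function `ψ`, which gives the boundary values. -/
noncomputable def extendByPsi (γ : ℝ) (D : Set ℂ) (g : ℂ → ℂ) (z : ℂ) : ℂ :=
  if z ∈ D then g z else (psi γ z : ℂ)

theorem continuousOn_extendByPsi (hf : IsHyperbolicDisc γ ρ W Ω f) {U : Set (ℂ × ℂ)} {D : Set ℂ}
    {g : ℂ → ℂ} (hG : IsHolomorphicGraph (discImage Ω f ∩ U) D g) (hW : IsOpen W) {M a : ℝ}
    (hM : ∀ y ∈ discImage Ω f ∩ U, ‖y.2‖ ≤ M * ‖y.1‖ ^ 2)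
    (ha : ∀ p : ℂ × ℂ, ‖p.1‖ < a → ‖p.2‖ ≤ M * ‖p.1‖ ^ 2 → p ∈ U ∩ W) :
    ContinuousOn (extendByPsi γ D g) (closure D ∩ Metric.ball 0 a) := by
  intro p hp
  by_cases hpD : p ∈ D
  · have h1 : ContinuousAt g p :=
      (hG.holomorphic.differentiableAt (hG.isOpen.mem_nhds hpD)).continuousAt
    refine (h1.congr ?_).continuousWithinAt
    filter_upwards [hG.isOpen.mem_nhds hpD] with z hz
    simp [extendByPsi, hz]
  · have hpa : ‖p‖ < a := by simpa using hp.2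
    have h1 : Tendsto g (𝓝[D] p) (𝓝 (psi γ p : ℂ)) := by
      have hbd : ∀ᶠ z in 𝓝[D] p, g z ∈ Metric.closedBall (0 : ℂ) (M * ‖p‖ ^ 2 + 1) := by
        have hc : ContinuousAt (fun z : ℂ => M * ‖z‖ ^ 2) p := by fun_prop
        have := (hc.tendsto.mono_left (nhdsWithin_le_nhds (s := D))).eventually_le_const
          (show M * ‖p‖ ^ 2 < M * ‖p‖ ^ 2 + 1 by linarith)
        filter_upwards [this, self_mem_nhdsWithin] with z hz hzD
        simpa using (hM _ (hG.mem hzD)).trans hz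
      -- As `g` is bounded near `p`, only cluster values `w` matter: `(p, w)` is a limit of disc
      -- points, and not in the disc because `p ∉ D`, so it lies on the quadric.
      refine (isCompact_closedBall (0 : ℂ) _).tendsto_nhds_of_unique_mapClusterPt hbd ?_
      intro w _ hw
      obtain ⟨F, hF, hFw⟩ := mapClusterPt_iff_ultrafilter.1 hw
      have hFp : Tendsto id (F : Filter ℂ) (𝓝 p) := hF.trans nhdsWithin_le_nhds
      have hpair : Tendsto (fun z => (z, g z)) (F : Filter ℂ) (𝓝 (p, w)) := hFp.prodMk_nhds hFw
      have hFD : ∀ᶠ z in (F : Filter ℂ), z ∈ D := hF self_mem_nhdsWithin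
      have hwM : ‖w‖ ≤ M * ‖p‖ ^ 2 :=
        le_of_tendsto_of_tendsto hFw.norm ((hFp.norm.pow 2).const_mul M)
          (hFD.mono fun z hz => hM _ (hG.mem hz))
      have hmem := ha (p, w) hpa hwM
      have hcl : (p, w) ∈ closure (discImage Ω f) :=
        mem_closure_of_tendsto hpair (hFD.mono fun z hz => (hG.mem hz).1)
      rcases hf.mem_or_mem_quadric_of_mem_closure hW hcl hmem.2 with h | h
      · exact absurd (hG.of_mem ⟨h, hmem.1⟩).1 hpD
      · exact h
    have h2 : Tendsto (fun z => (psi γ z : ℂ)) (𝓝 p) (𝓝 (psi γ p : ℂ)) :=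
      (Complex.continuous_ofReal.comp (continuous_psi γ)).tendsto p
    have h3 : extendByPsi γ D g p = psi γ p := by simp [extendByPsi, hpD]
    rw [ContinuousWithinAt, h3]
    have h4 : Tendsto (extendByPsi γ D g) (𝓝[D] p) (𝓝 (psi γ p : ℂ)) :=
      h1.congr' (by
        filter_upwards [self_mem_nhdsWithin] with z hz
        simp [extendByPsi, hz])
    have h5 : Tendsto (extendByPsi γ D g) (𝓝[Dᶜ] p) (𝓝 (psi γ p : ℂ)) :=
      (h2.mono_left nhdsWithin_le_nhds).congr' (by
        filter_upwards [self_mem_nhdsWithin] with z hz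
        simp [extendByPsi, show z ∉ D from hz])
    have h6 := h4.sup h5
    rw [← nhdsWithin_union, union_compl_self] at h6
    exact h6.mono_left (nhdsWithin_mono _ (subset_univ _))

/-- A half-disc in the graph of `g₁` gives a function `g₂ ∘ z - w`. -/
theorem extendByPsi_comp {R : ℝ} {z w : ℂ → ℂ} (hL : IsLocalDisc γ ρ R z w) {D : Set ℂ} {g : ℂ → ℂ}
    {a : ℝ} (hg : DifferentiableOn ℂ g D) (h0 : (0 : ℂ) ∉ D)
    (hc : ContinuousOn (extendByPsi γ D g) (closure D ∩ Metric.ball 0 a))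
    (hzD : ∀ s ∈ hd R, z s ∈ D) (hza : ∀ s ∈ chd R, ‖z s‖ < a) {r : ℝ} (hrR : r < R) :
    ContinuousOn (fun s => extendByPsi γ D g (z s) - w s) (chd r) ∧
    DifferentiableOn ℂ (fun s => extendByPsi γ D g (z s) - w s) (hd r) ∧
    extendByPsi γ D g (z 0) - w 0 = 0 := by
  refine ⟨?_, ?_, ?_⟩
  · refine (hc.comp (hL.cont_z.mono (chd_mono hrR.le)) fun s hs => ⟨?_, ?_⟩).sub
      (hL.cont_w.mono (chd_mono hrR.le))
    · exact ((hL.cont_z s (chd_mono hrR.le hs)).mono (hd_subset_chd R)).mem_closure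
        (chd_subset_closure_hd hrR hs) hzD
    · simpa using hza s (chd_mono hrR.le hs)
  · have h1 : DifferentiableOn ℂ (fun s => g (z s) - w s) (hd R) :=
      (hg.comp hL.diff_z hzD).sub hL.diff_w
    refine (h1.mono (hd_mono hrR.le)).congr fun s hs => ?_
    simp [extendByPsi, hzD s (hd_mono hrR.le hs)]
  · rw [hL.w_zero, hL.z_zero]
    simp [extendByPsi, h0, psi]

/-- Two graphs which agree along a half-disc coincide. -/
theorem graph_eq_of_half_disc {U : Set (ℂ × ℂ)} {D₁ D₂ : Set ℂ} {g₁ g₂ : ℂ → ℂ}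
    (hf : IsHyperbolicDisc γ ρ W Ω f) (hf' : IsHyperbolicDisc γ ρ W Ω' f')
    (hg : IsGoodHyperbolicOrigin γ ρ W)
    (h₁ : IsHolomorphicGraph (discImage Ω f ∩ U) D₁ g₁)
    (h₂ : IsHolomorphicGraph (discImage Ω' f' ∩ U) D₂ g₂) (hD : D₁ ⊆ D₂)
    {R : ℝ} {z w : ℂ → ℂ} (hL : IsLocalDisc γ ρ R z w)
    (hz : ∀ s ∈ hd R, z s ∈ D₁ ∧ g₁ (z s) = w s) (heq : ∀ s ∈ hd R, g₂ (z s) = w s) :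
    discImage Ω f ∩ U = discImage Ω' f' ∩ U := by
  have hRp := hL.pos
  have hpt : ((R / 2 : ℝ) : ℂ) * Complex.I ∈ hd R := I_mul_mem_hd (half_pos hRp) (half_lt_self hRp)
  have hopen : IsOpen (z '' hd R) := by
    rcases (hL.diff_z.analyticOnNhd (isOpen_hd R)).is_constant_or_isOpen
      (convex_hd R).isPreconnected with ⟨c, hc⟩ | h
    · exfalso
      have h1 := ((hL.cont_z 0 (zero_mem_chd hRp.le)).mono (hd_subset_chd R)).mem_closure (t := {c})
        (chd_subset_closure_hd (half_lt_self hRp) (zero_mem_chd (half_pos hRp).le)) hc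
      rw [closure_singleton, mem_singleton_iff, hL.z_zero] at h1
      refine hL.z_ne _ (hd_subset_chd R hpt) (fun h0 => ?_) ((hc _ hpt).trans h1.symm)
      have := hpt.2
      rw [h0] at this
      simp at this
    · exact h _ Subset.rfl (isOpen_hd R)
  have hEq : EqOn g₁ g₂ D₁ := by
    refine (h₁.holomorphic.analyticOnNhd h₁.isOpen).eqOn_of_preconnected_of_eventuallyEq
      ((h₂.holomorphic.mono hD).analyticOnNhd h₁.isOpen) h₁.isConnected.isPreconnected
      (hz _ hpt).1 ?_
    filter_upwards [hopen.mem_nhds ⟨_, hpt, rfl⟩] with x hx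
    obtain ⟨s, hs, rfl⟩ := hx
    rw [(hz s hs).2, heq s hs]
  -- `D₂` is connected, and `D₁` is relatively closed in it: over a limit point in `D₂` the second
  -- disc has `ρ < 0`, which excludes the quadric.
  have hDD : D₂ ⊆ D₁ := by
    refine h₂.isConnected.isPreconnected.subset_of_closure_inter_subset h₁.isOpen
      ⟨_, hD (hz _ hpt).1, (hz _ hpt).1⟩ ?_
    rintro p ⟨hpcl, hpD⟩
    have hy := h₂.mem hpD
    have hc : ContinuousWithinAt (fun x => (x, g₂ x)) D₁ p :=
      (continuousAt_id.prodMk (h₂.holomorphic.differentiableAt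
        (h₂.isOpen.mem_nhds hpD)).continuousAt).continuousWithinAt
    have hcl : (p, g₂ p) ∈ closure (discImage Ω f) := hc.mem_closure hpcl fun x hx => by
      have := (h₁.mem hx).1
      rwa [hEq hx] at this
    have hW := hf'.discImage_subset hy.1
    rcases hf.mem_or_mem_quadric_of_mem_closure hg.isOpen hcl hW with h | h
    · exact (h₁.of_mem ⟨h, hy.2⟩).1
    · have := hf'.neg_of_mem_discImage hy.1
      rw [hg.quadric_subset _ hW h] at this
      exact absurd this (lt_irrefl _)
  rw [h₁.eq_graph, h₂.eq_graph, ← Subset.antisymm hD hDD]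
  exact image_congr fun x hx => by rw [hEq hx]

/-- One half-disc of the first disc, at a single zero `ζ`, suffices. The second disc needs estimates
on its whole part near the origin, since `(z(s), g₂(z(s)))` may belong to any of its half-discs. -/
theorem discImage_inter_eq {δ₀ K M M' : ℝ} {U : Set (ℂ × ℂ)} {D₁ D₂ : Set ℂ} {g₁ g₂ : ℂ → ℂ}
    (hf : IsHyperbolicDisc γ ρ W Ω f) (hf' : IsHyperbolicDisc γ ρ W Ω' f')
    (hg : IsGoodHyperbolicOrigin γ ρ W) (hδ₀ : 0 < δ₀) (hW : Metric.ball 0 δ₀ ⊆ W)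
    (hne : ∀ y ∈ discImage Ω f, ‖y‖ < δ₀ → y.1 ≠ 0)
    (hne' : ∀ y ∈ discImage Ω' f', ‖y‖ < δ₀ → y.1 ≠ 0)
    (hM : ∀ y ∈ discImage Ω f, ‖y‖ < δ₀ → ‖y.2‖ ≤ M * ‖y.1‖ ^ 2)
    (hM' : ∀ y ∈ discImage Ω' f', ‖y‖ < δ₀ → ‖y.2‖ ≤ M' * ‖y.1‖ ^ 2)
    (hM0 : 0 < M) (hM0' : 0 < M') (hK0 : 0 < K)
    (hK : ∀ p : ℂ × ℂ, ‖p‖ < δ₀ → |ρ p| ≤ K * ‖p.2 - (psi γ p.1 : ℂ)‖)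
    (hUV : U ⊆ Metric.ball 0 δ₀) (hU : IsOpen U) (hU0 : (0 : ℂ × ℂ) ∈ U)
    (h₁ : IsHolomorphicGraph (discImage Ω f ∩ U) D₁ g₁)
    (h₂ : IsHolomorphicGraph (discImage Ω' f' ∩ U) D₂ g₂)
    (hcond : D₁ = D₂ ∨ (D₁ ⊆ D₂ ∧ ∀ z ∈ D₁, (g₁ z).re ≤ (g₂ z).re)) :
    discImage Ω f ∩ U = discImage Ω' f' ∩ U := by
  have hD : D₁ ⊆ D₂ := hcond.elim (fun h => h.subset) (fun h => h.1)
  have hlt : ∀ y ∈ U, ‖y‖ < δ₀ := fun y hy => by simpa using hUV hy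
  obtain ⟨ζ, hζ, hζ0⟩ := hf.touches
  obtain ⟨R₀, hR₀Ω, hL₀⟩ := hf.exists_isLocalDisc hg hδ₀ hne hζ hζ0
  set z : ℂ → ℂ := fun s => (f (cayley ζ s)).1 with hz
  set w : ℂ → ℂ := fun s => (f (cayley ζ s)).2 with hw
  obtain ⟨δ₁, hδ₁, hballU⟩ := Metric.mem_nhds_iff.1 (hU.mem_nhds hU0)
  -- a bound on `‖z‖` which forces graphs to stay in a given ball
  have hsmall : ∀ δ > 0, ∃ a > 0, ∀ p : ℂ × ℂ, ‖p.1‖ < a → ‖p.2‖ ≤ M' * ‖p.1‖ ^ 2 → ‖p‖ < δ := by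
    intro δ hδ
    refine ⟨min 1 (δ / (M' + 1)), lt_min one_pos (by positivity), fun p hp1 hp2 => ?_⟩
    have e1 := hp1.trans_le (min_le_left _ _)
    have e2 := hp1.trans_le (min_le_right _ _)
    rw [lt_div_iff₀ (by positivity)] at e2
    have e3 := norm_nonneg p.1
    rw [Prod.norm_def]
    refine max_lt ?_ ?_ <;> nlinarith
  obtain ⟨a, ha, haU⟩ := hsmall δ₁ hδ₁
  obtain ⟨R, hR, hRR₀, hRs⟩ := hL₀.exists_small (lt_min hδ₁ ha)
  have hL := hL₀.mono hR hRR₀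
  have hzD : ∀ s ∈ hd R, z s ∈ D₁ ∧ g₁ (z s) = w s := by
    intro s hs
    have hs' := hd_subset_chd R hs
    refine h₁.of_mem (y := f (cayley ζ s)) ⟨⟨_, ⟨hR₀Ω s (chd_mono hRR₀ hs'), ?_⟩, rfl⟩, hballU ?_⟩
    · simpa using norm_cayley_lt_one (hf.norm_eq_one_of_apply_eq_zero hg hζ hζ0) hs.2
    · exact mem_ball_zero_iff.2 ((hRs s hs').trans_le (min_le_left _ _))
  have hza : ∀ s ∈ chd R, ‖z s‖ < a := fun s hs =>
    (le_max_left _ _).trans_lt ((hRs s hs).trans_le (min_le_right _ _))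
  have h0D : (0 : ℂ) ∉ D₂ := fun h => hne' _ (h₂.mem h).1 (hlt _ (h₂.mem h).2) rfl
  have hMU : ∀ y ∈ discImage Ω' f' ∩ U, ‖y.2‖ ≤ M' * ‖y.1‖ ^ 2 := fun y hy =>
    hM' y hy.1 (hlt y hy.2)
  have hG := continuousOn_extendByPsi hf' h₂ hg.isOpen hMU (a := a) fun p h1 h2 => by
    have : p ∈ U := hballU (by simpa using haU p h1 h2)
    exact ⟨this, hW (hUV this)⟩
  obtain ⟨hhc, hhd, hh0⟩ := extendByPsi_comp hL h₂.holomorphic h0D hG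
    (fun s hs => hD (hzD s hs).1) hza (half_lt_self hR)
  set h : ℂ → ℂ := fun s => extendByPsi γ D₂ g₂ (z s) - w s with hh
  have hin : ∀ s, z s ∈ D₂ → h s = g₂ (z s) - w s := fun s hs => by simp [hh, extendByPsi, hs]
  have hR2 : 0 < R / 2 := half_pos hR
  have hhd2 : hd (R / 2) ⊆ hd R := hd_mono (by linarith)
  suffices hzero : ∀ s ∈ hd (R / 2), h s = 0 by
    refine graph_eq_of_half_disc hf hf' hg h₁ h₂ hD (hL.mono hR2 (by linarith))
      (fun s hs => hzD s (hhd2 hs)) fun s hs => ?_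
    have := hzero s hs
    rwa [hin s (hD (hzD s (hhd2 hs)).1), sub_eq_zero] at this
  have hnotin : ∀ s ∈ chd R, s.im = 0 → z s ∉ D₂ → h s = 0 := fun s hs him hs2 => by
    simp only [hh, extendByPsi, hs2, if_false]
    rw [hL.flat s hs him, sub_self]
  rcases hcond with rfl | ⟨-, hre⟩
  -- A flat point over the common domain would lie on the graph by continuity, hence in `ρ < 0`, yet
  -- it lies on the quadric. So flat points project outside the domain, where `h = 0`.
  · refine eq_zero_of_flat_eq_zero hR2 hhc hhd fun s hs hs0 => ?_
    have hsR := chd_mono (by linarith : R / 2 ≤ R) hs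
    refine hnotin s hsR hs0 fun hsD => ?_
    have hcs : ContinuousWithinAt (fun s => g₁ (z s) - w s) (hd R) s :=
      ((h₁.holomorphic.differentiableAt (h₁.isOpen.mem_nhds hsD)).continuousAt.comp_continuousWithinAt
        ((hL.cont_z s hsR).mono (hd_subset_chd R))).sub ((hL.cont_w s hsR).mono (hd_subset_chd R))
    have hcl := hcs.mem_closure (t := {0}) (chd_subset_closure_hd (half_lt_self hR) hs)
      fun s' hs' => sub_eq_zero.2 (hzD s' hs').2
    rw [closure_singleton, mem_singleton_iff, sub_eq_zero, hL.flat s hsR hs0] at hcl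
    have hy := (h₁.mem hsD).1
    have := hf.neg_of_mem_discImage hy
    rw [hg.quadric_subset _ (hf.discImage_subset hy) hcl] at this
    exact lt_irrefl _ this
  · have hpt : ∀ t : ℝ, 0 < t → t ≤ R / 2 → (t : ℂ) * Complex.I ∈ hd R := fun t h1 h2 =>
      I_mul_mem_hd h1 (by linarith)
    obtain ⟨n, hn, r₀, C, hr₀, hr₀R, hC, hpow⟩ := hL.exists_pow_le_sqrt hg
    -- `|h| ≤ (M + M') |z|²` and `|z|ⁿ ≤ C √t` on the imaginary axis give this constant.
    refine eq_zero_of_flat_im_le hR2 hhc hhd hh0 (n := n) (C := (M + M') ^ n * C ^ 2)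
      (r₀ := min r₀ (R / 2)) ?_ ?_ (lt_min hr₀ hR2) ?_
    · intro s hs
      rw [hin s (hD (hzD s (hhd2 hs)).1), ← (hzD s (hhd2 hs)).2, Complex.sub_re, sub_nonneg]
      exact hre _ (hzD s (hhd2 hs)).1
    · intro ε hε
      -- On the flat part `Im h = Im g₂`, and `-ρ ≤ K |g₂ - ψ| = K |h|`; hence `ε / K`.
      obtain ⟨δ₂, hδ₂, him⟩ := hf'.exists_abs_im_snd_le hg hδ₀ hne' (div_pos hε hK0)
      obtain ⟨a', ha', haδ⟩ := hsmall δ₂ hδ₂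
      obtain ⟨r, hr, hrR, hrs⟩ := hL.exists_small ha'
      refine ⟨r, hr, fun s hs hs0 => ?_⟩
      have hsR := chd_mono hrR hs
      by_cases hsD : z s ∈ D₂
      · have hy := h₂.mem hsD
        have e1 := him _ hy.1 (haδ _ ((le_max_left _ _).trans_lt (hrs s hs)) (hMU _ hy))
        have e2 := hK _ (hlt _ hy.2)
        rw [hin s hsD]
        have e3 : w s = (psi γ (z s) : ℂ) := hL.flat s hsR hs0
        rw [e3, Complex.sub_im, Complex.ofReal_im, sub_zero]
        refine e1.trans ?_
        calc ε / K * -ρ (z s, g₂ (z s)) ≤ ε / K * (K * ‖g₂ (z s) - (psi γ (z s) : ℂ)‖) := by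
              gcongr
              exact (neg_le_abs _).trans e2
          _ = _ := by field_simp
      · rw [hnotin s hsR hs0 hsD]
        simp
    · intro t ht0 htr
      have hp := hpow t ht0 (htr.trans (min_le_left _ _))
      have hs := hpt t ht0 (htr.trans (min_le_right _ _))
      set s : ℂ := t * Complex.I
      have hsD := hzD s hs
      have hy₁ := h₁.mem hsD.1
      have hy₂ := h₂.mem (hD hsD.1)
      have e1 := hM _ hy₁.1 (hlt _ hy₁.2)
      have e2 := hMU _ hy₂
      have e3 : ‖h s‖ ≤ (M + M') * ‖z s‖ ^ 2 := by
        rw [hin s (hD hsD.1), ← hsD.2]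
        refine (norm_sub_le _ _).trans ?_
        dsimp only at e1 e2
        linarith
      calc ‖h s‖ ^ n ≤ ((M + M') * ‖z s‖ ^ 2) ^ n := by gcongr
        _ = (M + M') ^ n * (‖z s‖ ^ n) ^ 2 := by rw [mul_pow, ← pow_mul, ← pow_mul, mul_comm 2]
        _ ≤ (M + M') ^ n * (C * Real.sqrt t) ^ 2 := by gcongr
        _ = _ := by rw [mul_pow, Real.sq_sqrt ht0.le]; ring

end HyperbolicDiscs

theorem mainTheorem6 (γ : ℝ) (ρ : ℂ × ℂ → ℝ) (W : Set (ℂ × ℂ))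
    (hgood : HyperbolicDiscs.IsGoodHyperbolicOrigin γ ρ W)
    (Ω₁ Ω₂ : Set ℂ) (f₁ f₂ : ℂ → ℂ × ℂ)
    (hf₁ : HyperbolicDiscs.IsHyperbolicDisc γ ρ W Ω₁ f₁)
    (hf₂ : HyperbolicDiscs.IsHyperbolicDisc γ ρ W Ω₂ f₂) :
    ∃ V ∈ 𝓝 (0 : ℂ × ℂ), ∀ U ⊆ V, IsOpen U → (0 : ℂ × ℂ) ∈ U →
      ∀ (D₁ D₂ : Set ℂ) (g₁ g₂ : ℂ → ℂ),
        HyperbolicDiscs.IsHolomorphicGraph (HyperbolicDiscs.discImage Ω₁ f₁ ∩ U) D₁ g₁ →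
        HyperbolicDiscs.IsHolomorphicGraph (HyperbolicDiscs.discImage Ω₂ f₂ ∩ U) D₂ g₂ →
        (D₁ = D₂ ∨ (D₁ ⊆ D₂ ∧ ∀ z ∈ D₁, (g₁ z).re ≤ (g₂ z).re)) →
        HyperbolicDiscs.discImage Ω₁ f₁ ∩ U = HyperbolicDiscs.discImage Ω₂ f₂ ∩ U := by
  -- `V` is chosen before the graphs are given, but the estimates need projections avoiding `0` near
  -- the origin. If this fails for one of the discs, no admissible `U` makes it a graph and `V =
  -- univ` works vacuously.
  by_cases hex : (∃ δ > 0, ∀ y ∈ HyperbolicDiscs.discImage Ω₁ f₁, ‖y‖ < δ → y.1 ≠ 0) ∧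
      ∃ δ > 0, ∀ y ∈ HyperbolicDiscs.discImage Ω₂ f₂, ‖y‖ < δ → y.1 ≠ 0
  swap
  · refine ⟨univ, univ_mem, fun U _ hU hU0 D₁ D₂ g₁ g₂ h₁ h₂ _ => absurd ?_ hex⟩
    exact ⟨hf₁.exists_fst_ne_zero hgood (hU.mem_nhds hU0) h₁,
      hf₂.exists_fst_ne_zero hgood (hU.mem_nhds hU0) h₂⟩
  obtain ⟨⟨δ₁, hδ₁, hne₁⟩, δ₂, hδ₂, hne₂⟩ := hex
  obtain ⟨M₁, hM₁, δ₃, hδ₃, hb₁⟩ := hf₁.exists_norm_snd_le hgood hδ₁ hne₁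
  obtain ⟨M₂, hM₂, δ₄, hδ₄, hb₂⟩ := hf₂.exists_norm_snd_le hgood hδ₂ hne₂
  obtain ⟨K, hK, δ₅, hδ₅, hρ⟩ := hgood.abs_apply_le
  obtain ⟨δ₆, hδ₆, hW⟩ := Metric.mem_nhds_iff.1 (hgood.isOpen.mem_nhds hgood.zero_mem)
  obtain ⟨δ, hδ, hlt⟩ : ∃ δ > 0, δ ≤ δ₁ ∧ δ ≤ δ₂ ∧ δ ≤ δ₃ ∧ δ ≤ δ₄ ∧ δ ≤ δ₅ ∧ δ ≤ δ₆ :=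
    ⟨min δ₁ (min δ₂ (min δ₃ (min δ₄ (min δ₅ δ₆)))), by positivity, by simp⟩
  obtain ⟨l₁, l₂, l₃, l₄, l₅, l₆⟩ := hlt
  refine ⟨Metric.ball 0 δ, Metric.ball_mem_nhds _ hδ,
    fun U hUV hU hU0 D₁ D₂ g₁ g₂ h₁ h₂ hcond => ?_⟩
  exact HyperbolicDiscs.discImage_inter_eq hf₁ hf₂ hgood hδ ((Metric.ball_subset_ball l₆).trans hW)
    (fun y hy h => hne₁ y hy (h.trans_le l₁)) (fun y hy h => hne₂ y hy (h.trans_le l₂))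
    (fun y hy h => hb₁ y hy (h.trans_le l₃)) (fun y hy h => hb₂ y hy (h.trans_le l₄))
    hM₁ hM₂ hK (fun p h => hρ p (h.trans_le l₅)) hUV hU hU0 h₁ h₂ hcond
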